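/- Let $n\ge 1$ and let $S=\{(x,y,z)\in\mathbb C^3 : x^{n+1}=yz\}=\mathbb C^2/G$, where $G$ is the cyclic group of order $n+1$ generated by $\operatorname{diag}(\zeta^{-1},\zeta)$, $\zeta=e^{2\pi i/(n+1)}$, and the quotient map is $q(w_1,w_2)=(w_1w_2,\,w_1^{n+1},\,w_2^{n+1})$. Let $X\to S$ be its minimal resolution, realized as the set of all $((x,y,z),[a_1:b_1],\dots,[a_n:b_n])\in\mathbb C^3\times(\mathbb P^1)^n$ with $a_ib_{i+1}x=a_{i+1}b_i$ for $0\le i\le n$, where $a_0=1$, $a_{n+1}=y$, $b_0=z$, $b_{n+1}=1$. Let $E\subset X$ be the exceptional set, the fibre over $0$; it is a chain of $(-2)$-curves $E_1,\dots,E_n$. Let $\eta$ be the nowhere vanishing holomorphic $2$-form on $X$ induced, up to a nonzero constant, by $dw_1\wedge dw_2$ on $\mathbb C^2$. Let $f:(X,E)\to(X,E)$ be an automorphism, i.e. a biholomorphism between neighbourhoods of $E$ with $f(E)=E$. Suppose that $f$ has trivial symmetry, i.e. $f(E_i)=E_i$ for all $i$, and that $f^*\eta=\delta\,\eta$ with a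 constant $\delta\in\mathbb C$ that is not a root of unity. Fix a square root $\delta^{1/2}$ of $\delta$ and put $\hat\tau:=\delta^{1/2}+\delta^{-1/2}$. The map of $(S,0)$ induced by $f$ lifts through $q$ to a holomorphic map $F:(\mathbb C^2,0)\to(\mathbb C^2,0)$; suppose that the eigenvalues of $F'(0)$, with multiplicity, are $\alpha_1=\delta^{1/2}\alpha$ and $\alpha_2=\delta^{1/2}\alpha^{-1}$ with $\alpha\in\mathbb C^\times$ (the multipliers of $E$). Put $\gamma_j:=\alpha_1^{\,j}\alpha_2^{\,j-n-1}=\delta^{(2j-n-1)/2}\alpha^{n+1}$ for $0\le j\le n+1$. Since the $\gamma_j$ are distinct, exactly one of the following holds: (C1) $\gamma_j\ne1$ for all $j=0,\dots,n+1$; (C2) $\gamma_i=1$ for a unique $i\in\{1,\dots,n\}$; (C3) $\gamma_0=1$ or $\gamma_{n+1}=1$. Let $H_m$ and $K_m$ $(m\ge0)$ be the polynomials with $H_m(t+t^{-1})=t^m+t^{-m}$ and $(t-t^{-1})K_m(t+t^{-1})=t^{m+1}-t^{-(m+1)}$. Let $\operatorname{Fix}^{\mathrm i}(f,E)$ be the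 set of isolated points of the fixed point set of $f|_E$, and let $N(f,E)$ be the number of curves $E_i$ that are fixed pointwise by $f$. For $p\in\operatorname{Fix}^{\mathrm i}(f,E)$, with $f=(f_1,f_2)$ in local coordinates $t=(t_1,t_2)$ of $X$ centred at $p$, put $$\mu(f,p)=\dim_{\mathbb C}\mathbb C\{t\}/(t_1-f_1,\,t_2-f_2)\in\mathbb N\cup\{\infty\},\qquad \nu(f,p)=\operatorname{Res}_p\frac{dt_1\wedge dt_2}{(t_1-f_1)(t_2-f_2)},$$ where the Grothendieck residue $\nu(f,p)$ is considered when $\mu(f,p)<\infty$, and $$\mu(f,E)=\sum_{p\in\operatorname{Fix}^{\mathrm i}(f,E)}\mu(f,p)+2N(f,E),\qquad \hat\nu(f,E)=\sum_{p\in\operatorname{Fix}^{\mathrm i}(f,E)}\delta^{1/2}\nu(f,p)+N(f,E)\,\delta^{1/2}\frac{\delta+1}{(\delta-1)^2}.$$ Then $\operatorname{Fix}^{\mathrm i}(f,E)$ is finite, and the following hold, where the denominators do not vanish. In case (C1), $$\mu(f,E)=n+1,\qquad \hat\nu(f,E)=\frac{K_n(\hat\tau)}{H_{n+1}(\hat\tau)-\{\alpha^{n+1}+\alpha^{-(n+1)}\}}.$$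 In case (C2), with $\gamma_i=1$, $$\mu(f,E)=n+1,\qquad \hat\nu(f,E)=\frac{K_n(\hat\tau)}{(H_2(\hat\tau)-2)\,K_{i-1}(\hat\tau)\,K_{n-i}(\hat\tau)}.$$ In case (C3), $\mu(f,E)\ge n+2$. -/

import Mathlib

/-!
Automorphisms near the exceptional set of the minimal resolution of an `A_n` singularity,
and their topological and holomorphic fixed point indices along the exceptional set.
-/

open Filter Topology

noncomputable section

namespace AnResolution

/-! ### The minimal resolution and its atlas -/

/-- The projective line `ℙ¹` over `ℂ`. -/
abbrev P1 : Type := Projectivization ℂ (Fin 2 → ℂ)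

/-- `IsHom a b q` says that `[a : b]` are homogeneous coordinates of `q`. -/
def IsHom (a b : ℂ) (q : P1) : Prop :=
  ∃ h : (![a, b] : Fin 2 → ℂ) ≠ 0, Projectivization.mk ℂ ![a, b] h = q

/-- The point `[1 : v]`. -/
def affV (v : ℂ) : P1 := Projectivization.mk ℂ ![1, v] (fun h => one_ne_zero (congrFun h 0))

/-- The point `[u : 1]`. -/
def affU (u : ℂ) : P1 := Projectivization.mk ℂ ![u, 1] (fun h => one_ne_zero (congrFun h 1))

/-- The minimal resolution of the singularity `x^(n+1) = y z` of type `A_n`: the set of all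
`((x, y, z), [a_1 : b_1], …, [a_n : b_n])` in `ℂ³ × (ℙ¹)ⁿ` with
`a_i b_{i+1} x = a_{i+1} b_i` for `0 ≤ i ≤ n`, where `a_0 = 1`, `a_{n+1} = y`, `b_0 = z`,
`b_{n+1} = 1`. The equations are homogeneous, so they do not depend on the homogeneous
coordinates. The `j`-th factor `[a_j : b_j]`, `1 ≤ j ≤ n`, has index `j - 1 : Fin n`. -/
def X (n : ℕ) : Type :=
  {p : (ℂ × ℂ × ℂ) × (Fin n → P1) //
    ∃ a b : ℕ → ℂ, a 0 = 1 ∧ a (n + 1) = p.1.2.1 ∧ b 0 = p.1.2.2 ∧ b (n + 1) = 1 ∧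
      (∀ j : Fin n, IsHom (a (j + 1)) (b (j + 1)) (p.2 j)) ∧
      ∀ i ≤ n, a i * b (i + 1) * p.1.1 = a (i + 1) * b i}

variable {n : ℕ}

/-- The resolution map `X → S = {x^(n+1) = y z} ⊆ ℂ³`. -/
def toS (p : X n) : ℂ × ℂ × ℂ := p.1.1

/-- The exceptional set: the fibre over the singular point. -/
def exc (n : ℕ) : Set (X n) := {p | toS p = 0}

/-- The `(-2)`-curve `E_{i+1}`, `i : Fin n`: the points over the singular point whose homogeneous
coordinates are `[1 : 0]` in the factors before the `(i+1)`-st one and `[0 : 1]` in the factors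
after it. -/
def curve (i : Fin n) : Set (X n) :=
  {p | toS p = 0 ∧ (∀ j < i, p.1.2 j = affV 0) ∧ ∀ j, i < j → p.1.2 j = affU 0}

/-- The inverse `ℂ² → W_{k+1} ⊆ X` of the coordinate system
`(u, v) = (u_{k+1}, v_k) = (a_{k+1} / b_{k+1}, b_k / a_k)`, for `0 ≤ k ≤ n`. The images of these
`n + 1` maps form the holomorphic atlas of the surface `X`; the `j`-th factor is `[1 : v_j]` for
`j ≤ k` and `[u_j : 1]` for `j > k`, where `v_j = u^(k-j) v^(k+1-j)`, `u_j = u^(j-k) v^(j-k-1)`. -/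
def chart (k : Fin (n + 1)) (w : ℂ × ℂ) : X n :=
  ⟨((w.1 * w.2, w.1 ^ (n + 1 - k : ℕ) * w.2 ^ (n - k : ℕ), w.1 ^ (k : ℕ) * w.2 ^ (k + 1 : ℕ)),
    fun j => if (j : ℕ) + 1 ≤ k then affV (w.1 ^ (k - (j + 1) : ℕ) * w.2 ^ (k + 1 - (j + 1) : ℕ))
      else affU (w.1 ^ (j + 1 - k : ℕ) * w.2 ^ (j + 1 - k - 1 : ℕ))), by
    have hk := k.is_lt
    refine ⟨fun j => if j ≤ (k : ℕ) then 1 else w.1 ^ (j - k : ℕ) * w.2 ^ (j - k - 1 : ℕ),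
      fun j => if j ≤ (k : ℕ) then w.1 ^ (k - j : ℕ) * w.2 ^ (k + 1 - j : ℕ) else 1,
      by simp, ?_, by simp, ?_, ?_, ?_⟩
    · have h1 : ¬ n + 1 ≤ (k : ℕ) := by omega
      have h2 : n + 1 - (k : ℕ) - 1 = n - k := by omega
      simp [h1, h2]
    · have h1 : ¬ n + 1 ≤ (k : ℕ) := by omega
      simp [h1]
    · intro j
      by_cases h : (j : ℕ) + 1 ≤ k
      · simp only [h, if_true]
        exact ⟨_, rfl⟩
      · simp only [h, if_false]
        exact ⟨_, rfl⟩
    · intro i hi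
      rcases lt_trichotomy i (k : ℕ) with h | h | h
      · obtain ⟨d, hd⟩ : ∃ d, (k : ℕ) = i + 1 + d := ⟨k - (i + 1), by omega⟩
        have e1 : (k : ℕ) - (i + 1) = d := by omega
        have e2 : (k : ℕ) + 1 - (i + 1) = d + 1 := by omega
        have e3 : (k : ℕ) - i = d + 1 := by omega
        have e4 : (k : ℕ) + 1 - i = d + 2 := by omega
        simp only [h.le, Nat.succ_le_of_lt h, if_true, e1, e2, e3, e4]
        ring
      · subst h
        simp
      · obtain ⟨d, hd⟩ : ∃ d, i = (k : ℕ) + 1 + d := ⟨i - (k + 1), by omega⟩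
        have h1 : ¬ i ≤ (k : ℕ) := by omega
        have h2 : ¬ i + 1 ≤ (k : ℕ) := by omega
        have e1 : i - (k : ℕ) = d + 1 := by omega
        have e2 : i + 1 - (k : ℕ) = d + 2 := by omega
        have e3 : d + 2 - 1 = d + 1 := rfl
        simp only [h1, h2, if_false, e1, e2, e3, Nat.add_sub_cancel]
        ring⟩

/-! ### Automorphisms of the pair `(X, E)` -/

/-- `F` is a local representation of `f : X → X` around `a ∈ ℂ²` with respect to the charts `k`
(source) and `l` (target): it is holomorphic at `a` and `f (chart k w) = chart l (F w)` near `a`. -/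
def IsLocalRep (f : X n → X n) (k l : Fin (n + 1)) (a : ℂ × ℂ) (F : ℂ × ℂ → ℂ × ℂ) : Prop :=
  AnalyticAt ℂ F a ∧ ∀ᶠ w in 𝓝 a, f (chart k w) = chart l (F w)

/-- `f` is holomorphic in a neighbourhood of the exceptional set. -/
def HolomorphicNearExc (f : X n → X n) : Prop :=
  ∀ (k : Fin (n + 1)) (a : ℂ × ℂ), chart k a ∈ exc n → ∃ l F, IsLocalRep f k l a F

/-- Two maps agree in a neighbourhood of the exceptional set. -/
def EqNearExc (f g : X n → X n) : Prop :=
  ∀ (k : Fin (n + 1)) (a : ℂ × ℂ), chart k a ∈ exc n →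
    ∀ᶠ w in 𝓝 a, f (chart k w) = g (chart k w)

/-- `f` represents an automorphism `(X, E) → (X, E)`: it is a biholomorphism between neighbourhoods
of the exceptional set `E` that maps `E` to `E`. Only the germ of `f` along `E` matters; the values
elsewhere are arbitrary. -/
def IsAut (f : X n → X n) : Prop :=
  HolomorphicNearExc f ∧ Set.MapsTo f (exc n) (exc n) ∧
    ∃ g : X n → X n, HolomorphicNearExc g ∧ Set.MapsTo g (exc n) (exc n) ∧
      EqNearExc (g ∘ f) id ∧ EqNearExc (f ∘ g) id

/-- `f` induces the trivial automorphism of the Dynkin diagram: every `(-2)`-curve is mapped onto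
itself. -/
def HasTrivialSymmetry (f : X n → X n) : Prop := ∀ i : Fin n, f '' curve i = curve i

/-- `f` has twist number `δ`: `f^* η = δ η` for the standard nowhere vanishing holomorphic
`2`-form `η` on `X`, the lift of the Poincaré residue of `dx ∧ dy ∧ dz` on `S`, which is induced
(up to a nonzero constant) by `dw₁ ∧ dw₂` on `ℂ²`. As `dx ∧ dz / z = du ∧ dv` in every chart,
`η` is `du ∧ dv` in every chart up to one constant, so that the equation says that the Jacobian
determinant of `f` in charts is `δ`. -/
def HasTwist (f : X n → X n) (δ : ℂ) : Prop :=
  ∀ (k l : Fin (n + 1)) (a : ℂ × ℂ) (F : ℂ × ℂ → ℂ × ℂ), chart k a ∈ exc n →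
    IsLocalRep f k l a F → ∀ᶠ w in 𝓝 a, (fderiv ℂ F w).det = δ

/-- The quotient map `ℂ² → S = ℂ² / G`, where `G` is the cyclic group of order `n + 1` generated by
`diag(ζ⁻¹, ζ)`, `ζ = exp(2πi/(n+1))`. -/
def quot (n : ℕ) (w : ℂ × ℂ) : ℂ × ℂ × ℂ := (w.1 * w.2, w.1 ^ (n + 1), w.2 ^ (n + 1))

/-- `F : (ℂ², 0) → (ℂ², 0)` is a lift of `f`: collapsing `E` turns `f` into a map of `(S, 0)`,
which is also the map induced by `F` through the quotient `ℂ² → S`. -/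
def IsLift (f : X n → X n) (F : ℂ × ℂ → ℂ × ℂ) : Prop :=
  AnalyticAt ℂ F 0 ∧ F 0 = 0 ∧
    ∀ᶠ w in 𝓝 (0 : ℂ × ℂ), ∀ p : X n, toS p = quot n w → toS (f p) = quot n (F w)

/-- `(α₁, α₂)` are multipliers of `f` at `E`: the eigenvalues, with multiplicity, of the Jacobian
matrix `F'(0)` of a lift `F` of `f`. -/
def HasMultipliers (f : X n → X n) (α₁ α₂ : ℂ) : Prop :=
  ∃ F : ℂ × ℂ → ℂ × ℂ, IsLift f F ∧
    LinearMap.charpoly (fderiv ℂ F 0 : (ℂ × ℂ) →ₗ[ℂ] (ℂ × ℂ)) =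
      (Polynomial.X - Polynomial.C α₁) * (Polynomial.X - Polynomial.C α₂)

/-! ### Intersection multiplicity and Grothendieck residue in `ℂ²` -/

/-- The algebra of functions on `ℂ²` that are holomorphic at `a`; modulo the functions that vanish
near `a` it is the ring `ℂ{z₁, z₂}` of convergent power series at `a`. -/
def holAt (a : ℂ × ℂ) : Subalgebra ℂ (ℂ × ℂ → ℂ) where
  carrier := {h | AnalyticAt ℂ h a}
  mul_mem' := fun h₁ h₂ => AnalyticAt.mul h₁ h₂
  add_mem' := fun h₁ h₂ => AnalyticAt.add h₁ h₂
  algebraMap_mem' := fun _ => analyticAt_const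

/-- The ideal generated by the germs of `g₁` and `g₂` at `a`. -/
def germIdeal (g₁ g₂ : ℂ × ℂ → ℂ) (a : ℂ × ℂ) : Ideal (holAt a) where
  carrier := {h | ∃ c₁ ∈ holAt a, ∃ c₂ ∈ holAt a,
    ∀ᶠ w in 𝓝 a, h.1 w = c₁ w * g₁ w + c₂ w * g₂ w}
  zero_mem' := ⟨0, zero_mem _, 0, zero_mem _, by simp⟩
  add_mem' := by
    rintro h h' ⟨c₁, hc₁, c₂, hc₂, H⟩ ⟨c₁', hc₁', c₂', hc₂', H'⟩
    refine ⟨c₁ + c₁', add_mem hc₁ hc₁', c₂ + c₂', add_mem hc₂ hc₂', ?_⟩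
    filter_upwards [H, H'] with w hw hw'
    simp only [Subalgebra.coe_add, Pi.add_apply, hw, hw']
    ring
  smul_mem' := by
    rintro r h ⟨c₁, hc₁, c₂, hc₂, H⟩
    refine ⟨r.1 * c₁, mul_mem r.2 hc₁, r.1 * c₂, mul_mem r.2 hc₂, ?_⟩
    filter_upwards [H] with w hw
    simp only [smul_eq_mul, Subalgebra.coe_mul, Pi.mul_apply, hw]
    ring

/-- `dim_ℂ ℂ{z}/(g₁, g₂)` at the point `a`, possibly infinite. -/
def interMult (g₁ g₂ : ℂ × ℂ → ℂ) (a : ℂ × ℂ) : ℕ∞ :=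
  Cardinal.toENat (Module.rank ℂ (holAt a ⧸ germIdeal g₁ g₂ a))

/-- The coefficient of `(z₁ - a₁)^i (z₂ - a₂)^j` in the Taylor series of `h` at `a`. -/
def taylorCoeff (h : ℂ × ℂ → ℂ) (a : ℂ × ℂ) (i j : ℕ) : ℂ :=
  iteratedDeriv i (fun s => iteratedDeriv j (fun t => h (s, t)) a.2) a.1 /
    ((i.factorial : ℂ) * (j.factorial : ℂ))

/-- `r` is the Grothendieck residue at `a` of `dz₁ ∧ dz₂ / (g₁ g₂)`: if
`(z_i - a_i)^(N+1) = c_{i1} g₁ + c_{i2} g₂` near `a` for `i = 1, 2` with holomorphic `c_{ij}`, then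
the residue is that of `det(c_{ij}) dz₁ ∧ dz₂ / ((z₁ - a₁)^(N+1) (z₂ - a₂)^(N+1))`, which is the
coefficient of `(z₁ - a₁)^N (z₂ - a₂)^N` in `det(c_{ij})`. -/
def IsResidue (g₁ g₂ : ℂ × ℂ → ℂ) (a : ℂ × ℂ) (r : ℂ) : Prop :=
  ∃ (N : ℕ) (c₁₁ c₁₂ c₂₁ c₂₂ : ℂ × ℂ → ℂ),
    AnalyticAt ℂ c₁₁ a ∧ AnalyticAt ℂ c₁₂ a ∧ AnalyticAt ℂ c₂₁ a ∧ AnalyticAt ℂ c₂₂ a ∧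
    (∀ᶠ w in 𝓝 a, (w.1 - a.1) ^ (N + 1) = c₁₁ w * g₁ w + c₁₂ w * g₂ w) ∧
    (∀ᶠ w in 𝓝 a, (w.2 - a.2) ^ (N + 1) = c₂₁ w * g₁ w + c₂₂ w * g₂ w) ∧
    r = taylorCoeff (fun w => c₁₁ w * c₂₂ w - c₁₂ w * c₂₁ w) a N N

/-- The Grothendieck residue at `a` of `dz₁ ∧ dz₂ / (g₁ g₂)`, where `a` is an isolated common zero
of `g₁` and `g₂`. -/
def residue (g₁ g₂ : ℂ × ℂ → ℂ) (a : ℂ × ℂ) : ℂ := Classical.epsilon (IsResidue g₁ g₂ a)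

/-! ### Fixed point indices on the exceptional set -/

/-- A chart containing `p`, together with the coordinates of `p` in it. -/
def chartPt (p : X n) : Fin (n + 1) × (ℂ × ℂ) :=
  Function.invFun (fun q : Fin (n + 1) × (ℂ × ℂ) => chart q.1 q.2) p

/-- The expression of `f` in the chart `k` (used near fixed points of `f` only). -/
def inChart (f : X n → X n) (k : Fin (n + 1)) (w : ℂ × ℂ) : ℂ × ℂ :=
  Function.invFun (chart k) (f (chart k w))

/-- The topological local index `μ(f, p) = dim_ℂ ℂ{z}/(z₁ - f₁(z), z₂ - f₂(z))`. -/
def muAt (f : X n → X n) (p : X n) : ℕ∞ :=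
  interMult (fun w => w.1 - (inChart f (chartPt p).1 w).1)
    (fun w => w.2 - (inChart f (chartPt p).1 w).2) (chartPt p).2

/-- The holomorphic local index `ν(f, p)`, the residue at `p` of
`dz₁ ∧ dz₂ / ((z₁ - f₁(z)) (z₂ - f₂(z)))`. -/
def nuAt (f : X n → X n) (p : X n) : ℂ :=
  residue (fun w => w.1 - (inChart f (chartPt p).1 w).1)
    (fun w => w.2 - (inChart f (chartPt p).1 w).2) (chartPt p).2

/-- The isolated fixed points on `E`: the isolated points of the fixed point set of `f|_E`. -/
def isolatedFix (f : X n → X n) : Set (X n) :=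
  {p | p ∈ exc n ∧ f p = p ∧ ∃ k a, chart k a = p ∧
    ∀ᶠ w in 𝓝[≠] a, chart k w ∈ exc n → f (chart k w) ≠ chart k w}

/-- The number `N(f, E)` of `(-2)`-curves in `E` that are fixed pointwise by `f`. -/
def numFixedCurves (f : X n → X n) : ℕ := Set.ncard {i : Fin n | ∀ p ∈ curve i, f p = p}

/-- `μ(f, E)`, the sum of the `μ(f, p)` over the isolated fixed points on `E`, plus `2 N(f, E)`. -/
def muExc (f : X n → X n) : ℕ∞ :=
  (∑ᶠ p ∈ isolatedFix f, muAt f p) + 2 * (numFixedCurves f : ℕ∞)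

/-- `ν̂(f, E)`, the sum of the `β ν(f, p)` over the isolated fixed points on `E`, plus
`N(f, E) β (δ + 1) / (δ - 1)²`, where `β` is the chosen square root of the twist number `δ`. -/
def nuHatExc (f : X n → X n) (β : ℂ) : ℂ :=
  (∑ᶠ p ∈ isolatedFix f, β * nuAt f p) +
    (numFixedCurves f : ℂ) * (β * ((β ^ 2 + 1) / (β ^ 2 - 1) ^ 2))

/-! ### The polynomials `H_m` and `K_m` -/

/-- `H_m(w) = 2 T_m(w/2)`, that is, `H_m(z + z⁻¹) = z^m + z^(-m)`. -/
def H (m : ℕ) (w : ℂ) : ℂ := (Polynomial.Chebyshev.C ℂ m).eval w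

/-- `K_m(w) = U_m(w/2)`, that is, `z^(m+1) - z^(-(m+1)) = (z - z⁻¹) K_m(z + z⁻¹)`. -/
def K (m : ℕ) (w : ℂ) : ℂ := (Polynomial.Chebyshev.S ℂ m).eval w

theorem H_add_inv (m : ℕ) (z : ℂ) (hz : z ≠ 0) : H m (z + z⁻¹) = z ^ m + (z⁻¹) ^ m := by
  have key : ∀ m : ℕ, H m (z + z⁻¹) = z ^ m + (z⁻¹) ^ m ∧
      H (m + 1) (z + z⁻¹) = z ^ (m + 1) + (z⁻¹) ^ (m + 1) := by
    intro m
    induction m with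
    | zero => constructor <;> simp [H]; norm_num
    | succ k ih =>
      refine ⟨ih.2, ?_⟩
      have e : H (k + 1 + 1) (z + z⁻¹) = (z + z⁻¹) * H (k + 1) (z + z⁻¹) - H k (z + z⁻¹) := by
        have := Polynomial.Chebyshev.C_add_two ℂ (k : ℤ)
        simp only [H]
        push_cast
        rw [show (k : ℤ) + 1 + 1 = k + 2 by ring, this]
        simp
      rw [e, ih.1, ih.2]
      linear_combination (z ^ k + z⁻¹ ^ k) * mul_inv_cancel₀ hz
  exact (key m).1

theorem K_add_inv (m : ℕ) (z : ℂ) (hz : z ≠ 0) :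
    (z - z⁻¹) * K m (z + z⁻¹) = z ^ (m + 1) - (z⁻¹) ^ (m + 1) := by
  have key : ∀ m : ℕ, (z - z⁻¹) * K m (z + z⁻¹) = z ^ (m + 1) - (z⁻¹) ^ (m + 1) ∧
      (z - z⁻¹) * K (m + 1) (z + z⁻¹) = z ^ (m + 2) - (z⁻¹) ^ (m + 2) := by
    intro m
    induction m with
    | zero => constructor <;> simp [K]; ring
    | succ k ih =>
      refine ⟨ih.2, ?_⟩
      have e : K (k + 1 + 1) (z + z⁻¹) = (z + z⁻¹) * K (k + 1) (z + z⁻¹) - K k (z + z⁻¹) := by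
        have := Polynomial.Chebyshev.S_add_two ℂ (k : ℤ)
        simp only [K]
        push_cast
        rw [show (k : ℤ) + 1 + 1 = k + 2 by ring, this]
        simp
      rw [e, mul_sub, mul_left_comm, ih.1, ih.2]
      linear_combination (z ^ (k + 1) - z⁻¹ ^ (k + 1)) * mul_inv_cancel₀ hz
  exact (key m).1

/-- The geometric progression `γ_j = α₁^j α₂^(j-n-1)`. -/
def gam (n : ℕ) (α₁ α₂ : ℂ) (j : ℕ) : ℂ := α₁ ^ (j : ℤ) * α₂ ^ ((j : ℤ) - n - 1)

end AnResolution

end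

noncomputable section

namespace AnResolution

/-! ### Analytic germs in two variables -/

/-! The fixed points of `f` on `E` are governed by the geometric progression `γ`. Trivial symmetry
makes every corner, the intersection point of two consecutive curves, a fixed point. For `n ≥ 2`
each curve therefore contains a fixed corner, and in the coordinate with that corner at infinity `f`
is an affine map, by Liouville's theorem (`exists_affine_hAxis`, `exists_affine_vAxis`). At a corner
the multipliers along the two curves have product `δ`, so the multiplier on one curve determines the
next: they are `γ_1, γ_2 = δ γ_1, …` (`exists_chainAction`). The first one is read off from a lift
`F` along the curve in `X` lying over the image of the second coordinate axis (`IsLift.chart_zero`):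
`F'(0)` is triangular, and the diagonal entry `d` satisfies `γ_1 d^(n+1) = δ`. As `d` may be either
multiplier of `E`, the progression is only known up to exchanging `α₁` and `α₂`, that is, up to `γ_j
↦ γ_(n+1-j)⁻¹`. For `n = 1` no corner need be fixed; there `f` acts on the curve as the Möbius
transformation of the matrix `F'(0)`, and the fixed points are its eigenlines
(`IsLift.moebiusAction`).

If no `γ_1, …, γ_n` equals `1`, the fixed points are `P_0, …, P_n`, and `f'(P_k)` has the
eigenvalues `γ_(k+1)` and `γ_k⁻¹`. A simple fixed point has `μ = 1` and `ν = 1 / det (1 - f'(P_k))`,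
and these reciprocals telescope (`sum_inv_charValue`). The sum depends on `γ_0` and `γ_(n+1)` only,
and it is the stated quotient after the substitution of `H` and `K` (`index_formula`).

If `γ_i = 1`, the two points `P_(i-1)` and `P_i` on the curve `E_i` are replaced by a pointwise
fixed curve or by one parabolic fixed point. The second has `μ = 2` and `ν = (δ + 1) / (δ - 1)²`
(`index_parabolic`), exactly the contribution assigned to a fixed curve and exactly what is missing
from the telescoping sum, because `γ_(i-1) = δ⁻¹` and `γ_(i+1) = δ`. So the same formula holds, and
its denominator factors (`denom_eq_of_gam_eq_one`). If `γ_0` or `γ_(n+1)` is `1`, then all `n + 1`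
points are present and one end point is degenerate, so that its `μ` is at least `2`.

The local indices are computed from a factorization of `id - f` as an invertible matrix applied to
`(z₁^(p+1), z₂^(q+1))` (`mem_germIdeal_iff`, `residue_eq`). -/

theorem exists_hadamard {h : ℂ × ℂ → ℂ} {a : ℂ × ℂ} (hh : AnalyticAt ℂ h a) :
    ∃ h₁ h₂ : ℂ × ℂ → ℂ, AnalyticAt ℂ h₁ a ∧ AnalyticAt ℂ h₂ a ∧
      ∀ᶠ w in 𝓝 a, h w = h a + (w.1 - a.1) * h₁ w + (w.2 - a.2) * h₂ w := by
  obtain ⟨p, r, hp⟩ := hh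
  -- Leaving the last argument of each term of the series free gives a series with values in linear
  -- forms. At `w - a`, applied to `w - a`, it sums to `h w - h a`; its values on the two basis
  -- vectors are the required quotients.
  have hq0 : 0 < p.shift.radius := by
    rw [FormalMultilinearSeries.radius_shift]; exact hp.r_pos.trans_le hp.r_le
  have hq := p.shift.hasFPowerSeriesOnBall hq0
  have hQ : AnalyticAt ℂ (fun w => p.shift.sum (w - a)) a := by
    refine AnalyticAt.fun_comp (g := p.shift.sum) ?_ (by fun_prop)
    simpa using hq.analyticAt
  have hb : ∀ᶠ w in 𝓝 a, w - a ∈ Metric.eball (0 : ℂ × ℂ) (min r p.shift.radius) := by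
    have h0 : Tendsto (fun w => w - a) (𝓝 a) (𝓝 0) := by
      have : ContinuousAt (fun w => w - a) a := by fun_prop
      simpa [ContinuousAt] using this
    exact h0 (Metric.eball_mem_nhds _ (lt_min hp.r_pos hq0))
  refine ⟨fun w => p.shift.sum (w - a) (1, 0), fun w => p.shift.sum (w - a) (0, 1),
    ?_, ?_, ?_⟩
  · exact ((ContinuousLinearMap.apply ℂ ℂ ((1, 0) : ℂ × ℂ)).analyticAt _).comp hQ
  · exact ((ContinuousLinearMap.apply ℂ ℂ ((0, 1) : ℂ × ℂ)).analyticAt _).comp hQ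
  filter_upwards [hb] with w hw
  have h1 := hp.hasSum (Metric.eball_subset_eball (min_le_left _ _) hw)
  have h2 := (hq.hasSum (Metric.eball_subset_eball (min_le_right _ _) hw))
  have h3 := (ContinuousLinearMap.apply ℂ ℂ (w - a)).hasSum h2
  have h4 := (hasSum_nat_add_iff' 1).2 h1
  have h5 : p.shift.sum (w - a) (w - a) = h w - h a := by
    have h6 := h3.unique (a₂ := h w - h a) (by
      convert h4 using 1
      · funext m
        generalize w - a = y
        have : (Fin.snoc (fun _ : Fin m => y) y : Fin (m + 1) → ℂ × ℂ) = fun _ => y := by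
          funext i
          refine Fin.lastCases ?_ (fun j => ?_) i <;> simp
        simp only [FormalMultilinearSeries.shift, ContinuousLinearMap.apply_apply,
          ContinuousMultilinearMap.curryRight_apply]
        exact congrArg _ this
      · simp [hp.coeff_zero])
    simpa using h6
  have h7 : w - a = (w.1 - a.1) • ((1, 0) : ℂ × ℂ) + (w.2 - a.2) • ((0, 1) : ℂ × ℂ) := by
    ext <;> simp
  have h8 : p.shift.sum (w - a) (w - a) =
      (w.1 - a.1) * p.shift.sum (w - a) (1, 0) + (w.2 - a.2) * p.shift.sum (w - a) (0, 1) := by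
    conv_lhs => arg 2; rw [h7]
    rw [map_add, map_smul, map_smul, smul_eq_mul, smul_eq_mul]
  linear_combination h8 - h5

/-- Division by the ideal `(z₁, z₂²)`. -/
theorem exists_hadamard_sq {h : ℂ × ℂ → ℂ} {a : ℂ × ℂ} (hh : AnalyticAt ℂ h a)
    (h0 : h a = 0) (h1 : fderiv ℂ h a (0, 1) = 0) :
    ∃ h₁ h₂ : ℂ × ℂ → ℂ, AnalyticAt ℂ h₁ a ∧ AnalyticAt ℂ h₂ a ∧
      ∀ᶠ w in 𝓝 a, h w = (w.1 - a.1) * h₁ w + (w.2 - a.2) ^ 2 * h₂ w := by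
  obtain ⟨b, c, hb, hc, e⟩ := exists_hadamard hh
  have hd : HasFDerivAt h (b a • ContinuousLinearMap.fst ℂ ℂ ℂ +
      c a • ContinuousLinearMap.snd ℂ ℂ ℂ) a := by
    have e1 : HasFDerivAt (fun w : ℂ × ℂ => w.1 - a.1) (ContinuousLinearMap.fst ℂ ℂ ℂ) a :=
      hasFDerivAt_fst.sub_const _
    have e2 : HasFDerivAt (fun w : ℂ × ℂ => w.2 - a.2) (ContinuousLinearMap.snd ℂ ℂ ℂ) a :=
      hasFDerivAt_snd.sub_const _
    have := ((e1.mul hb.differentiableAt.hasFDerivAt).add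
      (e2.mul hc.differentiableAt.hasFDerivAt)).const_add (h a)
    refine HasFDerivAt.congr_of_eventuallyEq (f := fun w => h a + ((w.1 - a.1) * b w +
      (w.2 - a.2) * c w)) ?_ (e.mono fun w hw => by rw [hw]; ring)
    refine this.congr_fderiv ?_
    ext <;> simp
  have hc0 : c a = 0 := by
    rw [hd.fderiv] at h1
    simpa using h1
  -- Since `c` vanishes at `a` it can be divided once more; its `z₁` part is absorbed into the first
  -- quotient.
  obtain ⟨c₁, c₂, hc₁, hc₂, e'⟩ := exists_hadamard hc
  refine ⟨fun w => b w + (w.2 - a.2) * c₁ w, c₂,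
    hb.add ((analyticAt_snd.sub analyticAt_const).mul hc₁), hc₂, ?_⟩
  filter_upwards [e, e'] with w hw hw'
  rw [hw, hw', h0, hc0]
  ring

/-! ### Taylor series of germs -/

theorem taylorCoeff_zero_zero (h : ℂ × ℂ → ℂ) (a : ℂ × ℂ) : taylorCoeff h a 0 0 = h a := by
  simp [taylorCoeff]

/-- The one-variable Taylor coefficient. -/
def tcoeff (φ : ℂ → ℂ) (s : ℂ) (i : ℕ) : ℂ := iteratedDeriv i φ s / (i.factorial : ℂ)

theorem tcoeff_mul {φ ψ : ℂ → ℂ} {s : ℂ} (hφ : AnalyticAt ℂ φ s) (hψ : AnalyticAt ℂ ψ s) (i : ℕ) :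
    tcoeff (fun t => φ t * ψ t) s i =
      ∑ p ∈ Finset.HasAntidiagonal.antidiagonal i, tcoeff φ s p.1 * tcoeff ψ s p.2 := by
  have := iteratedDeriv_mul (n := i) (hφ.contDiffAt) (hψ.contDiffAt)
  have e : (fun t => φ t * ψ t) = φ * ψ := rfl
  rw [tcoeff, e, this, Finset.Nat.sum_antidiagonal_eq_sum_range_succ_mk, Finset.sum_div]
  refine Finset.sum_congr rfl fun k hk => ?_
  have hk : k ≤ i := Nat.lt_succ_iff.1 (Finset.mem_range.1 hk)
  rw [Nat.cast_choose ℂ hk, tcoeff, tcoeff]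
  have h1 := Nat.cast_ne_zero (R := ℂ).2 i.factorial_ne_zero
  have h2 := Nat.cast_ne_zero (R := ℂ).2 k.factorial_ne_zero
  have h3 := Nat.cast_ne_zero (R := ℂ).2 (i - k).factorial_ne_zero
  field_simp

theorem tcoeff_congr {φ ψ : ℂ → ℂ} {s : ℂ} (h : φ =ᶠ[𝓝 s] ψ) (i : ℕ) :
    tcoeff φ s i = tcoeff ψ s i := by
  rw [tcoeff, tcoeff, h.iteratedDeriv_eq]

theorem tcoeff_sum {ι : Type*} (u : Finset ι) {φ : ι → ℂ → ℂ} {s : ℂ}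
    (hφ : ∀ j ∈ u, AnalyticAt ℂ (φ j) s) (i : ℕ) :
    tcoeff (fun t => ∑ j ∈ u, φ j t) s i = ∑ j ∈ u, tcoeff (φ j) s i := by
  simp only [tcoeff]
  rw [iteratedDeriv_fun_sum fun j hj => (hφ j hj).contDiffAt, Finset.sum_div]

/-- Nesting one-variable coefficients allows the Leibniz rule to be applied one variable at a time.
-/
theorem taylorCoeff_eq_tcoeff (h : ℂ × ℂ → ℂ) (a : ℂ × ℂ) (i j : ℕ) :
    taylorCoeff h a i j = tcoeff (fun s => tcoeff (fun t => h (s, t)) a.2 j) a.1 i := by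
  simp only [tcoeff, taylorCoeff, div_eq_mul_inv]
  rw [iteratedDeriv_mul_const_field]
  ring

/-- The partial derivatives. -/
def pderiv₁ (h : ℂ × ℂ → ℂ) (w : ℂ × ℂ) : ℂ := deriv (fun s => h (s, w.2)) w.1
/-- The partial derivative in the second variable. -/
def pderiv₂ (h : ℂ × ℂ → ℂ) (w : ℂ × ℂ) : ℂ := deriv (fun t => h (w.1, t)) w.2

theorem pderiv₁_eq {h : ℂ × ℂ → ℂ} {a : ℂ × ℂ} (hh : DifferentiableAt ℂ h a) :
    pderiv₁ h a = fderiv ℂ h a (1, 0) := by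
  have h1 : HasDerivAt (fun s : ℂ => (s, a.2)) ((1, 0) : ℂ × ℂ) a.1 :=
    (hasDerivAt_id _).prodMk (hasDerivAt_const _ _)
  exact (HasFDerivAt.comp_hasDerivAt (x := a.1) (l := h) hh.hasFDerivAt h1).deriv

theorem pderiv₂_eq {h : ℂ × ℂ → ℂ} {a : ℂ × ℂ} (hh : DifferentiableAt ℂ h a) :
    pderiv₂ h a = fderiv ℂ h a (0, 1) := by
  have h1 : HasDerivAt (fun s : ℂ => (a.1, s)) ((0, 1) : ℂ × ℂ) a.2 :=
    (hasDerivAt_const _ _).prodMk (hasDerivAt_id _)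
  exact (HasFDerivAt.comp_hasDerivAt (x := a.2) (l := h) hh.hasFDerivAt h1).deriv

theorem analyticAt_pderiv₁ {h : ℂ × ℂ → ℂ} {a : ℂ × ℂ} (hh : AnalyticAt ℂ h a) :
    AnalyticAt ℂ (pderiv₁ h) a := by
  have h1 : AnalyticAt ℂ (fun w => fderiv ℂ h w (1, 0)) a :=
    ((ContinuousLinearMap.apply ℂ ℂ ((1, 0) : ℂ × ℂ)).analyticAt _).comp hh.fderiv
  refine h1.congr ?_
  filter_upwards [hh.eventually_analyticAt] with w hw
  exact (pderiv₁_eq hw.differentiableAt).symm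

theorem analyticAt_pderiv₂ {h : ℂ × ℂ → ℂ} {a : ℂ × ℂ} (hh : AnalyticAt ℂ h a) :
    AnalyticAt ℂ (pderiv₂ h) a := by
  have h1 : AnalyticAt ℂ (fun w => fderiv ℂ h w (0, 1)) a :=
    ((ContinuousLinearMap.apply ℂ ℂ ((0, 1) : ℂ × ℂ)).analyticAt _).comp hh.fderiv
  refine h1.congr ?_
  filter_upwards [hh.eventually_analyticAt] with w hw
  exact (pderiv₂_eq hw.differentiableAt).symm

theorem pderiv_comm {h : ℂ × ℂ → ℂ} {a : ℂ × ℂ} (hh : AnalyticAt ℂ h a) :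
    pderiv₁ (pderiv₂ h) a = pderiv₂ (pderiv₁ h) a := by
  have hs := (hh.contDiffAt (n := ⊤)).isSymmSndFDerivAt_of_omega.eq (1, 0) (0, 1)
  have hd := hh.fderiv.differentiableAt
  have e1 : pderiv₂ h =ᶠ[𝓝 a] fun w => fderiv ℂ h w (0, 1) := by
    filter_upwards [hh.eventually_analyticAt] with w hw
    exact pderiv₂_eq hw.differentiableAt
  have e2 : pderiv₁ h =ᶠ[𝓝 a] fun w => fderiv ℂ h w (1, 0) := by
    filter_upwards [hh.eventually_analyticAt] with w hw
    exact pderiv₁_eq hw.differentiableAt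
  rw [pderiv₁_eq (analyticAt_pderiv₂ hh).differentiableAt,
    pderiv₂_eq (analyticAt_pderiv₁ hh).differentiableAt, e1.fderiv_eq, e2.fderiv_eq,
    fderiv_clm_apply hd (by fun_prop), fderiv_clm_apply hd (by fun_prop)]
  simpa using hs

theorem iteratedDeriv_snd (h : ℂ × ℂ → ℂ) (s : ℂ) (j : ℕ) :
    iteratedDeriv j (fun t => h (s, t)) = fun t => (pderiv₂^[j] h) (s, t) := by
  induction j with
  | zero => simp
  | succ j ih => rw [iteratedDeriv_succ, ih, Function.iterate_succ_apply']; rfl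

theorem iteratedDeriv_fst (h : ℂ × ℂ → ℂ) (t : ℂ) (i : ℕ) :
    iteratedDeriv i (fun s => h (s, t)) = fun s => (pderiv₁^[i] h) (s, t) := by
  induction i with
  | zero => simp
  | succ j ih => rw [iteratedDeriv_succ, ih, Function.iterate_succ_apply']; rfl

theorem analyticAt_iterate_pderiv₂ {h : ℂ × ℂ → ℂ} {a : ℂ × ℂ} (hh : AnalyticAt ℂ h a) (j : ℕ) :
    AnalyticAt ℂ (pderiv₂^[j] h) a := by
  induction j with
  | zero => simpa
  | succ j ih => rw [Function.iterate_succ_apply']; exact analyticAt_pderiv₂ ih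

theorem taylorCoeff_eq (h : ℂ × ℂ → ℂ) (a : ℂ × ℂ) (i j : ℕ) :
    taylorCoeff h a i j =
      (pderiv₁^[i] (pderiv₂^[j] h)) a / ((i.factorial : ℂ) * (j.factorial : ℂ)) := by
  simp only [taylorCoeff, iteratedDeriv_snd, iteratedDeriv_fst]

theorem analyticAt_slice_snd {h : ℂ × ℂ → ℂ} {a : ℂ × ℂ} (hh : AnalyticAt ℂ h a) :
    AnalyticAt ℂ (fun t => h (a.1, t)) a.2 :=
  AnalyticAt.fun_comp (g := h) (f := fun t : ℂ => (a.1, t)) hh (by fun_prop)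

theorem analyticAt_slice_fst {h : ℂ × ℂ → ℂ} {a : ℂ × ℂ} (hh : AnalyticAt ℂ h a) :
    AnalyticAt ℂ (fun s => h (s, a.2)) a.1 :=
  AnalyticAt.fun_comp (g := h) (f := fun s : ℂ => (s, a.2)) hh (by fun_prop)

/-- Iterated partial derivatives are jointly analytic, so the inner coefficient is an analytic
function of the outer variable, as the outer Leibniz rule requires. -/
theorem analyticAt_tcoeff_slice {h : ℂ × ℂ → ℂ} {a : ℂ × ℂ} (hh : AnalyticAt ℂ h a) (j : ℕ) :
    AnalyticAt ℂ (fun s => tcoeff (fun t => h (s, t)) a.2 j) a.1 := by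
  simp only [tcoeff, iteratedDeriv_snd]
  exact (analyticAt_slice_fst (analyticAt_iterate_pderiv₂ hh j)).div_const

theorem eventually_slice {a : ℂ × ℂ} {P : ℂ × ℂ → Prop} (h : ∀ᶠ w in 𝓝 a, P w) :
    ∀ᶠ s in 𝓝 a.1, ∀ᶠ t in 𝓝 a.2, P (s, t) := by
  rw [← Prod.mk.eta (p := a), nhds_prod_eq] at h
  exact h.curry

theorem taylorCoeff_congr {h k : ℂ × ℂ → ℂ} {a : ℂ × ℂ} (e : h =ᶠ[𝓝 a] k) (i j : ℕ) :
    taylorCoeff h a i j = taylorCoeff k a i j := by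
  rw [taylorCoeff_eq_tcoeff, taylorCoeff_eq_tcoeff]
  refine tcoeff_congr ?_ i
  filter_upwards [eventually_slice e] with s hs
  exact tcoeff_congr hs j

/-- The Taylor series of a germ. -/
def taylor (h : ℂ × ℂ → ℂ) (a : ℂ × ℂ) : PowerSeries (PowerSeries ℂ) :=
  PowerSeries.mk fun i => PowerSeries.mk fun j => taylorCoeff h a i j

/-- The coefficient of `z₁^i z₂^j`. -/
def cf (i j : ℕ) (P : PowerSeries (PowerSeries ℂ)) : ℂ :=
  PowerSeries.coeff j (PowerSeries.coeff i P)

theorem cf_taylor (h : ℂ × ℂ → ℂ) (a : ℂ × ℂ) (i j : ℕ) :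
    cf i j (taylor h a) = taylorCoeff h a i j := by simp [cf, taylor]

theorem cf_ext {P Q : PowerSeries (PowerSeries ℂ)} (h : ∀ i j, cf i j P = cf i j Q) : P = Q := by
  ext i j; exact h i j

theorem cf_mul (P Q : PowerSeries (PowerSeries ℂ)) (i j : ℕ) :
    cf i j (P * Q) = ∑ p ∈ Finset.HasAntidiagonal.antidiagonal i, ∑ q ∈ Finset.HasAntidiagonal.antidiagonal j,
      cf p.1 q.1 P * cf p.2 q.2 Q := by
  simp [cf, PowerSeries.coeff_mul]

theorem cf_add (P Q : PowerSeries (PowerSeries ℂ)) (i j : ℕ) :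
    cf i j (P + Q) = cf i j P + cf i j Q := by simp [cf]

theorem cf_sub (P Q : PowerSeries (PowerSeries ℂ)) (i j : ℕ) :
    cf i j (P - Q) = cf i j P - cf i j Q := by simp [cf]

theorem taylor_congr {h k : ℂ × ℂ → ℂ} {a : ℂ × ℂ} (e : h =ᶠ[𝓝 a] k) : taylor h a = taylor k a :=
  cf_ext fun i j => by rw [cf_taylor, cf_taylor, taylorCoeff_congr e]

theorem taylor_mul {h k : ℂ × ℂ → ℂ} {a : ℂ × ℂ} (hh : AnalyticAt ℂ h a) (hk : AnalyticAt ℂ k a) :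
    taylor (fun w => h w * k w) a = taylor h a * taylor k a := by
  refine cf_ext fun i j => ?_
  -- The inner product rule is needed for all `s` near `a.1`, since the outer coefficient
  -- differentiates in `s`.
  have hev : ∀ᶠ s in 𝓝 a.1, tcoeff (fun t => h (s, t) * k (s, t)) a.2 j =
      ∑ q ∈ Finset.HasAntidiagonal.antidiagonal j, tcoeff (fun t => h (s, t)) a.2 q.1 *
        tcoeff (fun t => k (s, t)) a.2 q.2 := by
    filter_upwards [eventually_slice hh.eventually_analyticAt,
      eventually_slice hk.eventually_analyticAt] with s hs hs'
    exact tcoeff_mul (analyticAt_slice_snd (a := (s, a.2)) hs.self_of_nhds)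
      (analyticAt_slice_snd (a := (s, a.2)) hs'.self_of_nhds) j
  rw [cf_taylor, taylorCoeff_eq_tcoeff, tcoeff_congr hev, tcoeff_sum, cf_mul, Finset.sum_comm]
  · refine Finset.sum_congr rfl fun q _ => ?_
    rw [tcoeff_mul (analyticAt_tcoeff_slice hh _) (analyticAt_tcoeff_slice hk _)]
    simp only [cf_taylor, taylorCoeff_eq_tcoeff]
  · exact fun q _ => (analyticAt_tcoeff_slice hh _).mul (analyticAt_tcoeff_slice hk _)

theorem taylor_add {h k : ℂ × ℂ → ℂ} {a : ℂ × ℂ} (hh : AnalyticAt ℂ h a) (hk : AnalyticAt ℂ k a) :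
    taylor (fun w => h w + k w) a = taylor h a + taylor k a := by
  refine cf_ext fun i j => ?_
  have hev : ∀ᶠ s in 𝓝 a.1, tcoeff (fun t => h (s, t) + k (s, t)) a.2 j =
      tcoeff (fun t => h (s, t)) a.2 j + tcoeff (fun t => k (s, t)) a.2 j := by
    filter_upwards [eventually_slice hh.eventually_analyticAt,
      eventually_slice hk.eventually_analyticAt] with s hs hs'
    have h1 := analyticAt_slice_snd (a := (s, a.2)) hs.self_of_nhds
    have h2 := analyticAt_slice_snd (a := (s, a.2)) hs'.self_of_nhds
    rw [tcoeff, iteratedDeriv_fun_add h1.contDiffAt h2.contDiffAt, add_div, tcoeff, tcoeff]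
  rw [cf_taylor, taylorCoeff_eq_tcoeff, tcoeff_congr hev, cf_add, cf_taylor, cf_taylor, tcoeff,
    iteratedDeriv_fun_add (analyticAt_tcoeff_slice hh j).contDiffAt
      (analyticAt_tcoeff_slice hk j).contDiffAt, add_div, taylorCoeff_eq_tcoeff,
    taylorCoeff_eq_tcoeff, tcoeff, tcoeff]

theorem tcoeff_const (c s : ℂ) (j : ℕ) : tcoeff (fun _ => c) s j = if j = 0 then c else 0 := by
  rw [tcoeff, iteratedDeriv_const]
  split_ifs with h
  · simp [h]
  · simp

theorem tcoeff_sub_const (c s : ℂ) (j : ℕ) :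
    tcoeff (fun t => t - c) s j = if j = 0 then s - c else if j = 1 then 1 else 0 := by
  rcases j with _ | _ | j
  · simp [tcoeff]
  · simp [tcoeff]
  · have : deriv (fun t : ℂ => t - c) = fun _ => 1 := by funext t; simp
    rw [tcoeff, iteratedDeriv_succ', this, iteratedDeriv_const]
    simp

theorem taylor_const (c : ℂ) (a : ℂ × ℂ) :
    taylor (fun _ => c) a = PowerSeries.C (PowerSeries.C c) := by
  refine cf_ext fun i j => ?_
  rw [cf_taylor, taylorCoeff_eq_tcoeff]
  simp only [tcoeff_const, cf, PowerSeries.coeff_C]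
  split_ifs <;> simp_all [PowerSeries.coeff_C]

theorem taylor_fst (a : ℂ × ℂ) : taylor (fun w => w.1 - a.1) a = PowerSeries.X := by
  refine cf_ext fun i j => ?_
  rw [cf_taylor, taylorCoeff_eq_tcoeff]
  simp only [tcoeff_const, cf, PowerSeries.coeff_X]
  rcases eq_or_ne j 0 with rfl | hj
  · simp only [if_true, tcoeff_sub_const]
    rcases i with _ | _ | i <;> simp
  · simp only [hj, if_false, tcoeff_const]
    rcases i with _ | _ | i <;> simp [hj, PowerSeries.coeff_one]

theorem taylor_snd (a : ℂ × ℂ) :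
    taylor (fun w => w.2 - a.2) a = PowerSeries.C PowerSeries.X := by
  refine cf_ext fun i j => ?_
  rw [cf_taylor, taylorCoeff_eq_tcoeff]
  simp only [cf, PowerSeries.coeff_C, tcoeff_sub_const, tcoeff_const]
  rcases i with _ | i <;> rcases j with _ | _ | j <;> simp [PowerSeries.coeff_X]

theorem taylor_pow {h : ℂ × ℂ → ℂ} {a : ℂ × ℂ} (hh : AnalyticAt ℂ h a) (m : ℕ) :
    taylor (fun w => h w ^ m) a = taylor h a ^ m := by
  induction m with
  | zero => simp [taylor_const]
  | succ m ih => simp only [pow_succ]; rw [taylor_mul (hh.fun_pow m) hh, ih]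

theorem taylor_sub {h k : ℂ × ℂ → ℂ} {a : ℂ × ℂ} (hh : AnalyticAt ℂ h a) (hk : AnalyticAt ℂ k a) :
    taylor (fun w => h w - k w) a = taylor h a - taylor k a := by
  have := taylor_add (hh.sub hk) hk
  simp only [Pi.sub_apply, sub_add_cancel] at this
  rw [this]; exact (add_sub_cancel_right _ _).symm

/-! ### Intersection multiplicities -/

/-- `Λ` factors through the local algebra, so it bounds the dimension from below even when that
dimension is infinite. -/
theorem le_interMult {g₁ g₂ : ℂ × ℂ → ℂ} {a : ℂ × ℂ} {V : Type} [AddCommGroup V] [Module ℂ V]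
    [Module.Finite ℂ V] (Λ : holAt a →ₗ[ℂ] V) (hs : Function.Surjective Λ)
    (hI : ∀ h ∈ germIdeal g₁ g₂ a, Λ h = 0) :
    (Module.finrank ℂ V : ℕ∞) ≤ interMult g₁ g₂ a := by
  let L : (holAt a ⧸ germIdeal g₁ g₂ a) →ₗ[ℂ] V :=
    (((germIdeal g₁ g₂ a).restrictScalars ℂ).liftQ Λ hI) ∘ₗ
      (Submodule.Quotient.restrictScalarsEquiv ℂ (germIdeal g₁ g₂ a)).symm.toLinearMap
  have hL : Function.Surjective L := by
    intro v
    obtain ⟨h, rfl⟩ := hs v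
    exact ⟨Submodule.Quotient.mk h, rfl⟩
  have := LinearMap.rank_le_of_surjective L hL
  rw [← Module.finrank_eq_rank ℂ V] at this
  have h2 := Cardinal.toENat.monotone' this
  exact (map_natCast Cardinal.toENat _).symm.trans_le h2

theorem interMult_eq {g₁ g₂ : ℂ × ℂ → ℂ} {a : ℂ × ℂ} {V : Type} [AddCommGroup V] [Module ℂ V]
    [Module.Finite ℂ V] (Λ : holAt a →ₗ[ℂ] V) (hs : Function.Surjective Λ)
    (hI : ∀ h, h ∈ germIdeal g₁ g₂ a ↔ Λ h = 0) :
    interMult g₁ g₂ a = Module.finrank ℂ V := by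
  refine le_antisymm ?_ (le_interMult Λ hs fun h hh => (hI h).1 hh)
  let L : (holAt a ⧸ germIdeal g₁ g₂ a) →ₗ[ℂ] V :=
    (((germIdeal g₁ g₂ a).restrictScalars ℂ).liftQ Λ fun h hh => (hI h).1 hh) ∘ₗ
      (Submodule.Quotient.restrictScalarsEquiv ℂ (germIdeal g₁ g₂ a)).symm.toLinearMap
  have hL : Function.Injective L := by
    rw [← LinearMap.ker_eq_bot, LinearMap.ker_eq_bot']
    intro x hx
    obtain ⟨h, rfl⟩ := Submodule.Quotient.mk_surjective _ x
    exact (Submodule.Quotient.mk_eq_zero _).2 ((hI h).2 hx)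
  have := LinearMap.rank_le_of_injective L hL
  rw [← Module.finrank_eq_rank ℂ V] at this
  have h2 := Cardinal.toENat.monotone' this
  exact h2.trans_eq (map_natCast Cardinal.toENat _)

/-- Evaluation of germs. -/
def evalGerm (a : ℂ × ℂ) : holAt a →ₗ[ℂ] ℂ where
  toFun h := h.1 a
  map_add' _ _ := rfl
  map_smul' _ _ := rfl

/-- Directional derivatives of germs. -/
def dirGerm (a ξ : ℂ × ℂ) : holAt a →ₗ[ℂ] ℂ where
  toFun h := fderiv ℂ h.1 a ξ
  map_add' h k := by
    have h1 : AnalyticAt ℂ h.1 a := h.2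
    have h2 : AnalyticAt ℂ k.1 a := k.2
    change fderiv ℂ (h.1 + k.1) a ξ = _
    rw [fderiv_add h1.differentiableAt h2.differentiableAt]; rfl
  map_smul' c h := by
    have h1 : AnalyticAt ℂ h.1 a := h.2
    change fderiv ℂ (c • h.1) a ξ = _
    rw [fderiv_const_smul h1.differentiableAt]; rfl

theorem surjective_evalGerm (a : ℂ × ℂ) : Function.Surjective (evalGerm a) :=
  fun c => ⟨⟨fun _ => c, analyticAt_const⟩, rfl⟩

theorem surjective_eval_dir (a ξ : ℂ × ℂ) (hξ : ξ ≠ 0) :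
    Function.Surjective ((evalGerm a).prod (dirGerm a ξ)) := by
  -- With `ℓ ξ = 1` the affine function `c + d ℓ(w - a)` has value `c` and derivative `d` along `ξ`.
  obtain ⟨ℓ, hℓ⟩ : ∃ ℓ : ℂ × ℂ →L[ℂ] ℂ, ℓ ξ = 1 := by
    by_cases h1 : ξ.1 = 0
    · have h2 : ξ.2 ≠ 0 := fun h => hξ (Prod.ext h1 h)
      exact ⟨ξ.2⁻¹ • ContinuousLinearMap.snd ℂ ℂ ℂ, by simp [h2]⟩
    · exact ⟨ξ.1⁻¹ • ContinuousLinearMap.fst ℂ ℂ ℂ, by simp [h1]⟩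
  rintro ⟨c, d⟩
  have hd : HasFDerivAt (fun w => c + d * ℓ (w - a)) (d • ℓ) a := by
    have h2 : HasFDerivAt (fun w => ℓ w - ℓ a) ℓ a := ℓ.hasFDerivAt.sub_const (ℓ a)
    have := (h2.const_mul d).const_add c
    simpa only [map_sub] using this
  have ha : AnalyticAt ℂ (fun w => c + d * ℓ (w - a)) a := by
    have h2 : AnalyticAt ℂ (fun w => ℓ w - ℓ a) a := (ℓ.analyticAt a).fun_sub analyticAt_const
    have := (analyticAt_const (v := c)).fun_add ((analyticAt_const (v := d)).fun_mul h2)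
    simpa only [map_sub] using this
  refine ⟨⟨_, ha⟩, ?_⟩
  refine Prod.ext ?_ ?_
  · change c + d * ℓ (a - a) = c
    simp
  · change fderiv ℂ (fun w => c + d * ℓ (w - a)) a ξ = d
    rw [hd.fderiv]
    simp [hℓ]

/-- An analytic invertible change of generators does not change the ideal. -/
theorem mem_germIdeal_iff {g₁ g₂ e₁ e₂ m₁₁ m₁₂ m₂₁ m₂₂ : ℂ × ℂ → ℂ} {a : ℂ × ℂ}
    (h₁₁ : AnalyticAt ℂ m₁₁ a) (h₁₂ : AnalyticAt ℂ m₁₂ a) (h₂₁ : AnalyticAt ℂ m₂₁ a)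
    (h₂₂ : AnalyticAt ℂ m₂₂ a) (hdet : m₁₁ a * m₂₂ a - m₁₂ a * m₂₁ a ≠ 0)
    (h₁ : ∀ᶠ w in 𝓝 a, g₁ w = m₁₁ w * e₁ w + m₁₂ w * e₂ w)
    (h₂ : ∀ᶠ w in 𝓝 a, g₂ w = m₂₁ w * e₁ w + m₂₂ w * e₂ w) (h : holAt a) :
    h ∈ germIdeal g₁ g₂ a ↔ h ∈ germIdeal e₁ e₂ a := by
  have hD : AnalyticAt ℂ (fun w => m₁₁ w * m₂₂ w - m₁₂ w * m₂₁ w) a :=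
    (h₁₁.mul h₂₂).sub (h₁₂.mul h₂₁)
  have hI := hD.fun_inv hdet
  constructor
  · rintro ⟨c₁, hc₁, c₂, hc₂, H⟩
    refine ⟨fun w => c₁ w * m₁₁ w + c₂ w * m₂₁ w,
      (AnalyticAt.mul hc₁ h₁₁).add (AnalyticAt.mul hc₂ h₂₁),
      fun w => c₁ w * m₁₂ w + c₂ w * m₂₂ w,
      (AnalyticAt.mul hc₁ h₁₂).add (AnalyticAt.mul hc₂ h₂₂), ?_⟩
    filter_upwards [H, h₁, h₂] with w hw h1 h2
    rw [hw, h1, h2]; ring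
  · rintro ⟨c₁, hc₁, c₂, hc₂, H⟩
    -- Cramer's rule: the coefficient row is multiplied by the inverse matrix.
    refine ⟨fun w => (c₁ w * m₂₂ w - c₂ w * m₂₁ w) * (m₁₁ w * m₂₂ w - m₁₂ w * m₂₁ w)⁻¹,
      ((AnalyticAt.mul hc₁ h₂₂).sub (AnalyticAt.mul hc₂ h₂₁)).mul hI,
      fun w => (c₂ w * m₁₁ w - c₁ w * m₁₂ w) * (m₁₁ w * m₂₂ w - m₁₂ w * m₂₁ w)⁻¹,
      ((AnalyticAt.mul hc₂ h₁₁).sub (AnalyticAt.mul hc₁ h₁₂)).mul hI, ?_⟩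
    filter_upwards [H, h₁, h₂, hD.continuousAt.eventually_ne hdet] with w hw h1 h2 h3
    rw [hw, h1, h2]
    linear_combination -(c₁ w * e₁ w + c₂ w * e₂ w) * mul_inv_cancel₀ h3

theorem interMult_coord (a : ℂ × ℂ) (h : holAt a) :
    h ∈ germIdeal (fun w => w.1 - a.1) (fun w => w.2 - a.2) a ↔ evalGerm a h = 0 := by
  constructor
  · rintro ⟨c₁, hc₁, c₂, hc₂, H⟩
    change h.1 a = 0
    rw [H.self_of_nhds]; simp
  · intro h0
    have h0 : h.1 a = 0 := h0
    obtain ⟨b, c, hb, hc, e⟩ := exists_hadamard h.2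
    refine ⟨b, hb, c, hc, e.mono fun w hw => ?_⟩
    rw [hw, h0]; ring

theorem hasFDerivAt_ideal_sq {c₁ c₂ : ℂ × ℂ → ℂ} {a : ℂ × ℂ} (hc₁ : AnalyticAt ℂ c₁ a)
    (hc₂ : AnalyticAt ℂ c₂ a) :
    HasFDerivAt (fun w : ℂ × ℂ => c₁ w * (w.1 - a.1) + c₂ w * (w.2 - a.2) ^ 2)
      (c₁ a • ContinuousLinearMap.fst ℂ ℂ ℂ) a := by
  have e1 : HasFDerivAt (fun w : ℂ × ℂ => w.1 - a.1) (ContinuousLinearMap.fst ℂ ℂ ℂ) a :=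
    hasFDerivAt_fst.sub_const _
  have e2 : HasFDerivAt (fun w : ℂ × ℂ => w.2 - a.2) (ContinuousLinearMap.snd ℂ ℂ ℂ) a :=
    hasFDerivAt_snd.sub_const _
  have := (hc₁.differentiableAt.hasFDerivAt.mul e1).add
    (hc₂.differentiableAt.hasFDerivAt.mul (e2.pow 2))
  refine this.congr_fderiv ?_
  ext <;> simp

/-- The value and the derivative along `z₂` are the two coordinates on the quotient by `(z₁, z₂²)`;
this is where multiplicity two comes from. -/
theorem interMult_coord_sq (a : ℂ × ℂ) (h : holAt a) :
    h ∈ germIdeal (fun w => w.1 - a.1) (fun w => (w.2 - a.2) ^ 2) a ↔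
      ((evalGerm a).prod (dirGerm a (0, 1))) h = 0 := by
  constructor
  · rintro ⟨c₁, hc₁, c₂, hc₂, H⟩
    refine Prod.ext ?_ ?_
    · change h.1 a = 0
      rw [H.self_of_nhds]; simp
    · change fderiv ℂ h.1 a (0, 1) = 0
      rw [EventuallyEq.fderiv_eq H, (hasFDerivAt_ideal_sq hc₁ hc₂).fderiv]
      simp
  · intro h0
    have h1 : h.1 a = 0 := congrArg Prod.fst h0
    have h2 : fderiv ℂ h.1 a (0, 1) = 0 := congrArg Prod.snd h0
    obtain ⟨b, c, hb, hc, e⟩ := exists_hadamard_sq h.2 h1 h2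
    refine ⟨b, hb, c, hc, e.mono fun w hw => ?_⟩
    rw [hw]; ring

theorem interMult_eq_one {g₁ g₂ m₁₁ m₁₂ m₂₁ m₂₂ : ℂ × ℂ → ℂ} {a : ℂ × ℂ}
    (h₁₁ : AnalyticAt ℂ m₁₁ a) (h₁₂ : AnalyticAt ℂ m₁₂ a) (h₂₁ : AnalyticAt ℂ m₂₁ a)
    (h₂₂ : AnalyticAt ℂ m₂₂ a) (hdet : m₁₁ a * m₂₂ a - m₁₂ a * m₂₁ a ≠ 0)
    (h₁ : ∀ᶠ w in 𝓝 a, g₁ w = m₁₁ w * (w.1 - a.1) + m₁₂ w * (w.2 - a.2))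
    (h₂ : ∀ᶠ w in 𝓝 a, g₂ w = m₂₁ w * (w.1 - a.1) + m₂₂ w * (w.2 - a.2)) :
    interMult g₁ g₂ a = 1 := by
  rw [interMult_eq (evalGerm a) (surjective_evalGerm a) fun h =>
    (mem_germIdeal_iff h₁₁ h₁₂ h₂₁ h₂₂ hdet h₁ h₂ h).trans (interMult_coord a h)]
  simp

theorem interMult_eq_two {g₁ g₂ m₁₁ m₁₂ m₂₁ m₂₂ : ℂ × ℂ → ℂ} {a : ℂ × ℂ}
    (h₁₁ : AnalyticAt ℂ m₁₁ a) (h₁₂ : AnalyticAt ℂ m₁₂ a) (h₂₁ : AnalyticAt ℂ m₂₁ a)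
    (h₂₂ : AnalyticAt ℂ m₂₂ a) (hdet : m₁₁ a * m₂₂ a - m₁₂ a * m₂₁ a ≠ 0)
    (h₁ : ∀ᶠ w in 𝓝 a, g₁ w = m₁₁ w * (w.1 - a.1) + m₁₂ w * (w.2 - a.2) ^ 2)
    (h₂ : ∀ᶠ w in 𝓝 a, g₂ w = m₂₁ w * (w.1 - a.1) + m₂₂ w * (w.2 - a.2) ^ 2) :
    interMult g₁ g₂ a = 2 := by
  rw [interMult_eq ((evalGerm a).prod (dirGerm a (0, 1)))
    (surjective_eval_dir a _ (by simp)) fun h =>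
    (mem_germIdeal_iff h₁₁ h₁₂ h₂₁ h₂₂ hdet h₁ h₂ h).trans (interMult_coord_sq a h)]
  simp

/-- At a degenerate common zero the intersection multiplicity is at least two. -/
theorem two_le_interMult {g₁ g₂ : ℂ × ℂ → ℂ} {a : ℂ × ℂ} (hg₁ : AnalyticAt ℂ g₁ a)
    (hg₂ : AnalyticAt ℂ g₂ a) (h₁ : g₁ a = 0) (h₂ : g₂ a = 0) (ξ : ℂ × ℂ) (hξ : ξ ≠ 0)
    (d₁ : fderiv ℂ g₁ a ξ = 0) (d₂ : fderiv ℂ g₂ a ξ = 0) : 2 ≤ interMult g₁ g₂ a := by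
  refine le_trans ?_ (le_interMult ((evalGerm a).prod (dirGerm a ξ))
    (surjective_eval_dir a ξ hξ) ?_)
  · simp
  · rintro h ⟨c₁, hc₁, c₂, hc₂, H⟩
    have hc₁ : AnalyticAt ℂ c₁ a := hc₁
    have hc₂ : AnalyticAt ℂ c₂ a := hc₂
    refine Prod.ext ?_ ?_
    · change h.1 a = 0
      rw [H.self_of_nhds, h₁, h₂]; simp
    · change fderiv ℂ h.1 a ξ = 0
      have := (hc₁.differentiableAt.hasFDerivAt.mul hg₁.differentiableAt.hasFDerivAt).add
        (hc₂.differentiableAt.hasFDerivAt.mul hg₂.differentiableAt.hasFDerivAt)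
      have e : h.1 =ᶠ[𝓝 a] (c₁ * g₁ + c₂ * g₂) := H
      rw [e.fderiv_eq, this.fderiv]
      simp [h₁, h₂, d₁, d₂]

/-! ### Residues -/

/-- The coordinates as formal power series. -/
abbrev Z₁ : PowerSeries (PowerSeries ℂ) := PowerSeries.X
/-- The second coordinate as a formal power series. -/
abbrev Z₂ : PowerSeries (PowerSeries ℂ) := PowerSeries.C PowerSeries.X

theorem cf_mul_Z₁_pow (P : PowerSeries (PowerSeries ℂ)) (m i j : ℕ) :
    cf i j (P * Z₁ ^ m) = if m ≤ i then cf (i - m) j P else 0 := by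
  rw [cf, PowerSeries.coeff_mul_X_pow']
  split_ifs <;> simp [cf]

theorem cf_mul_Z₂_pow (P : PowerSeries (PowerSeries ℂ)) (m i j : ℕ) :
    cf i j (P * Z₂ ^ m) = if m ≤ j then cf i (j - m) P else 0 := by
  rw [cf, ← map_pow, PowerSeries.coeff_mul_C, PowerSeries.coeff_mul_X_pow']
  split_ifs <;> simp [cf]

/-- Cramer's rule gives `det B · Z₁^(p+1) Z₂^(q+1) = Z₁^(N+1) Z₂^(N+1)` up to multiples of
`Z₁^(N+p+2)` and `Z₂^(N+q+2)`. This is why the residue does not depend on the exponent and on the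
coefficients used to define it. -/
theorem cf_det (B₁₁ B₁₂ B₂₁ B₂₂ k : PowerSeries (PowerSeries ℂ)) (p q N : ℕ)
    (h₁ : B₁₁ * Z₁ ^ (p + 1) + B₁₂ * Z₂ ^ (q + 1) = Z₁ ^ (N + 1))
    (h₂ : B₂₁ * Z₁ ^ (p + 1) + B₂₂ * Z₂ ^ (q + 1) = Z₂ ^ (N + 1)) :
    cf N N ((B₁₁ * B₂₂ - B₁₂ * B₂₁) * k) = cf p q k := by
  have key : ((B₁₁ * B₂₂ - B₁₂ * B₂₁) * k) * Z₁ ^ (p + 1) * Z₂ ^ (q + 1) =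
      k * Z₁ ^ (N + 1) * Z₂ ^ (N + 1) - (B₂₁ * k) * Z₁ ^ (N + p + 2)
        - (B₁₂ * k) * Z₂ ^ (N + q + 2) := by
    have e1 : Z₁ ^ (N + p + 2) = Z₁ ^ (N + 1) * Z₁ ^ (p + 1) := by rw [← pow_add]; congr 1; ring
    have e2 : Z₂ ^ (N + q + 2) = Z₂ ^ (N + 1) * Z₂ ^ (q + 1) := by rw [← pow_add]; congr 1; ring
    rw [e1, e2]
    linear_combination (k * B₂₂ * Z₂ ^ (q + 1)) * h₁ - (k * B₁₂ * Z₂ ^ (q + 1)) * h₂ +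
      (k * Z₁ ^ (N + 1)) * h₂
  -- At this bidegree both error terms have an exponent too large by one.
  have := congrArg (cf (N + p + 1) (N + q + 1)) key
  rw [cf_sub, cf_sub, cf_mul_Z₂_pow, cf_mul_Z₁_pow, cf_mul_Z₂_pow, cf_mul_Z₁_pow,
    cf_mul_Z₁_pow, cf_mul_Z₂_pow, if_pos (by omega), if_pos (by omega), if_pos (by omega),
    if_pos (by omega), if_neg (by omega), if_neg (by omega)] at this
  rw [show N + p + 1 - (p + 1) = N by omega, show N + q + 1 - (q + 1) = N by omega,
    show N + p + 1 - (N + 1) = p by omega, show N + q + 1 - (N + 1) = q by omega] at this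
  simpa using this

theorem taylor_coord_pow (a : ℂ × ℂ) (m : ℕ) :
    taylor (fun w => (w.1 - a.1) ^ m) a = Z₁ ^ m ∧ taylor (fun w => (w.2 - a.2) ^ m) a = Z₂ ^ m := by
  constructor
  · rw [taylor_pow (analyticAt_fst.fun_sub analyticAt_const), taylor_fst]
  · rw [taylor_pow (analyticAt_snd.fun_sub analyticAt_const), taylor_snd]

theorem analyticAt_coord_pow₁ (a : ℂ × ℂ) (m : ℕ) :
    AnalyticAt ℂ (fun w : ℂ × ℂ => (w.1 - a.1) ^ m) a :=
  (analyticAt_fst.fun_sub analyticAt_const).pow m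

theorem analyticAt_coord_pow₂ (a : ℂ × ℂ) (m : ℕ) :
    AnalyticAt ℂ (fun w : ℂ × ℂ => (w.2 - a.2) ^ m) a :=
  (analyticAt_snd.fun_sub analyticAt_const).pow m

/-- The transformation law: the residue of `(g₁, g₂) = M (z₁^(p+1), z₂^(q+1))` with `M` invertible
is the coefficient of `z₁^p z₂^q` in `1 / det M`. -/
theorem residue_eq {g₁ g₂ m₁₁ m₁₂ m₂₁ m₂₂ : ℂ × ℂ → ℂ} {a : ℂ × ℂ} (p q : ℕ)
    (h₁₁ : AnalyticAt ℂ m₁₁ a) (h₁₂ : AnalyticAt ℂ m₁₂ a) (h₂₁ : AnalyticAt ℂ m₂₁ a)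
    (h₂₂ : AnalyticAt ℂ m₂₂ a) (hdet : m₁₁ a * m₂₂ a - m₁₂ a * m₂₁ a ≠ 0)
    (h₁ : ∀ᶠ w in 𝓝 a, g₁ w = m₁₁ w * (w.1 - a.1) ^ (p + 1) + m₁₂ w * (w.2 - a.2) ^ (q + 1))
    (h₂ : ∀ᶠ w in 𝓝 a, g₂ w = m₂₁ w * (w.1 - a.1) ^ (p + 1) + m₂₂ w * (w.2 - a.2) ^ (q + 1)) :
    residue g₁ g₂ a = cf p q (taylor (fun w => (m₁₁ w * m₂₂ w - m₁₂ w * m₂₁ w)⁻¹) a) := by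
  have hD : AnalyticAt ℂ (fun w => m₁₁ w * m₂₂ w - m₁₂ w * m₂₁ w) a :=
    (h₁₁.fun_mul h₂₂).fun_sub (h₁₂.fun_mul h₂₁)
  have hI := hD.fun_inv hdet
  have hne := hD.continuousAt.eventually_ne hdet
  have z₁ := analyticAt_coord_pow₁ a
  have z₂ := analyticAt_coord_pow₂ a
  -- The residue is defined by choice, so every admissible value has to be identified, and one has
  -- to exist.
  have huniq : ∀ r, IsResidue g₁ g₂ a r →
      r = cf p q (taylor (fun w => (m₁₁ w * m₂₂ w - m₁₂ w * m₂₁ w)⁻¹) a) := by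
    rintro r ⟨N, c₁₁, c₁₂, c₂₁, c₂₂, k₁₁, k₁₂, k₂₁, k₂₂, e₁, e₂, rfl⟩
    have b₁₁ := (k₁₁.fun_mul h₁₁).fun_add (k₁₂.fun_mul h₂₁)
    have b₁₂ := (k₁₁.fun_mul h₁₂).fun_add (k₁₂.fun_mul h₂₂)
    have b₂₁ := (k₂₁.fun_mul h₁₁).fun_add (k₂₂.fun_mul h₂₁)
    have b₂₂ := (k₂₁.fun_mul h₁₂).fun_add (k₂₂.fun_mul h₂₂)
    have E₁ := taylor_congr (a := a) (h := fun w => (w.1 - a.1) ^ (N + 1))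
      (k := fun w => (c₁₁ w * m₁₁ w + c₁₂ w * m₂₁ w) * (w.1 - a.1) ^ (p + 1) +
        (c₁₁ w * m₁₂ w + c₁₂ w * m₂₂ w) * (w.2 - a.2) ^ (q + 1)) (by
        filter_upwards [e₁, h₁, h₂] with w u₁ u₂ u₃
        rw [u₁, u₂, u₃]; ring)
    have E₂ := taylor_congr (a := a) (h := fun w => (w.2 - a.2) ^ (N + 1))
      (k := fun w => (c₂₁ w * m₁₁ w + c₂₂ w * m₂₁ w) * (w.1 - a.1) ^ (p + 1) +
        (c₂₁ w * m₁₂ w + c₂₂ w * m₂₂ w) * (w.2 - a.2) ^ (q + 1)) (by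
        filter_upwards [e₂, h₁, h₂] with w u₁ u₂ u₃
        rw [u₁, u₂, u₃]; ring)
    rw [taylor_add (b₁₁.fun_mul (z₁ _)) (b₁₂.fun_mul (z₂ _)), taylor_mul b₁₁ (z₁ _), taylor_mul b₁₂ (z₂ _),
      (taylor_coord_pow a _).1, (taylor_coord_pow a _).1, (taylor_coord_pow a _).2] at E₁
    rw [taylor_add (b₂₁.fun_mul (z₁ _)) (b₂₂.fun_mul (z₂ _)), taylor_mul b₂₁ (z₁ _), taylor_mul b₂₂ (z₂ _),
      (taylor_coord_pow a _).1, (taylor_coord_pow a _).2, (taylor_coord_pow a _).2] at E₂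
    -- The matrix `b = c m` expresses the powers of the coordinates through `z₁^(p+1)` and
    -- `z₂^(q+1)`, and `det c = det b · (det m)⁻¹`; `cf_det` is used with `k = (det m)⁻¹`.
    rw [← cf_taylor, ← cf_det _ _ _ _ _ p q N E₁.symm E₂.symm, ← taylor_mul b₁₁ b₂₂,
      ← taylor_mul b₁₂ b₂₁, ← taylor_sub (b₁₁.fun_mul b₂₂) (b₁₂.fun_mul b₂₁),
      ← taylor_mul ((b₁₁.fun_mul b₂₂).fun_sub (b₁₂.fun_mul b₂₁)) hI]
    refine congrArg _ (taylor_congr ?_)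
    filter_upwards [hne] with w hw
    linear_combination -(c₁₁ w * c₂₂ w - c₁₂ w * c₂₁ w) * mul_inv_cancel₀ hw
  -- The rows of the inverse matrix produce `z₁^(p+1)` and `z₂^(q+1)`; multiplied by `z₁^q` and
  -- `z₂^p` they produce the common exponent `p + q + 1`.
  have hex : ∃ r, IsResidue g₁ g₂ a r := by
    refine ⟨_, p + q, fun w => (w.1 - a.1) ^ q * m₂₂ w * (m₁₁ w * m₂₂ w - m₁₂ w * m₂₁ w)⁻¹,
      fun w => -(w.1 - a.1) ^ q * m₁₂ w * (m₁₁ w * m₂₂ w - m₁₂ w * m₂₁ w)⁻¹,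
      fun w => -(w.2 - a.2) ^ p * m₂₁ w * (m₁₁ w * m₂₂ w - m₁₂ w * m₂₁ w)⁻¹,
      fun w => (w.2 - a.2) ^ p * m₁₁ w * (m₁₁ w * m₂₂ w - m₁₂ w * m₂₁ w)⁻¹,
      ((z₁ q).fun_mul h₂₂).fun_mul hI, ((z₁ q).fun_neg.fun_mul h₁₂).fun_mul hI, ((z₂ p).fun_neg.fun_mul h₂₁).fun_mul hI,
      ((z₂ p).fun_mul h₁₁).fun_mul hI, ?_, ?_, rfl⟩
    · filter_upwards [h₁, h₂, hne] with w u₁ u₂ u₃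
      rw [u₁, u₂]
      linear_combination -(w.1 - a.1) ^ (p + q + 1) * mul_inv_cancel₀ u₃
    · filter_upwards [h₁, h₂, hne] with w u₁ u₂ u₃
      rw [u₁, u₂]
      linear_combination -(w.2 - a.2) ^ (p + q + 1) * mul_inv_cancel₀ u₃
  exact huniq _ (Classical.epsilon_spec hex)

/-! ### Fixed point indices of germs of maps -/

theorem det_prod (A : ℂ × ℂ →L[ℂ] ℂ × ℂ) :
    A.det = (A (1, 0)).1 * (A (0, 1)).2 - (A (0, 1)).1 * (A (1, 0)).2 := by
  rw [ContinuousLinearMap.det, ← LinearMap.det_toMatrix (Module.Basis.finTwoProd ℂ),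
    Matrix.det_fin_two]
  simp [LinearMap.toMatrix_apply]

theorem fderiv_of_hadamard {h b c : ℂ × ℂ → ℂ} {a : ℂ × ℂ} (hb : AnalyticAt ℂ b a)
    (hc : AnalyticAt ℂ c a)
    (e : ∀ᶠ w in 𝓝 a, h w = h a + (w.1 - a.1) * b w + (w.2 - a.2) * c w) :
    fderiv ℂ h a (1, 0) = b a ∧ fderiv ℂ h a (0, 1) = c a := by
  have hd : HasFDerivAt h (b a • ContinuousLinearMap.fst ℂ ℂ ℂ +
      c a • ContinuousLinearMap.snd ℂ ℂ ℂ) a := by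
    have e1 : HasFDerivAt (fun w : ℂ × ℂ => w.1 - a.1) (ContinuousLinearMap.fst ℂ ℂ ℂ) a :=
      hasFDerivAt_fst.sub_const _
    have e2 : HasFDerivAt (fun w : ℂ × ℂ => w.2 - a.2) (ContinuousLinearMap.snd ℂ ℂ ℂ) a :=
      hasFDerivAt_snd.sub_const _
    have := ((e1.mul hb.differentiableAt.hasFDerivAt).add
      (e2.mul hc.differentiableAt.hasFDerivAt)).const_add (h a)
    refine HasFDerivAt.congr_of_eventuallyEq (f := fun w => h a + ((w.1 - a.1) * b w +
      (w.2 - a.2) * c w)) ?_ (e.mono fun w hw => by rw [hw]; ring)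
    refine this.congr_fderiv ?_
    ext <;> simp
  rw [hd.fderiv]
  simp

section
variable {Φ : ℂ × ℂ → ℂ × ℂ} {a : ℂ × ℂ}

theorem analyticAt_id_sub (hΦ : AnalyticAt ℂ Φ a) :
    AnalyticAt ℂ (fun w => w.1 - (Φ w).1) a ∧ AnalyticAt ℂ (fun w => w.2 - (Φ w).2) a :=
  ⟨analyticAt_fst.sub (AnalyticAt.fun_comp (g := Prod.fst) analyticAt_fst hΦ),
    analyticAt_snd.sub (AnalyticAt.fun_comp (g := Prod.snd) analyticAt_snd hΦ)⟩

theorem fderiv_id_sub (hΦ : AnalyticAt ℂ Φ a) (ξ : ℂ × ℂ) :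
    fderiv ℂ (fun w => w.1 - (Φ w).1) a ξ = ((ContinuousLinearMap.id ℂ (ℂ × ℂ) - fderiv ℂ Φ a) ξ).1 ∧
    fderiv ℂ (fun w => w.2 - (Φ w).2) a ξ = ((ContinuousLinearMap.id ℂ (ℂ × ℂ) - fderiv ℂ Φ a) ξ).2 := by
  have h1 : HasFDerivAt (fun w => w.1 - (Φ w).1) _ a :=
    hasFDerivAt_fst.sub (hasFDerivAt_fst.comp a hΦ.differentiableAt.hasFDerivAt)
  have h2 : HasFDerivAt (fun w => w.2 - (Φ w).2) _ a :=
    hasFDerivAt_snd.sub (hasFDerivAt_snd.comp a hΦ.differentiableAt.hasFDerivAt)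
  rw [h1.fderiv, h2.fderiv]
  simp

/-- The index of a nondegenerate fixed point. -/
theorem index_of_det_ne_zero (hΦ : AnalyticAt ℂ Φ a) (ha : Φ a = a)
    (hdet : (ContinuousLinearMap.id ℂ (ℂ × ℂ) - fderiv ℂ Φ a).det ≠ 0) :
    interMult (fun w => w.1 - (Φ w).1) (fun w => w.2 - (Φ w).2) a = 1 ∧
    residue (fun w => w.1 - (Φ w).1) (fun w => w.2 - (Φ w).2) a =
      ((ContinuousLinearMap.id ℂ (ℂ × ℂ) - fderiv ℂ Φ a).det)⁻¹ := by
  obtain ⟨b, c, hb, hc, e⟩ := exists_hadamard (analyticAt_id_sub hΦ).1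
  obtain ⟨b', c', hb', hc', e'⟩ := exists_hadamard (analyticAt_id_sub hΦ).2
  obtain ⟨d1, d2⟩ := fderiv_of_hadamard hb hc e
  obtain ⟨d1', d2'⟩ := fderiv_of_hadamard hb' hc' e'
  rw [(fderiv_id_sub hΦ _).1] at d1 d2
  rw [(fderiv_id_sub hΦ _).2] at d1' d2'
  rw [det_prod, d1, d2, d1', d2'] at hdet ⊢
  simp only [ha, sub_self, zero_add] at e e'
  refine ⟨interMult_eq_one hb hc hb' hc' hdet (e.mono fun w hw => by rw [hw]; ring)
    (e'.mono fun w hw => by rw [hw]; ring), ?_⟩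
  rw [residue_eq 0 0 hb hc hb' hc' hdet (e.mono fun w hw => by rw [hw]; ring)
    (e'.mono fun w hw => by rw [hw]; ring), cf_taylor, taylorCoeff_zero_zero]

/-- A fixed vector `ξ` of the derivative is a direction in which both components of `id - Φ` vanish
to second order. -/
theorem two_le_of_det_eq_zero (hΦ : AnalyticAt ℂ Φ a) (ha : Φ a = a)
    (hdet : (ContinuousLinearMap.id ℂ (ℂ × ℂ) - fderiv ℂ Φ a).det = 0) :
    2 ≤ interMult (fun w => w.1 - (Φ w).1) (fun w => w.2 - (Φ w).2) a := by
  obtain ⟨ξ, hξ, h⟩ : ∃ ξ : ℂ × ℂ, ξ ≠ 0 ∧ (ContinuousLinearMap.id ℂ (ℂ × ℂ) - fderiv ℂ Φ a) ξ = 0 := by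
    have := LinearMap.bot_lt_ker_of_det_eq_zero (f := ((ContinuousLinearMap.id ℂ (ℂ × ℂ) -
      fderiv ℂ Φ a : ℂ × ℂ →L[ℂ] ℂ × ℂ) : (ℂ × ℂ) →ₗ[ℂ] (ℂ × ℂ))) hdet
    obtain ⟨ξ, h1, h2⟩ := Submodule.exists_mem_ne_zero_of_ne_bot this.ne'
    exact ⟨ξ, h2, h1⟩
  refine two_le_interMult (analyticAt_id_sub hΦ).1 (analyticAt_id_sub hΦ).2 (by simp [ha])
    (by simp [ha]) ξ hξ ?_ ?_
  · rw [(fderiv_id_sub hΦ ξ).1, h]; rfl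
  · rw [(fderiv_id_sub hΦ ξ).2, h]; rfl

theorem cf_zero_left (h : ℂ × ℂ → ℂ) (j : ℕ) :
    cf 0 j (taylor h a) = tcoeff (fun t => h (a.1, t)) a.2 j := by
  rw [cf_taylor, taylorCoeff_eq_tcoeff]
  simp [tcoeff]

theorem cf_one_zero (h : ℂ × ℂ → ℂ) : cf 1 0 (taylor h a) = pderiv₁ h a := by
  rw [cf_taylor, taylorCoeff_eq]; simp

theorem cf_zero_one (h : ℂ × ℂ → ℂ) : cf 0 1 (taylor h a) = pderiv₂ h a := by
  rw [cf_taylor, taylorCoeff_eq]; simp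

theorem cf_one_one {h : ℂ × ℂ → ℂ} (hh : AnalyticAt ℂ h a) :
    cf 1 1 (taylor h a) = pderiv₂ (pderiv₁ h) a := by
  rw [cf_taylor, taylorCoeff_eq]; simp [pderiv_comm hh]

/-- First Taylor coefficients of the parabolic map `t ↦ t / (1 + e t)`. -/
theorem tcoeff_parabolic {ψ : ℂ → ℂ} {s e : ℂ} (hψ : AnalyticAt ℂ ψ s)
    (h : ∀ᶠ t in 𝓝 s, (1 + e * (t - s)) * (ψ t - s) = t - s) :
    tcoeff ψ s 1 = 1 ∧ tcoeff ψ s 2 = -e ∧ tcoeff ψ s 3 = e ^ 2 := by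
  have hl : AnalyticAt ℂ (fun t => 1 + e * (t - s)) s := by fun_prop
  have hx : AnalyticAt ℂ (fun t => ψ t - s) s := hψ.fun_sub analyticAt_const
  have l : ∀ j, tcoeff (fun t => 1 + e * (t - s)) s j =
      if j = 0 then 1 else if j = 1 then e else 0 := by
    intro j
    rcases j with _ | _ | j
    · simp [tcoeff]
    · simp [tcoeff]
    · have h1 : deriv (fun t : ℂ => 1 + e * (t - s)) = fun _ => e := by
        funext t; simp
      rw [tcoeff, iteratedDeriv_succ', h1, iteratedDeriv_const]
      simp
  have x : ∀ j, 0 < j → tcoeff (fun t => ψ t - s) s j = tcoeff ψ s j := by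
    intro j hj
    obtain ⟨j, rfl⟩ := Nat.exists_eq_succ_of_ne_zero hj.ne'
    have h1 : deriv (fun t => ψ t - s) = deriv ψ := by funext t; simp
    rw [tcoeff, tcoeff, iteratedDeriv_succ', iteratedDeriv_succ', h1]
  have x0 : tcoeff (fun t => ψ t - s) s 0 = 0 := by
    have := h.self_of_nhds
    simpa [tcoeff] using this
  -- Coefficients are compared in the product equation, which avoids expanding the quotient.
  have key : ∀ j, _ := fun j => (tcoeff_mul hl hx j).symm.trans
    ((tcoeff_congr h j).trans (tcoeff_sub_const s s j))
  have k1 := key 1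
  have k2 := key 2
  have k3 := key 3
  simp [Finset.Nat.antidiagonal_succ, l, x0, x] at k1 k2 k3
  refine ⟨k1, ?_, ?_⟩
  · rw [k1] at k2; linear_combination k2
  · rw [k1] at k2; linear_combination k3 - e * k2

theorem cf_zero_one_mul (P Q : PowerSeries (PowerSeries ℂ)) :
    cf 0 1 (P * Q) = cf 0 0 P * cf 0 1 Q + cf 0 1 P * cf 0 0 Q := by
  simp [cf_mul, Finset.Nat.antidiagonal_succ]

/-- Normal form of `id - Φ` at a fixed point whose invariant curve `z₁ = a₁` carries a parabolic
map. -/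
theorem parabolic_normal_form {δ e : ℂ} (hΦ : AnalyticAt ℂ Φ a)
    (hdet : ∀ᶠ w in 𝓝 a, (fderiv ℂ Φ w).det = δ) (hδ : δ ≠ 1) (he : e ≠ 0)
    (h₁ : ∀ᶠ t in 𝓝 a.2, (Φ (a.1, t)).1 = a.1)
    (h₂ : ∀ᶠ t in 𝓝 a.2, (1 + e * (t - a.2)) * ((Φ (a.1, t)).2 - a.2) = t - a.2) :
    ∃ m₁₁ m₁₂ m₂₁ m₂₂ : ℂ × ℂ → ℂ, AnalyticAt ℂ m₁₁ a ∧ AnalyticAt ℂ m₁₂ a ∧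
      AnalyticAt ℂ m₂₁ a ∧ AnalyticAt ℂ m₂₂ a ∧ m₁₁ a * m₂₂ a - m₁₂ a * m₂₁ a ≠ 0 ∧
      (∀ᶠ w in 𝓝 a, w.1 - (Φ w).1 = m₁₁ w * (w.1 - a.1) + m₁₂ w * (w.2 - a.2) ^ 2) ∧
      (∀ᶠ w in 𝓝 a, w.2 - (Φ w).2 = m₂₁ w * (w.1 - a.1) + m₂₂ w * (w.2 - a.2) ^ 2) ∧
      cf 0 1 (taylor (fun w => (m₁₁ w * m₂₂ w - m₁₂ w * m₂₁ w)⁻¹) a) = (δ + 1) / (δ - 1) ^ 2 := by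
  have hP : AnalyticAt ℂ (fun w => (Φ w).1) a :=
    AnalyticAt.fun_comp (g := Prod.fst) analyticAt_fst hΦ
  have hQ : AnalyticAt ℂ (fun w => (Φ w).2) a :=
    AnalyticAt.fun_comp (g := Prod.snd) analyticAt_snd hΦ
  obtain ⟨hG₁, hG₂⟩ := analyticAt_id_sub hΦ
  have hψ : AnalyticAt ℂ (fun t => (Φ (a.1, t)).2) a.2 := analyticAt_slice_snd hQ
  obtain ⟨q1, q2, q3⟩ := tcoeff_parabolic hψ h₂
  have p : ∀ j, 0 < j → cf 0 j (taylor (fun w => (Φ w).1) a) = 0 := by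
    intro j hj
    rw [cf_zero_left, tcoeff_congr (ψ := fun _ => a.1) h₁, tcoeff_const, if_neg hj.ne']
  -- the partial derivatives along the curve
  have hline : ∀ᶠ t in 𝓝 a.2, pderiv₁ (fun w => (Φ w).1) (a.1, t) *
      pderiv₂ (fun w => (Φ w).2) (a.1, t) = δ := by
    have c : Tendsto (fun t : ℂ => (a.1, t)) (𝓝 a.2) (𝓝 a) := by
      have : ContinuousAt (fun t : ℂ => (a.1, t)) a.2 := by fun_prop
      exact this
    filter_upwards [c.eventually hdet, c.eventually hΦ.eventually_analyticAt,
      h₁.eventually_nhds] with t t1 t2 t3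
    have d := t2.differentiableAt.hasFDerivAt
    have d1 : HasFDerivAt (fun w => (Φ w).1) _ (a.1, t) := hasFDerivAt_fst.comp _ d
    have d2 : HasFDerivAt (fun w => (Φ w).2) _ (a.1, t) := hasFDerivAt_snd.comp _ d
    -- The curve is invariant, so the Jacobian matrix is triangular along it and its determinant is
    -- the product of the diagonal entries.
    have z : pderiv₂ (fun w => (Φ w).1) (a.1, t) = 0 := by
      have : (fun t => (Φ (a.1, t)).1) =ᶠ[𝓝 t] fun _ => a.1 := t3
      exact this.deriv_eq.trans (deriv_const _ _)
    rw [pderiv₂_eq d1.differentiableAt, d1.fderiv] at z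
    rw [pderiv₁_eq d1.differentiableAt, pderiv₂_eq d2.differentiableAt, d1.fderiv, d2.fderiv, ← t1,
      det_prod]
    simp only [ContinuousLinearMap.comp_apply, ContinuousLinearMap.coe_fst',
      ContinuousLinearMap.coe_snd'] at z ⊢
    rw [z]; ring
  have hψ1 : pderiv₂ (fun w => (Φ w).2) a = 1 := by
    rw [← cf_zero_one, cf_zero_left]; exact q1
  have hψ2 : deriv (fun t => pderiv₂ (fun w => (Φ w).2) (a.1, t)) a.2 = -2 * e := by
    have : tcoeff (fun t => (Φ (a.1, t)).2) a.2 2 = -e := q2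
    rw [tcoeff, iteratedDeriv_succ, iteratedDeriv_one] at this
    have e3 : (fun t => pderiv₂ (fun w => (Φ w).2) (a.1, t)) = deriv (fun t => (Φ (a.1, t)).2) := rfl
    rw [e3]
    norm_num [Nat.factorial] at this
    linear_combination 2 * this
  have p10 : pderiv₁ (fun w => (Φ w).1) a = δ := by
    have := hline.self_of_nhds
    rw [Prod.mk.eta, hψ1, mul_one] at this
    exact this
  -- The constant product of the diagonal entries is differentiated along the curve: constancy of
  -- the Jacobian fixes this second-order term.
  have p11 : pderiv₂ (pderiv₁ (fun w => (Φ w).1)) a = 2 * e * δ := by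
    have e4 : HasDerivAt (fun t => pderiv₁ (fun w => (Φ w).1) (a.1, t))
        (pderiv₂ (pderiv₁ (fun w => (Φ w).1)) a) a.2 :=
      (analyticAt_slice_snd (analyticAt_pderiv₁ hP)).differentiableAt.hasDerivAt
    have e5 := (analyticAt_slice_snd (analyticAt_pderiv₂ hQ)).differentiableAt.hasDerivAt
    have e6 := (e4.mul e5).deriv
    have e7 : deriv (fun t => pderiv₁ (fun w => (Φ w).1) (a.1, t) *
      pderiv₂ (fun w => (Φ w).2) (a.1, t)) a.2 = 0 :=
      (EventuallyEq.deriv_eq (f := fun _ => δ) hline).trans (deriv_const _ _)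
    have e8 := e6.symm.trans e7
    rw [hψ2, Prod.mk.eta, hψ1, p10] at e8
    linear_combination e8
  -- the normal form
  have a2 : Φ a = a := by
    have e1 := h₁.self_of_nhds
    have e2 := h₂.self_of_nhds
    rw [Prod.mk.eta] at e1 e2
    simp only [sub_self, mul_zero, add_zero, one_mul] at e2
    exact Prod.ext e1 (sub_eq_zero.1 e2)
  have z1 : fderiv ℂ (fun w => w.1 - (Φ w).1) a (0, 1) = 0 := by
    have := p 1 one_pos
    rw [cf_zero_one, pderiv₂_eq hP.differentiableAt] at this
    rw [fderiv_fun_sub differentiableAt_fst hP.differentiableAt]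
    simp [this, fderiv_fst]
  have z2 : fderiv ℂ (fun w => w.2 - (Φ w).2) a (0, 1) = 0 := by
    have := hψ1
    rw [pderiv₂_eq hQ.differentiableAt] at this
    rw [fderiv_fun_sub differentiableAt_snd hQ.differentiableAt]
    simp [this, fderiv_snd]
  obtain ⟨m₁₁, m₁₂, h₁₁, h₁₂, E₁⟩ := exists_hadamard_sq hG₁ (by simp [a2]) z1
  obtain ⟨m₂₁, m₂₂, h₂₁, h₂₂, E₂⟩ := exists_hadamard_sq hG₂ (by simp [a2]) z2
  have F₁ : ∀ᶠ w in 𝓝 a, w.1 - (Φ w).1 = m₁₁ w * (w.1 - a.1) + m₁₂ w * (w.2 - a.2) ^ 2 :=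
    E₁.mono fun w hw => by rw [hw]; ring
  have F₂ : ∀ᶠ w in 𝓝 a, w.2 - (Φ w).2 = m₂₁ w * (w.1 - a.1) + m₂₂ w * (w.2 - a.2) ^ 2 :=
    E₂.mono fun w hw => by rw [hw]; ring
  have z₁ := analyticAt_coord_pow₁ a 1
  have z₂ := analyticAt_coord_pow₂ a 2
  have T : ∀ {m m' G : ℂ × ℂ → ℂ}, AnalyticAt ℂ m a → AnalyticAt ℂ m' a →
      (∀ᶠ w in 𝓝 a, G w = m w * (w.1 - a.1) + m' w * (w.2 - a.2) ^ 2) →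
      taylor G a = taylor m a * Z₁ ^ 1 + taylor m' a * Z₂ ^ 2 := by
    intro m m' G hm hm' h
    rw [← (taylor_coord_pow a 1).1, ← (taylor_coord_pow a 2).2, ← taylor_mul hm z₁,
      ← taylor_mul hm' z₂, ← taylor_add (hm.fun_mul z₁) (hm'.fun_mul z₂)]
    exact taylor_congr (h.mono fun w hw => by simp only [hw, pow_one])
  have T₁ := T h₁₁ h₁₂ F₁
  have T₂ := T h₂₁ h₂₂ F₂
  have S₁ : taylor (fun w => w.1 - (Φ w).1) a =
      taylor (fun w => w.1) a - taylor (fun w => (Φ w).1) a := taylor_sub analyticAt_fst hP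
  have S₂ : taylor (fun w => w.2 - (Φ w).2) a =
      taylor (fun w => w.2) a - taylor (fun w => (Φ w).2) a := taylor_sub analyticAt_snd hQ
  have X₁ : ∀ j, 0 < j → cf 0 j (taylor (fun w : ℂ × ℂ => w.1) a) = 0 := by
    intro j hj
    rw [cf_zero_left, tcoeff_const, if_neg hj.ne']
  have X₂ : ∀ j, 1 < j → cf 0 j (taylor (fun w : ℂ × ℂ => w.2) a) = 0 := by
    intro j hj
    rw [cf_zero_left]
    have := tcoeff_sub_const 0 a.2 j
    simp only [sub_zero] at this
    rw [this, if_neg (by omega), if_neg (by omega)]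
  have X10 : cf 1 0 (taylor (fun w : ℂ × ℂ => w.1) a) = 1 := by
    rw [cf_one_zero, pderiv₁_eq differentiableAt_fst, fderiv_fst]; rfl
  have X11 : cf 1 1 (taylor (fun w : ℂ × ℂ => w.1) a) = 0 := by
    have : pderiv₁ (fun w : ℂ × ℂ => w.1) = fun _ => 1 := by
      funext w; simp [pderiv₁]
    rw [cf_one_one analyticAt_fst, this]
    simp [pderiv₂]
  rw [S₁] at T₁
  rw [S₂] at T₂
  -- Only terms up to first order in `z₂` on `z₁ = a₁` enter. There `m₁₂` vanishes to that order,
  -- `m₁₁ = 1 - δ - 2eδ z₂ + …` and `m₂₂ = e - e² z₂ + …`, so `m₂₁` is irrelevant.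
  have B0 := congrArg (cf 0 2) T₁
  have B1 := congrArg (cf 0 3) T₁
  have A0 := congrArg (cf 1 0) T₁
  have A1 := congrArg (cf 1 1) T₁
  have D0 := congrArg (cf 0 2) T₂
  have D1 := congrArg (cf 0 3) T₂
  rw [cf_sub, cf_add, cf_mul_Z₁_pow, cf_mul_Z₂_pow] at B0 B1 A0 A1 D0 D1
  rw [X₁ 2 (by norm_num), p 2 (by norm_num)] at B0
  rw [X₁ 3 (by norm_num), p 3 (by norm_num)] at B1
  rw [X10, cf_one_zero, p10] at A0
  rw [X11, cf_one_one hP, p11] at A1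
  rw [X₂ 2 (by norm_num), cf_zero_left, q2] at D0
  rw [X₂ 3 (by norm_num), cf_zero_left, q3] at D1
  norm_num at B0 B1 A0 A1 D0 D1
  have hD : AnalyticAt ℂ (fun w => m₁₁ w * m₂₂ w - m₁₂ w * m₂₁ w) a :=
    (h₁₁.fun_mul h₂₂).fun_sub (h₁₂.fun_mul h₂₁)
  have v : ∀ m : ℂ × ℂ → ℂ, m a = cf 0 0 (taylor m a) := fun m => by
    rw [cf_taylor, taylorCoeff_zero_zero]
  have d00 : m₁₁ a * m₂₂ a - m₁₂ a * m₂₁ a = (1 - δ) * e := by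
    rw [v m₁₁, v m₁₂, v m₂₂, ← A0, ← B0, ← D0]; ring
  have hne : (1 - δ) * e ≠ 0 := mul_ne_zero (sub_ne_zero.2 hδ.symm) he
  have hne' : m₁₁ a * m₂₂ a - m₁₂ a * m₂₁ a ≠ 0 := by rwa [d00]
  refine ⟨m₁₁, m₁₂, m₂₁, m₂₂, h₁₁, h₁₂, h₂₁, h₂₂, hne', F₁, F₂, ?_⟩
  have d01 : cf 0 1 (taylor (fun w => m₁₁ w * m₂₂ w - m₁₂ w * m₂₁ w) a) =
      -(1 + δ) * e ^ 2 := by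
    rw [taylor_sub (h₁₁.fun_mul h₂₂) (h₁₂.fun_mul h₂₁), taylor_mul h₁₁ h₂₂, taylor_mul h₁₂ h₂₁,
      cf_sub, cf_zero_one_mul, cf_zero_one_mul, ← A0, ← A1, ← B0, ← B1, ← D0, ← D1]
    ring
  have hk : taylor (fun w => (m₁₁ w * m₂₂ w - m₁₂ w * m₂₁ w) *
      (m₁₁ w * m₂₂ w - m₁₂ w * m₂₁ w)⁻¹) a = taylor (fun _ => 1) a := by
    refine taylor_congr ?_
    filter_upwards [hD.continuousAt.eventually_ne hne'] with w hw
    exact mul_inv_cancel₀ hw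
  rw [taylor_mul hD (hD.fun_inv hne')] at hk
  have k1 := congrArg (cf 0 1) hk
  rw [cf_zero_one_mul, ← v, ← v, d00, d01, cf_zero_left (fun _ => (1 : ℂ)), tcoeff_const,
    if_neg one_ne_zero] at k1
  have h1δ : δ - 1 ≠ 0 := sub_ne_zero.2 hδ
  have h1δ' : 1 - δ ≠ 0 := sub_ne_zero.2 hδ.symm
  rw [eq_div_iff (pow_ne_zero 2 h1δ)]
  have k2 : (1 - δ) * (1 - δ) * e * cf 0 1 (taylor (fun w => (m₁₁ w * m₂₂ w - m₁₂ w * m₂₁ w)⁻¹) a)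
      = (1 + δ) * e := by
    have : ((1 - δ) * e) * ((1 - δ) * e)⁻¹ = 1 := mul_inv_cancel₀ hne
    linear_combination (1 - δ) * k1 + (1 + δ) * e * this
  refine mul_left_cancel₀ he ?_
  linear_combination k2

/-- The index at a fixed point where an invariant curve `z₁ = a₁` carries a parabolic map. -/
theorem index_parabolic {δ e : ℂ} (hΦ : AnalyticAt ℂ Φ a)
    (hdet : ∀ᶠ w in 𝓝 a, (fderiv ℂ Φ w).det = δ) (hδ : δ ≠ 1) (he : e ≠ 0)
    (h₁ : ∀ᶠ t in 𝓝 a.2, (Φ (a.1, t)).1 = a.1)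
    (h₂ : ∀ᶠ t in 𝓝 a.2, (1 + e * (t - a.2)) * ((Φ (a.1, t)).2 - a.2) = t - a.2) :
    interMult (fun w => w.1 - (Φ w).1) (fun w => w.2 - (Φ w).2) a = 2 ∧
    residue (fun w => w.1 - (Φ w).1) (fun w => w.2 - (Φ w).2) a = (δ + 1) / (δ - 1) ^ 2 := by
  obtain ⟨m₁₁, m₁₂, m₂₁, m₂₂, h₁₁, h₁₂, h₂₁, h₂₂, hne, F₁, F₂, hk⟩ :=
    parabolic_normal_form hΦ hdet hδ he h₁ h₂
  refine ⟨interMult_eq_two h₁₁ h₁₂ h₂₁ h₂₂ hne F₁ F₂, ?_⟩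
  rw [← hk]
  exact residue_eq 0 1 h₁₁ h₁₂ h₂₁ h₂₂ hne (F₁.mono fun w hw => by rw [hw]; ring)
    (F₂.mono fun w hw => by rw [hw]; ring)

/-! ### Exchange of the two coordinates -/

theorem tendsto_swap (a : ℂ × ℂ) : Tendsto Prod.swap (𝓝 a.swap) (𝓝 a) := by
  have := (continuous_swap (X := ℂ) (Y := ℂ)).tendsto a.swap
  rwa [Prod.swap_swap] at this

theorem tendsto_swap' (a : ℂ × ℂ) : Tendsto Prod.swap (𝓝 a) (𝓝 a.swap) :=
  (continuous_swap (X := ℂ) (Y := ℂ)).tendsto a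

theorem analyticAt_swap (a : ℂ × ℂ) : AnalyticAt ℂ (Prod.swap : ℂ × ℂ → ℂ × ℂ) a :=
  analyticAt_snd.prod analyticAt_fst

theorem AnalyticAt.comp_swap {E : Type*} [NormedAddCommGroup E] [NormedSpace ℂ E]
    {h : ℂ × ℂ → E} (hh : AnalyticAt ℂ h a) : AnalyticAt ℂ (fun w => h w.swap) a.swap :=
  AnalyticAt.fun_comp (g := h) (by rwa [Prod.swap_swap]) (analyticAt_swap _)

theorem fderiv_comp_swap {h : ℂ × ℂ → ℂ} (hh : DifferentiableAt ℂ h a) (ξ : ℂ × ℂ) :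
    fderiv ℂ (fun w => h w.swap) a.swap ξ = fderiv ℂ h a ξ.swap := by
  have hs : HasFDerivAt (Prod.swap : ℂ × ℂ → ℂ × ℂ)
      ((ContinuousLinearMap.snd ℂ ℂ ℂ).prod (ContinuousLinearMap.fst ℂ ℂ ℂ)) a.swap :=
    hasFDerivAt_snd.prodMk hasFDerivAt_fst
  have h1 : HasFDerivAt h (fderiv ℂ h a) a.swap.swap := by
    rw [Prod.swap_swap]; exact hh.hasFDerivAt
  have : HasFDerivAt (fun w : ℂ × ℂ => h w.swap) _ a.swap := h1.comp a.swap hs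
  rw [this.fderiv]
  rfl

/-- The coordinate swap exchanges the generators of the ideals. -/
theorem interMult_coord_sq' (a : ℂ × ℂ) (h : holAt a) :
    h ∈ germIdeal (fun w => (w.1 - a.1) ^ 2) (fun w => w.2 - a.2) a ↔
      ((evalGerm a).prod (dirGerm a (1, 0))) h = 0 := by
  have hs : AnalyticAt ℂ (fun w => h.1 w.swap) a.swap := AnalyticAt.comp_swap h.2
  have e := interMult_coord_sq a.swap ⟨_, hs⟩
  have h1 : AnalyticAt ℂ h.1 a := h.2
  have e2 : ((evalGerm a.swap).prod (dirGerm a.swap (0, 1))) ⟨_, hs⟩ =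
      ((evalGerm a).prod (dirGerm a (1, 0))) h := by
    refine Prod.ext ?_ ?_
    · change h.1 a.swap.swap = h.1 a
      rw [Prod.swap_swap]
    · exact fderiv_comp_swap h1.differentiableAt _
  rw [← e2, ← e]
  constructor
  · rintro ⟨c₁, hc₁, c₂, hc₂, H⟩
    refine ⟨_, AnalyticAt.comp_swap hc₂, _, AnalyticAt.comp_swap hc₁, ?_⟩
    filter_upwards [(tendsto_swap a).eventually H] with w hw
    simp only [hw, Prod.fst_swap, Prod.snd_swap]
    ring
  · rintro ⟨c₁, hc₁, c₂, hc₂, H⟩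
    have k₁ := AnalyticAt.comp_swap (a := a.swap) hc₁
    have k₂ := AnalyticAt.comp_swap (a := a.swap) hc₂
    rw [Prod.swap_swap] at k₁ k₂
    refine ⟨_, k₂, _, k₁, ?_⟩
    filter_upwards [(tendsto_swap' a).eventually H] with w hw
    simp only [Prod.swap_swap] at hw
    simp only [hw, Prod.fst_swap, Prod.snd_swap]
    ring

/-- The index at a fixed point where an invariant curve `z₂ = a₂` carries a parabolic map. -/
theorem index_parabolic' {δ e : ℂ} (hΦ : AnalyticAt ℂ Φ a)
    (hdet : ∀ᶠ w in 𝓝 a, (fderiv ℂ Φ w).det = δ) (hδ : δ ≠ 1) (he : e ≠ 0)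
    (h₁ : ∀ᶠ t in 𝓝 a.1, (Φ (t, a.2)).2 = a.2)
    (h₂ : ∀ᶠ t in 𝓝 a.1, (1 + e * (t - a.1)) * ((Φ (t, a.2)).1 - a.1) = t - a.1) :
    interMult (fun w => w.1 - (Φ w).1) (fun w => w.2 - (Φ w).2) a = 2 ∧
    residue (fun w => w.1 - (Φ w).1) (fun w => w.2 - (Φ w).2) a = (δ + 1) / (δ - 1) ^ 2 := by
  have hs : AnalyticAt ℂ (fun w => (Φ w.swap).swap) a.swap :=
    AnalyticAt.comp_swap (h := fun w => (Φ w).swap)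
      (AnalyticAt.fun_comp (g := Prod.swap) (analyticAt_swap _) hΦ)
  have hd : ∀ᶠ w in 𝓝 a.swap, (fderiv ℂ (fun w => (Φ w.swap).swap) w).det = δ := by
    filter_upwards [(tendsto_swap a).eventually hdet,
      (tendsto_swap a).eventually hΦ.eventually_analyticAt] with w w1 w2
    have d := w2.differentiableAt.hasFDerivAt
    have s1 : HasFDerivAt (Prod.swap : ℂ × ℂ → ℂ × ℂ)
      ((ContinuousLinearMap.snd ℂ ℂ ℂ).prod (ContinuousLinearMap.fst ℂ ℂ ℂ)) w :=
      hasFDerivAt_snd.prodMk hasFDerivAt_fst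
    have s2 : HasFDerivAt (Prod.swap : ℂ × ℂ → ℂ × ℂ)
      ((ContinuousLinearMap.snd ℂ ℂ ℂ).prod (ContinuousLinearMap.fst ℂ ℂ ℂ)) (Φ w.swap) :=
      hasFDerivAt_snd.prodMk hasFDerivAt_fst
    have d1 : HasFDerivAt (fun w : ℂ × ℂ => Φ w.swap) _ w := d.comp w s1
    have d2 : HasFDerivAt (fun w : ℂ × ℂ => (Φ w.swap).swap) _ w :=
      HasFDerivAt.comp (g := Prod.swap) w s2 d1
    rw [d2.fderiv, ← w1, det_prod, det_prod]
    simp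
    ring
  obtain ⟨m₁₁, m₁₂, m₂₁, m₂₂, h₁₁, h₁₂, h₂₁, h₂₂, hne, F₁, F₂, hk⟩ :=
    parabolic_normal_form hs hd hδ he h₁ h₂
  have k₁₁ := AnalyticAt.comp_swap (a := a.swap) h₁₁
  have k₁₂ := AnalyticAt.comp_swap (a := a.swap) h₁₂
  have k₂₁ := AnalyticAt.comp_swap (a := a.swap) h₂₁
  have k₂₂ := AnalyticAt.comp_swap (a := a.swap) h₂₂
  rw [Prod.swap_swap] at k₁₁ k₁₂ k₂₁ k₂₂
  have G₂ : ∀ᶠ w in 𝓝 a, w.2 - (Φ w).2 =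
      m₁₂ w.swap * (w.1 - a.1) ^ 2 + m₁₁ w.swap * (w.2 - a.2) := by
    filter_upwards [(tendsto_swap' a).eventually F₁] with w hw
    simp only [Prod.swap_swap, Prod.fst_swap, Prod.snd_swap] at hw
    rw [hw]; ring
  have G₁ : ∀ᶠ w in 𝓝 a, w.1 - (Φ w).1 =
      m₂₂ w.swap * (w.1 - a.1) ^ 2 + m₂₁ w.swap * (w.2 - a.2) := by
    filter_upwards [(tendsto_swap' a).eventually F₂] with w hw
    simp only [Prod.swap_swap, Prod.fst_swap, Prod.snd_swap] at hw
    rw [hw]; ring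
  -- The swap exchanges both the rows and the columns of the matrix, so the determinant, and with it
  -- the residue, keeps its sign.
  have hne' : m₂₂ a.swap * m₁₁ a.swap - m₂₁ a.swap * m₁₂ a.swap ≠ 0 := by
    intro h; apply hne; rw [← h]; ring
  constructor
  · rw [interMult_eq ((evalGerm a).prod (dirGerm a (1, 0)))
      (surjective_eval_dir a _ (by simp)) fun h =>
      (mem_germIdeal_iff k₂₂ k₂₁ k₁₂ k₁₁ hne' G₁ G₂ h).trans (interMult_coord_sq' a h)]
    simp
  · rw [← hk, residue_eq 1 0 k₂₂ k₂₁ k₁₂ k₁₁ hne' (G₁.mono fun w hw => by rw [hw]; ring)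
      (G₂.mono fun w hw => by rw [hw]; ring), cf_one_zero, cf_zero_one]
    simp only [pderiv₁, pderiv₂]
    congr 1
    funext s
    congr 1
    simp only [Prod.swap_prod_mk, Prod.fst_swap]
    ring

end

/-! ### Geometry of the atlas -/

theorem affU_eq_affV {u v : ℂ} : affU u = affV v ↔ u * v = 1 := by
  rw [affU, affV, Projectivization.mk_eq_mk_iff']
  constructor
  · rintro ⟨c, hc⟩
    have h0 := congrFun hc 0
    have h1 := congrFun hc 1
    simp at h0 h1
    rw [← h0, h1]
  · intro h
    refine ⟨u, ?_⟩
    funext i; fin_cases i <;> simp [h]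

theorem affV_injective {u v : ℂ} (h : affV u = affV v) : u = v := by
  rw [affV, affV, Projectivization.mk_eq_mk_iff'] at h
  obtain ⟨c, hc⟩ := h
  have h0 := congrFun hc 0
  have h1 := congrFun hc 1
  simp at h0 h1
  rw [← h1, h0, one_mul]

theorem affU_injective {u v : ℂ} (h : affU u = affU v) : u = v := by
  rw [affU, affU, Projectivization.mk_eq_mk_iff'] at h
  obtain ⟨c, hc⟩ := h
  have h0 := congrFun hc 0
  have h1 := congrFun hc 1
  simp at h0 h1
  rw [← h0, h1, one_mul]

variable {n : ℕ}

theorem toS_chart (k : Fin (n + 1)) (w : ℂ × ℂ) : toS (chart k w) =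
    (w.1 * w.2, w.1 ^ (n + 1 - k : ℕ) * w.2 ^ (n - k : ℕ), w.1 ^ (k : ℕ) * w.2 ^ (k + 1 : ℕ)) := rfl

theorem chart_snd_lt (k : Fin (n + 1)) (w : ℂ × ℂ) (j : Fin n) (h : (j : ℕ) + 1 ≤ k) :
    (chart k w).1.2 j = affV (w.1 ^ (k - (j + 1) : ℕ) * w.2 ^ (k + 1 - (j + 1) : ℕ)) := if_pos h

theorem chart_snd_ge (k : Fin (n + 1)) (w : ℂ × ℂ) (j : Fin n) (h : (k : ℕ) ≤ j) :
    (chart k w).1.2 j = affU (w.1 ^ (j + 1 - k : ℕ) * w.2 ^ (j + 1 - k - 1 : ℕ)) :=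
  if_neg (by omega)

theorem chart_snd_self (k : Fin (n + 1)) (w : ℂ × ℂ) (j : Fin n) (h : (k : ℕ) = j) :
    (chart k w).1.2 j = affU w.1 := by
  rw [chart_snd_ge k w j h.le, h]; simp

theorem chart_snd_pred (k : Fin (n + 1)) (w : ℂ × ℂ) (j : Fin n) (h : (k : ℕ) = j + 1) :
    (chart k w).1.2 j = affV w.2 := by
  rw [chart_snd_lt k w j h.ge, h]; simp

/-- The coordinate `u` is seen in the factor with index `k`, or as `y = u` if `k = n`; `v` is seen
in the factor with index `k - 1`, or as `z = v` if `k = 0`. -/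
theorem chart_injective (k : Fin (n + 1)) : Function.Injective (chart (n := n) k) := by
  intro w w' h
  have hk := k.is_lt
  refine Prod.ext ?_ ?_
  · by_cases hkn : (k : ℕ) < n
    · have := congrArg (fun p : X n => p.1.2 ⟨k, hkn⟩) h
      simp only [chart_snd_self k _ ⟨k, hkn⟩ rfl] at this
      exact affU_injective this
    · have := congrArg (fun p : X n => (toS p).2.1) h
      simp only [toS_chart, show n - (k : ℕ) = 0 by omega, show n + 1 - (k : ℕ) = 1 by omega] at this
      simpa using this
  · by_cases hk0 : (k : ℕ) = 0
    · have := congrArg (fun p : X n => (toS p).2.2) h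
      simp only [toS_chart, hk0] at this
      simpa using this
    · have e : (k : ℕ) = ((⟨k - 1, by omega⟩ : Fin n) : ℕ) + 1 := by
        change (k : ℕ) = k - 1 + 1
        omega
      have := congrArg (fun p : X n => p.1.2 ⟨k - 1, by omega⟩) h
      simp only [chart_snd_pred k _ _ e] at this
      exact affV_injective this

/-- In the shared factor `[u : 1] = [1 : u⁻¹]`, and the other new coordinate is forced by `x = u v`,
which is the product of the coordinates in every chart. -/
theorem chart_succ (k l : Fin (n + 1)) (hl : (l : ℕ) = k + 1) (w : ℂ × ℂ) (hw : w.1 ≠ 0) :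
    chart k w = chart l (w.1 ^ 2 * w.2, w.1⁻¹) := by
  obtain ⟨u, v⟩ := w
  have hln := l.is_lt
  simp only at hw
  have cancel : ∀ a b : ℕ, a = b → u ^ a * u⁻¹ ^ b = 1 := fun a b h => by
    rw [h, inv_pow, mul_inv_cancel₀ (pow_ne_zero _ hw)]
  refine Subtype.ext (Prod.ext ?_ ?_)
  · change toS _ = toS _
    simp only [toS_chart, hl]
    refine Prod.ext ?_ (Prod.ext ?_ ?_)
    · change u * v = u ^ 2 * v * u⁻¹
      field_simp
    · change u ^ (n + 1 - (k : ℕ)) * v ^ (n - (k : ℕ)) =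
        (u ^ 2 * v) ^ (n + 1 - (k + 1) : ℕ) * u⁻¹ ^ (n - (k + 1) : ℕ)
      obtain ⟨d, hd⟩ : ∃ d, n = k + 1 + d := ⟨n - (k + 1), by omega⟩
      rw [show n + 1 - (k : ℕ) = d + 2 by omega, show n - (k : ℕ) = d + 1 by omega,
        show n + 1 - ((k : ℕ) + 1) = d + 1 by omega, show n - ((k : ℕ) + 1) = d by omega]
      linear_combination -(u ^ (d + 2) * v ^ (d + 1)) * cancel d d rfl
    · change u ^ (k : ℕ) * v ^ ((k : ℕ) + 1) =
        (u ^ 2 * v) ^ ((k : ℕ) + 1) * u⁻¹ ^ ((k : ℕ) + 1 + 1)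
      linear_combination -(u ^ (k : ℕ) * v ^ ((k : ℕ) + 1)) * cancel (k + 2) (k + 2) rfl
  · funext j
    rcases lt_trichotomy (j : ℕ) k with h | h | h
    · rw [chart_snd_lt k _ j (by omega), chart_snd_lt l _ j (by omega)]
      obtain ⟨d, hd⟩ : ∃ d, (k : ℕ) = j + 1 + d := ⟨k - (j + 1), by omega⟩
      rw [show (k : ℕ) - (j + 1) = d by omega, show (k : ℕ) + 1 - (j + 1) = d + 1 by omega,
        show (l : ℕ) - (j + 1) = d + 1 by omega, show (l : ℕ) + 1 - (j + 1) = d + 2 by omega]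
      congr 1
      simp only
      linear_combination -(u ^ d * v ^ (d + 1)) * cancel (d + 2) (d + 2) rfl
    · rw [chart_snd_self k _ j h.symm, chart_snd_pred l _ j (by omega), affU_eq_affV]
      exact mul_inv_cancel₀ hw
    · rw [chart_snd_ge k _ j (by omega), chart_snd_ge l _ j (by omega)]
      obtain ⟨d, hd⟩ : ∃ d, (j : ℕ) = k + 1 + d := ⟨j - (k + 1), by omega⟩
      rw [show (j : ℕ) + 1 - k = d + 2 by omega, show (j : ℕ) + 1 - l = d + 1 by omega]
      congr 1
      simp only [show d + 2 - 1 = d + 1 from rfl, show d + 1 - 1 = d from rfl]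
      linear_combination -(u ^ (d + 2) * v ^ (d + 1)) * cancel d d rfl

/-- The converse transition map. -/
theorem chart_pred (k l : Fin (n + 1)) (hl : (l : ℕ) = k + 1) (w : ℂ × ℂ) (hw : w.2 ≠ 0) :
    chart l w = chart k (w.2⁻¹, w.2 ^ 2 * w.1) := by
  rw [chart_succ k l hl _ (inv_ne_zero hw)]
  congr 1
  refine Prod.ext ?_ ?_
  · simp; field_simp
  · simp

/-- `x = u v = 0` leaves the two axes. The axis `u = 0` for `k = 0` and the axis `v = 0` for `k = n`
are the noncompact ends of the chain, where `z = v` and `y = u` do not vanish identically. -/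
theorem chart_mem_exc (hn : 1 ≤ n) (k : Fin (n + 1)) (w : ℂ × ℂ) :
    chart k w ∈ exc n ↔ (w.1 = 0 ∧ 1 ≤ (k : ℕ)) ∨ (w.2 = 0 ∧ (k : ℕ) < n) := by
  have hk := k.is_lt
  change toS _ = 0 ↔ _
  rw [toS_chart]
  obtain ⟨u, v⟩ := w
  simp only [Prod.mk_eq_zero, mul_eq_zero, pow_eq_zero_iff', ne_eq]
  generalize (k : ℕ) = m at hk ⊢
  by_cases hu : u = 0 <;> by_cases hv : v = 0 <;> simp [hu, hv] <;> omega

/-- A finite point `[u : 1]` is never `[1 : 0]`, and `[1 : v]` is never `[0 : 1]`. This excludes the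
charts `k < i` and `k > i + 1`, so a curve is covered by one axis in each of two neighbouring
charts. -/
theorem chart_mem_curve (k : Fin (n + 1)) (i : Fin n) (w : ℂ × ℂ) :
    chart k w ∈ curve i ↔ ((k : ℕ) = i ∧ w.2 = 0) ∨ ((k : ℕ) = i + 1 ∧ w.1 = 0) := by
  have hk := k.is_lt
  have hi := i.is_lt
  constructor
  · rintro ⟨h0, h1, h2⟩
    have e := (chart_mem_exc (by omega) k w).1 h0
    rcases lt_trichotomy (k : ℕ) i with h | h | h
    · have := h1 ⟨k, by omega⟩ h
      rw [chart_snd_self k w _ rfl, affU_eq_affV] at this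
      simp at this
    · left
      refine ⟨h, ?_⟩
      rcases e with e | e
      · have e' : (k : ℕ) = ((⟨k - 1, by omega⟩ : Fin n) : ℕ) + 1 := by
          change (k : ℕ) = k - 1 + 1
          omega
        have := h1 ⟨k - 1, by omega⟩ (by change (k : ℕ) - 1 < i; omega)
        rw [chart_snd_pred k w _ e'] at this
        exact affV_injective this
      · exact e.1
    · right
      rcases Nat.eq_or_lt_of_le (Nat.succ_le_of_lt h) with h | h
      · refine ⟨h.symm, ?_⟩
        rcases e with e | e
        · exact e.1
        · have := h2 ⟨k, e.2⟩ (by change (i : ℕ) < k; omega)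
          rw [chart_snd_self k w _ rfl] at this
          exact affU_injective this
      · have := h2 ⟨k - 1, by omega⟩ (by change (i : ℕ) < k - 1; omega)
        have e' : (k : ℕ) = ((⟨k - 1, by omega⟩ : Fin n) : ℕ) + 1 := by
          change (k : ℕ) = k - 1 + 1
          omega
        rw [chart_snd_pred k w _ e'] at this
        have := affU_eq_affV.1 this.symm
        simp at this
  · rintro (⟨h, hw⟩ | ⟨h, hw⟩)
    · refine ⟨(chart_mem_exc (by omega) k w).2 (Or.inr ⟨hw, by omega⟩), fun j hj => ?_,
        fun j hj => ?_⟩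
      · have hj : (j : ℕ) < i := hj
        rw [chart_snd_lt k w j (by omega), hw, zero_pow (by omega), mul_zero]
      · have hj : (i : ℕ) < j := hj
        rw [chart_snd_ge k w j (by omega), hw, zero_pow (by omega), mul_zero]
    · refine ⟨(chart_mem_exc (by omega) k w).2 (Or.inl ⟨hw, by omega⟩), fun j hj => ?_,
        fun j hj => ?_⟩
      · have hj : (j : ℕ) < i := hj
        rw [chart_snd_lt k w j (by omega), hw, zero_pow (by omega), zero_mul]
      · have hj : (i : ℕ) < j := hj
        rw [chart_snd_ge k w j (by omega), hw, zero_pow (by omega), zero_mul]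

/-- Near the exceptional set only neighbouring charts overlap. -/
theorem chart_eq_chart_of_lt (hn : 1 ≤ n) {k l : Fin (n + 1)} {w w' : ℂ × ℂ} (hkl : (k : ℕ) < l)
    (h : chart k w = chart l w') (he : chart k w ∈ exc n) :
    (l : ℕ) = k + 1 ∧ w.1 ≠ 0 ∧ w' = (w.1 ^ 2 * w.2, w.1⁻¹) := by
  have hl := l.is_lt
  have e := (chart_mem_exc hn k w).1 he
  have h1 := congrArg (fun p : X n => p.1.2 ⟨k, by omega⟩) h
  simp only [chart_snd_self k w ⟨k, by omega⟩ rfl] at h1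
  have hkl' : ((⟨k, by omega⟩ : Fin n) : ℕ) + 1 ≤ l := hkl
  rw [chart_snd_lt l w' _ hkl', affU_eq_affV] at h1
  have hu : w.1 ≠ 0 := left_ne_zero_of_mul_eq_one h1
  -- If the charts were further apart, the next factor would force `v ≠ 0` besides `u ≠ 0`, off the
  -- exceptional set.
  have hl' : (l : ℕ) = k + 1 := by
    by_contra hne
    have h2 : (chart k w).1.2 ⟨k + 1, by omega⟩ = (chart l w').1.2 ⟨k + 1, by omega⟩ := by rw [h]
    rw [chart_snd_ge k w _ (Nat.le_succ _), chart_snd_lt l w' _ (by change (k : ℕ) + 1 + 1 ≤ l; omega),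
      affU_eq_affV] at h2
    have h3 := left_ne_zero_of_mul_eq_one h2
    have hv : w.2 ≠ 0 := by
      intro hv
      apply h3
      rw [hv, zero_pow, mul_zero]
      change (k : ℕ) + 1 + 1 - k - 1 ≠ 0
      omega
    rcases e with e | e
    · exact hu e.1
    · exact hv e.1
  refine ⟨hl', hu, ?_⟩
  rw [chart_succ k l hl' w hu] at h
  exact (chart_injective l h).symm

/-- Every point of the exceptional set is `chart 0 (0, 0)` or lies on the axis `u = 0` of a chart
`k ≥ 1`. -/
theorem exists_chart_of_mem_exc {p : X n} (hp : p ∈ exc n) :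
    ∃ (k : Fin (n + 1)) (v : ℂ), chart k (0, v) = p ∧ ((k : ℕ) = 0 → v = 0) := by
  obtain ⟨⟨S, q⟩, a, b, ha0, han, hb0, hbn, hab, heq⟩ := p
  have hS : S = 0 := hp
  subst hS
  simp only [Prod.snd_zero, Prod.fst_zero, mul_zero] at han hb0 hbn hab heq
  -- the last index with `a k ≠ 0`
  have hex : ∃ k, k ≤ n ∧ a k ≠ 0 := ⟨0, Nat.zero_le _, by simp [ha0]⟩
  classical
  obtain ⟨hkn, hak⟩ : Nat.findGreatest (fun k => a k ≠ 0) n ≤ n ∧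
      a (Nat.findGreatest (fun k => a k ≠ 0) n) ≠ 0 :=
    ⟨Nat.findGreatest_le n, Nat.findGreatest_spec (P := fun k => a k ≠ 0) (Nat.zero_le n)
      (by simp [ha0])⟩
  have hgt : ∀ j, Nat.findGreatest (fun k => a k ≠ 0) n < j → j ≤ n → a j = 0 := fun j h1 h2 =>
    not_not.1 (Nat.findGreatest_is_greatest (P := fun k => a k ≠ 0) h1 h2)
  generalize Nat.findGreatest (fun k => a k ≠ 0) n = k at hkn hak hgt
  -- Descending induction: with `x = 0` the equations read `a_(j+1) b_j = 0`, so `b_j = 0`, and then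
  -- `a_j ≠ 0` because `[a_j : b_j]` is a point of the projective line.
  have hlt : ∀ d j, j + d + 1 = k → b j = 0 ∧ a j ≠ 0 := by
    intro d
    induction d with
    | zero =>
      intro j hj
      have hbj : b j = 0 := by
        have := heq j (by omega)
        rw [show j + 1 = k by omega] at this
        exact (mul_eq_zero.1 this.symm).resolve_left hak
      refine ⟨hbj, fun haj => ?_⟩
      rcases j with _ | j
      · rw [ha0] at haj; exact one_ne_zero haj
      · obtain ⟨hne, -⟩ := hab ⟨j, by omega⟩
        apply hne
        simp [haj, hbj]
    | succ d ih =>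
      intro j hj
      have haj1 := (ih (j + 1) (by omega)).2
      have hbj : b j = 0 := by
        have := heq j (by omega)
        exact (mul_eq_zero.1 this.symm).resolve_left haj1
      refine ⟨hbj, fun haj => ?_⟩
      rcases j with _ | j
      · rw [ha0] at haj; exact one_ne_zero haj
      · obtain ⟨hne, -⟩ := hab ⟨j, by omega⟩
        apply hne
        simp [haj, hbj]
  have hv0 : k = 0 → b k / a k = 0 := by rintro rfl; rw [hb0, zero_div]
  refine ⟨⟨k, by omega⟩, b k / a k, ?_, hv0⟩
  refine Subtype.ext (Prod.ext ?_ ?_)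
  · change toS _ = 0
    rw [toS_chart]
    refine Prod.ext (by simp) (Prod.ext ?_ ?_)
    · change (0 : ℂ) ^ (n + 1 - k) * _ = 0
      rw [zero_pow (by omega), zero_mul]
    · change (0 : ℂ) ^ k * (b k / a k) ^ (k + 1) = 0
      rcases Nat.eq_zero_or_pos k with h | h
      · rw [hv0 h]; simp
      · rw [zero_pow (by omega), zero_mul]
  · funext j
    obtain ⟨hne, hj⟩ := hab j
    change _ = q j
    rw [← hj]
    rcases lt_trichotomy ((j : ℕ) + 1) k with h | h | h
    · have hbj := (hlt (k - (j + 1) - 1) (j + 1) (by omega))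
      rw [chart_snd_lt _ _ j h.le]
      simp only
      rw [zero_pow (by omega), zero_mul, affV, Projectivization.mk_eq_mk_iff']
      refine ⟨(a (j + 1))⁻¹, ?_⟩
      funext i; fin_cases i
      · simp [hbj.2]
      · simp [hbj.1]
    · rw [chart_snd_pred _ _ j h.symm, affV, Projectivization.mk_eq_mk_iff']
      refine ⟨(a (j + 1))⁻¹, ?_⟩
      rw [← h] at hak ⊢
      funext i; fin_cases i
      · simp [hak]
      · simp; ring
    · have haj := hgt (j + 1) h j.is_lt
      have hbj : b (j + 1) ≠ 0 := by
        intro hb; apply hne; simp [haj, hb]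
      rw [chart_snd_ge _ _ j (by change k ≤ j; omega)]
      simp only
      rw [zero_pow (by omega), zero_mul, affU, Projectivization.mk_eq_mk_iff']
      refine ⟨(b (j + 1))⁻¹, ?_⟩
      funext i; fin_cases i
      · simp [haj]
      · simp [hbj]

variable {f : X n → X n}

/-! ### Local representations of automorphisms -/

/-- The transition map from the chart `k` to the chart `k + 1`. -/
def trans (w : ℂ × ℂ) : ℂ × ℂ := (w.1 ^ 2 * w.2, w.1⁻¹)

/-- The transition map from the chart `k + 1` to the chart `k`. -/
def trans' (w : ℂ × ℂ) : ℂ × ℂ := (w.2⁻¹, w.2 ^ 2 * w.1)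

theorem analyticAt_trans {w : ℂ × ℂ} (hw : w.1 ≠ 0) : AnalyticAt ℂ trans w :=
  ((analyticAt_fst.fun_pow 2).fun_mul analyticAt_snd).prod (analyticAt_fst.fun_inv hw)

theorem analyticAt_trans' {w : ℂ × ℂ} (hw : w.2 ≠ 0) : AnalyticAt ℂ trans' w :=
  (analyticAt_snd.fun_inv hw).prod ((analyticAt_snd.fun_pow 2).fun_mul analyticAt_fst)

theorem det_comp_clm (A B : ℂ × ℂ →L[ℂ] ℂ × ℂ) : (A ∘SL B).det = A.det * B.det :=
  LinearMap.det_comp _ _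

/-- The form `du ∧ dv` is invariant under transition, which makes Jacobians comparable between
charts. -/
theorem det_fderiv_trans {w : ℂ × ℂ} (hw : w.1 ≠ 0) : (fderiv ℂ trans w).det = 1 := by
  have h := (analyticAt_trans hw).differentiableAt.hasFDerivAt
  have e1 : HasFDerivAt (fun w => (trans w).1) _ w := hasFDerivAt_fst.comp w h
  have e2 : HasFDerivAt (fun w => (trans w).2) _ w := hasFDerivAt_snd.comp w h
  have a1 := pderiv₁_eq e1.differentiableAt
  have a2 := pderiv₂_eq e1.differentiableAt
  have b1 := pderiv₁_eq e2.differentiableAt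
  have b2 := pderiv₂_eq e2.differentiableAt
  rw [e1.fderiv] at a1 a2
  rw [e2.fderiv] at b1 b2
  have c1 : pderiv₁ (fun w => (trans w).1) w = 2 * w.1 * w.2 := by
    simp [pderiv₁, trans]
  have c2 : pderiv₂ (fun w => (trans w).1) w = w.1 ^ 2 := by
    simp [pderiv₂, trans]
  have d1 : pderiv₁ (fun w => (trans w).2) w = -(w.1 ^ 2)⁻¹ := by
    simp [pderiv₁, trans]
  have d2 : pderiv₂ (fun w => (trans w).2) w = 0 := by
    simp [pderiv₂, trans]
  simp only [ContinuousLinearMap.comp_apply, ContinuousLinearMap.coe_fst',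
      ContinuousLinearMap.coe_snd'] at a1 a2 b1 b2
  rw [det_prod, ← a1, ← a2, ← b1, ← b2, c1, c2, d1, d2]
  field_simp
  ring

/-- The chart in which the image lands is not under control in `HolomorphicNearExc`; as only
neighbouring charts overlap there, one transition map moves it to any chart containing the image
point. A fixed point can thus be studied in a single chart. -/
theorem IsLocalRep.change_target (hn : 1 ≤ n) {k l l' : Fin (n + 1)} {a b : ℂ × ℂ}
    {F : ℂ × ℂ → ℂ × ℂ} (hF : IsLocalRep f k l a F) (he : f (chart k a) ∈ exc n)
    (hb : f (chart k a) = chart l' b) : ∃ F', IsLocalRep f k l' a F' ∧ F' a = b := by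
  obtain ⟨hFa, hFe⟩ := hF
  have h0 := hFe.self_of_nhds
  have h1 : chart l (F a) = chart l' b := h0.symm.trans hb
  rcases lt_trichotomy (l : ℕ) l' with h | h | h
  · obtain ⟨hl, hu, rfl⟩ := chart_eq_chart_of_lt hn h h1 (h0 ▸ he)
    refine ⟨fun w => trans (F w), ⟨(analyticAt_trans hu).fun_comp hFa, ?_⟩, rfl⟩
    have hc : ContinuousAt (fun w => (F w).1) a := hFa.continuousAt.fst
    filter_upwards [hFe, hc.eventually_ne hu] with w hw hw'
    rw [hw, chart_succ l l' hl _ hw']; rfl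
  · obtain rfl := Fin.ext h
    exact ⟨F, ⟨hFa, hFe⟩, chart_injective l h1⟩
  · obtain ⟨hl, hu, hb'⟩ := chart_eq_chart_of_lt hn h h1.symm (hb ▸ he)
    have hu' : (F a).2 ≠ 0 := by rw [hb']; exact inv_ne_zero hu
    refine ⟨fun w => trans' (F w), ⟨(analyticAt_trans' hu').fun_comp hFa, ?_⟩, ?_⟩
    · have hc : ContinuousAt (fun w => (F w).2) a := hFa.continuousAt.snd
      filter_upwards [hFe, hc.eventually_ne hu'] with w hw hw'
      rw [hw, chart_pred l' l hl _ hw']; rfl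
    · simp only [trans', hb']
      refine Prod.ext ?_ ?_
      · simp
      · simp; field_simp

theorem exists_localRep (hn : 1 ≤ n) (hf : HolomorphicNearExc f)
    (hm : Set.MapsTo f (exc n) (exc n)) {k l : Fin (n + 1)} {a b : ℂ × ℂ}
    (ha : chart k a ∈ exc n) (hb : f (chart k a) = chart l b) :
    ∃ F, IsLocalRep f k l a F ∧ F a = b := by
  obtain ⟨l', F, hF⟩ := hf k a ha
  exact hF.change_target hn (hm ha) hb

theorem exists_chart_eq {p : X n} (hp : p ∈ exc n) :
    ∃ (k : Fin (n + 1)) (a : ℂ × ℂ), chart k a = p := by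
  obtain ⟨k, v, h, -⟩ := exists_chart_of_mem_exc hp
  exact ⟨k, _, h⟩

theorem EqNearExc.eq {g : X n → X n} (h : EqNearExc f g) {p : X n} (hp : p ∈ exc n) :
    f p = g p := by
  obtain ⟨k, a, rfl⟩ := exists_chart_eq hp
  exact (h k a hp).self_of_nhds

theorem IsAut.mapsTo (hf : IsAut f) : Set.MapsTo f (exc n) (exc n) := hf.2.1

theorem IsAut.injOn (hf : IsAut f) : Set.InjOn f (exc n) := by
  obtain ⟨-, -, g, -, -, hgf, -⟩ := hf
  intro p hp q hq h
  have e1 := hgf.eq hp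
  have e2 := hgf.eq hq
  simp only [Function.comp_apply, id] at e1 e2
  rw [← e1, h, e2]

theorem IsAut.exists_localRep (hn : 1 ≤ n) (hf : IsAut f) {k l : Fin (n + 1)} {a b : ℂ × ℂ}
    (ha : chart k a ∈ exc n) (hb : f (chart k a) = chart l b) :
    ∃ F, IsLocalRep f k l a F ∧ F a = b :=
  AnResolution.exists_localRep hn hf.1 hf.2.1 ha hb

/-- The chain rule for the inverse germ: the two Jacobian determinants multiply to `1`. -/
theorem twist_ne_zero (hn : 1 ≤ n) (hf : IsAut f) {δ : ℂ} (hδ : HasTwist f δ) : δ ≠ 0 := by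
  obtain ⟨hh, hm, g, hg, hgm, hgf, -⟩ := hf
  have h0 : chart (n := n) 0 (0, 0) ∈ exc n := (chart_mem_exc hn 0 _).2 (Or.inr ⟨rfl, hn⟩)
  obtain ⟨l, F, hF⟩ := hh 0 (0, 0) h0
  have hF0 : f (chart 0 (0, 0)) = chart l (F (0, 0)) := hF.2.self_of_nhds
  have hg0 : g (chart l (F (0, 0))) = chart 0 (0, 0) := by
    rw [← hF0]; exact hgf.eq h0
  have h1 : chart l (F (0, 0)) ∈ exc n := hF0 ▸ hm h0
  obtain ⟨G, hG, hG0⟩ := AnResolution.exists_localRep hn hg hgm h1 hg0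
  have hid : ∀ᶠ w in 𝓝 ((0, 0) : ℂ × ℂ), G (F w) = w := by
    filter_upwards [hF.2, hF.1.continuousAt.eventually hG.2, hgf 0 _ h0] with w w1 w2 w3
    simp only [Function.comp_apply, id] at w3
    rw [w1, w2] at w3
    exact chart_injective 0 w3
  have hd : HasFDerivAt (fun w => G (F w)) _ ((0, 0) : ℂ × ℂ) :=
    hG.1.differentiableAt.hasFDerivAt.comp _ hF.1.differentiableAt.hasFDerivAt
  have hd' := hd.unique ((hasFDerivAt_id _).congr_of_eventuallyEq hid)
  have hdet := (hδ 0 l _ F h0 hF).self_of_nhds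
  intro hδ0
  rw [hδ0] at hdet
  have h2 : (fderiv ℂ G (F (0, 0)) ∘SL fderiv ℂ F (0, 0)).det = 1 := by
    rw [hd']; simp [ContinuousLinearMap.det]
  rw [det_comp_clm, hdet, mul_zero] at h2
  exact zero_ne_one h2

/-! ### Local indices through local representations -/

theorem interMult_congr {g₁ g₂ h₁ h₂ : ℂ × ℂ → ℂ} {a : ℂ × ℂ} (e₁ : g₁ =ᶠ[𝓝 a] h₁)
    (e₂ : g₂ =ᶠ[𝓝 a] h₂) : interMult g₁ g₂ a = interMult h₁ h₂ a := by
  have : germIdeal g₁ g₂ a = germIdeal h₁ h₂ a := by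
    ext h
    constructor
    · rintro ⟨c₁, hc₁, c₂, hc₂, H⟩
      refine ⟨c₁, hc₁, c₂, hc₂, ?_⟩
      filter_upwards [H, e₁, e₂] with w u1 u2 u3
      rw [u1, u2, u3]
    · rintro ⟨c₁, hc₁, c₂, hc₂, H⟩
      refine ⟨c₁, hc₁, c₂, hc₂, ?_⟩
      filter_upwards [H, e₁, e₂] with w u1 u2 u3
      rw [u1, u2, u3]
  rw [interMult, interMult, this]

theorem residue_congr {g₁ g₂ h₁ h₂ : ℂ × ℂ → ℂ} {a : ℂ × ℂ} (e₁ : g₁ =ᶠ[𝓝 a] h₁)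
    (e₂ : g₂ =ᶠ[𝓝 a] h₂) : residue g₁ g₂ a = residue h₁ h₂ a := by
  have : IsResidue g₁ g₂ a = IsResidue h₁ h₂ a := by
    funext r
    refine propext ⟨?_, ?_⟩
    · rintro ⟨N, c₁₁, c₁₂, c₂₁, c₂₂, k₁₁, k₁₂, k₂₁, k₂₂, H₁, H₂, hr⟩
      refine ⟨N, c₁₁, c₁₂, c₂₁, c₂₂, k₁₁, k₁₂, k₂₁, k₂₂, ?_, ?_, hr⟩
      · filter_upwards [H₁, e₁, e₂] with w u1 u2 u3
        rw [u1, u2, u3]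
      · filter_upwards [H₂, e₁, e₂] with w u1 u2 u3
        rw [u1, u2, u3]
    · rintro ⟨N, c₁₁, c₁₂, c₂₁, c₂₂, k₁₁, k₁₂, k₂₁, k₂₂, H₁, H₂, hr⟩
      refine ⟨N, c₁₁, c₁₂, c₂₁, c₂₂, k₁₁, k₁₂, k₂₁, k₂₂, ?_, ?_, hr⟩
      · filter_upwards [H₁, e₁, e₂] with w u1 u2 u3
        rw [u1, u2, u3]
      · filter_upwards [H₂, e₁, e₂] with w u1 u2 u3
        rw [u1, u2, u3]
  rw [residue, residue, this]

theorem IsLocalRep.inChart_eq {k : Fin (n + 1)} {a : ℂ × ℂ} {F : ℂ × ℂ → ℂ × ℂ}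
    (hF : IsLocalRep f k k a F) : inChart f k =ᶠ[𝓝 a] F := by
  filter_upwards [hF.2] with w hw
  rw [inChart, hw, Function.leftInverse_invFun (chart_injective k)]

/-- `Function.invFun` is meaningful only on the range of the charts, which contains all of `E`. -/
theorem chart_chartPt {p : X n} (hp : p ∈ exc n) : chart (chartPt p).1 (chartPt p).2 = p := by
  obtain ⟨k, a, h⟩ := exists_chart_eq hp
  exact Function.invFun_eq (f := fun q : Fin (n + 1) × (ℂ × ℂ) => chart q.1 q.2) ⟨(k, a), h⟩

theorem IsLocalRep.muAt_eq {p : X n} {F : ℂ × ℂ → ℂ × ℂ}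
    (hF : IsLocalRep f (chartPt p).1 (chartPt p).1 (chartPt p).2 F) :
    muAt f p = interMult (fun w => w.1 - (F w).1) (fun w => w.2 - (F w).2) (chartPt p).2 := by
  refine interMult_congr ?_ ?_
  · filter_upwards [hF.inChart_eq] with w hw
    rw [hw]
  · filter_upwards [hF.inChart_eq] with w hw
    rw [hw]

theorem IsLocalRep.nuAt_eq {p : X n} {F : ℂ × ℂ → ℂ × ℂ}
    (hF : IsLocalRep f (chartPt p).1 (chartPt p).1 (chartPt p).2 F) :
    nuAt f p = residue (fun w => w.1 - (F w).1) (fun w => w.2 - (F w).2) (chartPt p).2 := by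
  refine residue_congr ?_ ?_
  · filter_upwards [hF.inChart_eq] with w hw
    rw [hw]
  · filter_upwards [hF.inChart_eq] with w hw
    rw [hw]

/-- The characteristic value `det (1 - f'(p))` does not depend on the chart. -/
theorem det_id_sub_eq_of_lt (hn : 1 ≤ n) {k l : Fin (n + 1)} {a b : ℂ × ℂ}
    {F G : ℂ × ℂ → ℂ × ℂ} (hkl : (k : ℕ) < l) (hab : chart k a = chart l b)
    (he : chart k a ∈ exc n) (hF : IsLocalRep f k k a F) (hFa : F a = a)
    (hG : IsLocalRep f l l b G) :
    (ContinuousLinearMap.id ℂ (ℂ × ℂ) - fderiv ℂ F a).det =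
      (ContinuousLinearMap.id ℂ (ℂ × ℂ) - fderiv ℂ G b).det := by
  obtain ⟨hl, hu, rfl⟩ := chart_eq_chart_of_lt hn hkl hab he
  change _ = (ContinuousLinearMap.id ℂ (ℂ × ℂ) - fderiv ℂ G (trans a)).det
  have hτ := analyticAt_trans hu
  have hG' : ∀ᶠ w in 𝓝 (trans a), f (chart l w) = chart l (G w) := hG.2
  -- The two representations are conjugate by the transition map, hence so are their derivatives at
  -- the fixed point.
  have hconj : ∀ᶠ w in 𝓝 a, G (trans w) = trans (F w) := by
    have hc : ContinuousAt (fun w => (F w).1) a := hF.1.continuousAt.fst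
    have hc' : ContinuousAt (fun w : ℂ × ℂ => w.1) a := continuousAt_fst
    filter_upwards [hF.2, hτ.continuousAt.eventually hG', hc.eventually_ne (by rwa [hFa]),
      hc'.eventually_ne hu] with w w1 w2 w3 w4
    apply chart_injective l
    rw [← w2]
    have e1 := chart_succ k l hl w w4
    have e2 := chart_succ k l hl _ w3
    change f (chart l (w.1 ^ 2 * w.2, w.1⁻¹)) = chart l ((F w).1 ^ 2 * (F w).2, (F w).1⁻¹)
    rw [← e1, ← e2, w1]
  have hτF : HasFDerivAt trans (fderiv ℂ trans a) (F a) := by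
    rw [hFa]; exact hτ.differentiableAt.hasFDerivAt
  have hGd : HasFDerivAt G (fderiv ℂ G (trans a)) (trans a) :=
    AnalyticAt.differentiableAt hG.1 |>.hasFDerivAt
  have d1 : HasFDerivAt (fun w => G (trans w)) _ a := hGd.comp a hτ.differentiableAt.hasFDerivAt
  have d2 : HasFDerivAt (fun w => trans (F w)) _ a :=
    hτF.comp a hF.1.differentiableAt.hasFDerivAt
  have d3 := d1.unique (d2.congr_of_eventuallyEq hconj)
  have e : (ContinuousLinearMap.id ℂ (ℂ × ℂ) - fderiv ℂ G (trans a)) ∘SL fderiv ℂ trans a =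
      fderiv ℂ trans a ∘SL (ContinuousLinearMap.id ℂ (ℂ × ℂ) - fderiv ℂ F a) := by
    rw [ContinuousLinearMap.sub_comp, ContinuousLinearMap.comp_sub, d3]
    rfl
  have e' := congrArg ContinuousLinearMap.det e
  rw [det_comp_clm, det_comp_clm, det_fderiv_trans hu, mul_one, one_mul] at e'
  exact e'.symm

theorem det_id_sub_eq (hn : 1 ≤ n) {k l : Fin (n + 1)} {a b : ℂ × ℂ}
    {F G : ℂ × ℂ → ℂ × ℂ} (hab : chart k a = chart l b)
    (he : chart k a ∈ exc n) (hF : IsLocalRep f k k a F) (hFa : F a = a)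
    (hG : IsLocalRep f l l b G) (hGb : G b = b) :
    (ContinuousLinearMap.id ℂ (ℂ × ℂ) - fderiv ℂ F a).det =
      (ContinuousLinearMap.id ℂ (ℂ × ℂ) - fderiv ℂ G b).det := by
  rcases lt_trichotomy (k : ℕ) l with h | h | h
  · exact det_id_sub_eq_of_lt hn h hab he hF hFa hG
  · obtain rfl := Fin.ext h
    obtain rfl := chart_injective k hab
    have : F =ᶠ[𝓝 a] G := hF.inChart_eq.symm.trans hG.inChart_eq
    rw [this.fderiv_eq]
  · exact (det_id_sub_eq_of_lt hn h hab.symm (hab ▸ he) hG hGb hF).symm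

/-- `HasCharValue f p D`: `p` is a fixed point on `E` and `det (1 - f'(p)) = D`. -/
def HasCharValue (f : X n → X n) (p : X n) (D : ℂ) : Prop :=
  ∃ (k : Fin (n + 1)) (a : ℂ × ℂ) (F : ℂ × ℂ → ℂ × ℂ), chart k a = p ∧ p ∈ exc n ∧
    IsLocalRep f k k a F ∧ F a = a ∧ (ContinuousLinearMap.id ℂ (ℂ × ℂ) - fderiv ℂ F a).det = D

/-- The indices are taken in the chart selected by `chartPt`, which may differ from the chart of the
hypothesis; the invariance of `det (1 - f'(p))` bridges the two. -/
theorem HasCharValue.index (hn : 1 ≤ n) (hf : IsAut f) {p : X n} {D : ℂ}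
    (h : HasCharValue f p D) :
    (D ≠ 0 → muAt f p = 1 ∧ nuAt f p = D⁻¹) ∧ (D = 0 → 2 ≤ muAt f p) := by
  obtain ⟨k, a, F, rfl, he, hF, hFa, rfl⟩ := h
  have hc := chart_chartPt he
  have hfp : f (chart k a) = chart k a := by rw [hF.2.self_of_nhds, hFa]
  have hfix : f (chart (chartPt (chart k a)).1 (chartPt (chart k a)).2) =
      chart (chartPt (chart k a)).1 (chartPt (chart k a)).2 := by
    rw [hc, hfp]
  obtain ⟨G, hG, hGb⟩ := hf.exists_localRep hn (by rwa [hc]) hfix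
  rw [det_id_sub_eq hn hc.symm he hF hFa hG hGb, hG.muAt_eq, hG.nuAt_eq]
  exact ⟨index_of_det_ne_zero hG.1 hGb, two_le_of_det_eq_zero hG.1 hGb⟩

/-- `p` is a fixed point with the index of a parabolic fixed point. -/
def IsParabolicPt (f : X n → X n) (δ : ℂ) (p : X n) : Prop :=
  muAt f p = 2 ∧ nuAt f p = (δ + 1) / (δ - 1) ^ 2

/-! ### Invariant axes -/

section
variable {Φ : ℂ × ℂ → ℂ × ℂ} {a : ℂ × ℂ}

theorem fderiv_of_invariant_fst {φ : ℂ → ℂ} {c : ℂ} (hΦ : AnalyticAt ℂ Φ a)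
    (h : ∀ᶠ t in 𝓝 a.1, Φ (t, a.2) = (φ t, a.2)) (hφ : HasDerivAt φ c a.1) :
    fderiv ℂ Φ a (1, 0) = (c, 0) := by
  have h1 : HasDerivAt (fun s : ℂ => (s, a.2)) ((1, 0) : ℂ × ℂ) a.1 :=
    (hasDerivAt_id _).prodMk (hasDerivAt_const _ _)
  have h2 := HasFDerivAt.comp_hasDerivAt (x := a.1) (l := Φ) hΦ.differentiableAt.hasFDerivAt h1
  exact h2.unique ((hφ.prodMk (hasDerivAt_const _ _)).congr_of_eventuallyEq h)

theorem fderiv_of_invariant_snd {φ : ℂ → ℂ} {c : ℂ} (hΦ : AnalyticAt ℂ Φ a)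
    (h : ∀ᶠ t in 𝓝 a.2, Φ (a.1, t) = (a.1, φ t)) (hφ : HasDerivAt φ c a.2) :
    fderiv ℂ Φ a (0, 1) = (0, c) := by
  have h1 : HasDerivAt (fun s : ℂ => (a.1, s)) ((0, 1) : ℂ × ℂ) a.2 :=
    (hasDerivAt_const _ _).prodMk (hasDerivAt_id _)
  have h2 := HasFDerivAt.comp_hasDerivAt (x := a.2) (l := Φ) hΦ.differentiableAt.hasFDerivAt h1
  exact h2.unique (((hasDerivAt_const _ _).prodMk hφ).congr_of_eventuallyEq h)

/-- The matrix is triangular, so the eigenvalue transverse to the axis is `δ / c`. The twist and the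
multiplier along an invariant curve determine the characteristic value. -/
theorem det_of_apply_fst {A : ℂ × ℂ →L[ℂ] ℂ × ℂ} {c δ : ℂ} (h : A (1, 0) = (c, 0))
    (hd : A.det = δ) (hδ : δ ≠ 0) : c ≠ 0 ∧
    (ContinuousLinearMap.id ℂ (ℂ × ℂ) - A).det = (1 - c) * (1 - δ * c⁻¹) := by
  rw [det_prod, h] at hd
  have hc : c ≠ 0 := by
    rintro rfl; apply hδ; rw [← hd]; simp
  refine ⟨hc, ?_⟩
  rw [det_prod, ← hd]
  simp [h]
  field_simp
  simp

theorem det_of_apply_snd {A : ℂ × ℂ →L[ℂ] ℂ × ℂ} {c δ : ℂ} (h : A (0, 1) = (0, c))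
    (hd : A.det = δ) (hδ : δ ≠ 0) : c ≠ 0 ∧
    (ContinuousLinearMap.id ℂ (ℂ × ℂ) - A).det = (1 - c) * (1 - δ * c⁻¹) := by
  rw [det_prod, h] at hd
  have hc : c ≠ 0 := by
    rintro rfl; apply hδ; rw [← hd]; simp
  refine ⟨hc, ?_⟩
  rw [det_prod, ← hd]
  simp [h]
  field_simp

end

/-- `f` is given by `φ` on the axis `v = 0` of the chart `k` near `s`. -/
def OnHAxis (f : X n → X n) (k : Fin (n + 1)) (φ : ℂ → ℂ) (s : ℂ) : Prop :=
  ∀ᶠ t in 𝓝 s, f (chart k (t, 0)) = chart k (φ t, 0)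

/-- `f` is given by `φ` on the axis `u = 0` of the chart `k` near `s`. -/
def OnVAxis (f : X n → X n) (k : Fin (n + 1)) (φ : ℂ → ℂ) (s : ℂ) : Prop :=
  ∀ᶠ t in 𝓝 s, f (chart k (0, t)) = chart k (0, φ t)

theorem IsLocalRep.onHAxis {k : Fin (n + 1)} {s : ℂ} {F : ℂ × ℂ → ℂ × ℂ} {φ : ℂ → ℂ}
    (hF : IsLocalRep f k k (s, 0) F) (h : OnHAxis f k φ s) :
    ∀ᶠ t in 𝓝 s, F (t, 0) = (φ t, 0) := by
  have c : Tendsto (fun t : ℂ => (t, (0 : ℂ))) (𝓝 s) (𝓝 (s, 0)) :=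
    (continuous_id.prodMk continuous_const).tendsto s
  filter_upwards [h, c.eventually hF.2] with t t1 t2
  exact chart_injective k (t2.symm.trans t1)

theorem IsLocalRep.onVAxis {k : Fin (n + 1)} {s : ℂ} {F : ℂ × ℂ → ℂ × ℂ} {φ : ℂ → ℂ}
    (hF : IsLocalRep f k k (0, s) F) (h : OnVAxis f k φ s) :
    ∀ᶠ t in 𝓝 s, F (0, t) = (0, φ t) := by
  have c : Tendsto (fun t : ℂ => ((0 : ℂ), t)) (𝓝 s) (𝓝 (0, s)) :=
    (continuous_const.prodMk continuous_id).tendsto s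
  filter_upwards [h, c.eventually hF.2] with t t1 t2
  exact chart_injective k (t2.symm.trans t1)

section
variable {δ : ℂ}

theorem OnHAxis.hasCharValue (hn : 1 ≤ n) (hf : IsAut f) (hδ : HasTwist f δ)
    {k : Fin (n + 1)} (hk : (k : ℕ) < n) {φ : ℂ → ℂ} {s c : ℂ} (h : OnHAxis f k φ s)
    (hs : φ s = s) (hφ : HasDerivAt φ c s) :
    c ≠ 0 ∧ HasCharValue f (chart k (s, 0)) ((1 - c) * (1 - δ * c⁻¹)) := by
  have he : chart k (s, 0) ∈ exc n := (chart_mem_exc hn _ _).2 (Or.inr ⟨rfl, hk⟩)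
  have h0 : f (chart k (s, 0)) = chart k (s, 0) := by
    have := h.self_of_nhds; rwa [hs] at this
  obtain ⟨F, hF, hFs⟩ := hf.exists_localRep hn he h0
  have hd := (hδ k k _ F he hF).self_of_nhds
  obtain ⟨h1, h2⟩ := det_of_apply_fst
    (fderiv_of_invariant_fst hF.1 (hF.onHAxis h) hφ) hd (twist_ne_zero hn hf hδ)
  exact ⟨h1, k, (s, 0), F, rfl, he, hF, hFs, h2⟩

theorem OnVAxis.hasCharValue (hn : 1 ≤ n) (hf : IsAut f) (hδ : HasTwist f δ)
    {k : Fin (n + 1)} (hk : 1 ≤ (k : ℕ)) {φ : ℂ → ℂ} {s c : ℂ} (h : OnVAxis f k φ s)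
    (hs : φ s = s) (hφ : HasDerivAt φ c s) :
    c ≠ 0 ∧ HasCharValue f (chart k (0, s)) ((1 - c) * (1 - δ * c⁻¹)) := by
  have he : chart k (0, s) ∈ exc n := (chart_mem_exc hn _ _).2 (Or.inl ⟨rfl, hk⟩)
  have h0 : f (chart k (0, s)) = chart k (0, s) := by
    have := h.self_of_nhds; rwa [hs] at this
  obtain ⟨F, hF, hFs⟩ := hf.exists_localRep hn he h0
  have hd := (hδ k k _ F he hF).self_of_nhds
  obtain ⟨h1, h2⟩ := det_of_apply_snd
    (fderiv_of_invariant_snd hF.1 (hF.onVAxis h) hφ) hd (twist_ne_zero hn hf hδ)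
  exact ⟨h1, k, (0, s), F, rfl, he, hF, hFs, h2⟩

/-- The index of a parabolic fixed point, if `chartPt` puts it on the axis `v = 0`. -/
theorem OnHAxis.isParabolicPt (hn : 1 ≤ n) (hf : IsAut f) (hδ : HasTwist f δ) (hδ1 : δ ≠ 1)
    {p : X n} (he : p ∈ exc n) {φ : ℂ → ℂ} {s e : ℂ} (hp : (chartPt p).2 = (s, 0))
    (h : OnHAxis f (chartPt p).1 φ s) (hne : e ≠ 0)
    (hφ : ∀ᶠ t in 𝓝 s, (1 + e * (t - s)) * (φ t - s) = t - s) : IsParabolicPt f δ p := by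
  have hc := chart_chartPt he
  rw [hp] at hc
  have hs : φ s = s := by
    have := hφ.self_of_nhds
    simp only [sub_self, mul_zero, add_zero, one_mul] at this
    exact sub_eq_zero.1 this
  have h0 : f (chart (chartPt p).1 (s, 0)) = chart (chartPt p).1 (s, 0) := by
    have := h.self_of_nhds; rwa [hs] at this
  have he' : chart (chartPt p).1 (s, 0) ∈ exc n := by rwa [hc]
  obtain ⟨F, hF, hFs⟩ := hf.exists_localRep hn he' h0
  have hF' : IsLocalRep f (chartPt p).1 (chartPt p).1 (chartPt p).2 F := by rwa [hp]
  rw [IsParabolicPt, hF'.muAt_eq, hF'.nuAt_eq, hp]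
  have hd := hδ _ _ _ F he' hF
  have hax := hF.onHAxis h
  refine index_parabolic' hF.1 hd hδ1 hne (hax.mono fun t ht => by rw [ht]) ?_
  filter_upwards [hax, hφ] with t t1 t2
  rw [t1]; exact t2

/-- The index of a parabolic fixed point, if `chartPt` puts it on the axis `u = 0`. -/
theorem OnVAxis.isParabolicPt (hn : 1 ≤ n) (hf : IsAut f) (hδ : HasTwist f δ) (hδ1 : δ ≠ 1)
    {p : X n} (he : p ∈ exc n) {φ : ℂ → ℂ} {s e : ℂ} (hp : (chartPt p).2 = (0, s))
    (h : OnVAxis f (chartPt p).1 φ s) (hne : e ≠ 0)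
    (hφ : ∀ᶠ t in 𝓝 s, (1 + e * (t - s)) * (φ t - s) = t - s) : IsParabolicPt f δ p := by
  have hc := chart_chartPt he
  rw [hp] at hc
  have hs : φ s = s := by
    have := hφ.self_of_nhds
    simp only [sub_self, mul_zero, add_zero, one_mul] at this
    exact sub_eq_zero.1 this
  have h0 : f (chart (chartPt p).1 (0, s)) = chart (chartPt p).1 (0, s) := by
    have := h.self_of_nhds; rwa [hs] at this
  have he' : chart (chartPt p).1 (0, s) ∈ exc n := by rwa [hc]
  obtain ⟨F, hF, hFs⟩ := hf.exists_localRep hn he' h0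
  have hF' : IsLocalRep f (chartPt p).1 (chartPt p).1 (chartPt p).2 F := by rwa [hp]
  rw [IsParabolicPt, hF'.muAt_eq, hF'.nuAt_eq, hp]
  have hd := hδ _ _ _ F he' hF
  have hax := hF.onVAxis h
  refine index_parabolic hF.1 hd hδ1 hne (hax.mono fun t ht => by rw [ht]) ?_
  filter_upwards [hax, hφ] with t t1 t2
  rw [t1]; exact t2

end

/-! ### Isolated fixed points -/

/-- The fixed points on the `i`-th curve. -/
def curveFix (f : X n → X n) (i : Fin n) : Set (X n) := {p | p ∈ curve i ∧ f p = p}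

theorem exists_mem_curve (hn : 1 ≤ n) {p : X n} (hp : p ∈ exc n) : ∃ i, p ∈ curve i := by
  obtain ⟨k, a, rfl⟩ := exists_chart_eq hp
  have hk := k.is_lt
  rcases (chart_mem_exc hn k a).1 hp with h | h
  · exact ⟨⟨k - 1, by omega⟩, (chart_mem_curve _ _ _).2
      (Or.inr ⟨by change (k : ℕ) = k - 1 + 1; omega, h.1⟩)⟩
  · exact ⟨⟨k, h.2⟩, (chart_mem_curve _ _ _).2 (Or.inl ⟨rfl, h.1⟩)⟩

theorem curve_subset_exc (i : Fin n) : curve i ⊆ exc n := fun _ h => h.1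

/-- Points of a pointwise fixed curve are limits of fixed points on it. Away from these curves only
finitely many fixed points of `E` remain, and in a chart these are isolated. -/
theorem isolatedFix_eq (hn : 1 ≤ n)
    (hfin : ∀ i : Fin n, (∀ p ∈ curve i, f p = p) ∨ (curveFix f i).Finite) :
    isolatedFix f = {p | p ∈ exc n ∧ f p = p ∧
      ∀ i : Fin n, (∀ q ∈ curve i, f q = q) → p ∉ curve i} := by
  ext p
  constructor
  · rintro ⟨he, hp, k, a, hka, hev⟩
    refine ⟨he, hp, fun i hi hpi => ?_⟩
    rw [← hka, chart_mem_curve] at hpi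
    -- The axis representing the curve is a path along which fixed points accumulate at `a`.
    have hline : ∃ ℓ : ℂ → ℂ × ℂ, ∃ s, ℓ s = a ∧ ContinuousAt ℓ s ∧ (∀ t, t ≠ s → ℓ t ≠ a) ∧
        ∀ t, chart k (ℓ t) ∈ curve i := by
      obtain ⟨u, v⟩ := a
      rcases hpi with ⟨h1, h2⟩ | ⟨h1, h2⟩
      · refine ⟨fun t => (t, v), u, rfl, by fun_prop, fun t ht h => ht (congrArg Prod.fst h),
          fun t => (chart_mem_curve _ _ _).2 (Or.inl ⟨h1, h2⟩)⟩
      · refine ⟨fun t => (u, t), v, rfl, by fun_prop, fun t ht h => ht (congrArg Prod.snd h),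
          fun t => (chart_mem_curve _ _ _).2 (Or.inr ⟨h1, h2⟩)⟩
    obtain ⟨ℓ, s, rfl, hc, hne, hmem⟩ := hline
    have ht : Tendsto ℓ (𝓝[≠] s) (𝓝[≠] (ℓ s)) :=
      tendsto_nhdsWithin_iff.2 ⟨hc.tendsto.mono_left nhdsWithin_le_nhds,
        eventually_nhdsWithin_of_forall fun t ht => hne t ht⟩
    obtain ⟨t, ht⟩ := (ht.eventually hev).exists
    exact ht (curve_subset_exc i (hmem t)) (hi _ (hmem t))
  · rintro ⟨he, hp, hnot⟩
    obtain ⟨k, a, hka⟩ := exists_chart_eq he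
    refine ⟨he, hp, k, a, hka, ?_⟩
    set B : Set (X n) := ⋃ i ∈ {i : Fin n | ¬ ∀ q ∈ curve i, f q = q}, curveFix f i with hB
    have hBfin : B.Finite := by
      refine Set.Finite.biUnion (Set.toFinite _) fun i hi => ?_
      exact (hfin i).resolve_left hi
    have hpre : (chart k ⁻¹' B).Finite := hBfin.preimage (chart_injective k).injOn
    have h1 : ∀ᶠ w in 𝓝[≠] a, w ∉ chart k ⁻¹' B := by
      have : (chart k ⁻¹' B \ {a})ᶜ ∈ 𝓝 a :=
        (hpre.sdiff).isClosed.isOpen_compl.mem_nhds (by simp)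
      filter_upwards [nhdsWithin_le_nhds this, self_mem_nhdsWithin] with w w1 w2 w3
      exact w1 ⟨w3, w2⟩
    have h2 : ∀ᶠ w in 𝓝[≠] a, ∀ i : Fin n, (∀ q ∈ curve i, f q = q) → chart k w ∉ curve i := by
      rw [eventually_all]
      intro i
      by_cases hi : ∀ q ∈ curve i, f q = q
      · have hpi := hnot i hi
        rw [← hka, chart_mem_curve] at hpi
        push Not at hpi
        have c1 : ContinuousAt (fun w : ℂ × ℂ => w.1) a := continuousAt_fst
        have c2 : ContinuousAt (fun w : ℂ × ℂ => w.2) a := continuousAt_snd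
        refine nhdsWithin_le_nhds ?_
        by_cases k1 : (k : ℕ) = i
        · filter_upwards [c2.eventually_ne (hpi.1 k1)] with w hw _
          rw [chart_mem_curve]
          rintro (h | h)
          · exact hw h.2
          · omega
        · by_cases k2 : (k : ℕ) = i + 1
          · filter_upwards [c1.eventually_ne (hpi.2 k2)] with w hw _
            rw [chart_mem_curve]
            rintro (h | h)
            · omega
            · exact hw h.2
          · refine Eventually.of_forall fun w _ => ?_
            rw [chart_mem_curve]
            omega
      · exact Eventually.of_forall fun w h => absurd h hi
    filter_upwards [h1, h2] with w w1 w2 w3 w4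
    obtain ⟨i, hi⟩ := exists_mem_curve hn w3
    by_cases hfi : ∀ q ∈ curve i, f q = q
    · exact w2 i hfi hi
    · exact w1 (Set.mem_biUnion (x := i) hfi ⟨hi, w4⟩)

/-! ### The action on the chain of curves -/

/-- An entire function with a simple pole at infinity is affine. -/
theorem eq_affine_of_inv {φ ψ : ℂ → ℂ} {c : ℂ} (hφ : Differentiable ℂ φ) (hψ : HasDerivAt ψ c 0)
    (hψ0 : ψ 0 = 0) (hc : c ≠ 0) (h : ∀ᶠ t in 𝓝[≠] (0 : ℂ), ψ t * φ t⁻¹ = 1) (s : ℂ) :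
    φ s = c⁻¹ * s + φ 0 := by
  have hd : Differentiable ℂ (dslope φ 0) := by
    rw [← differentiableOn_univ, Complex.differentiableOn_dslope Filter.univ_mem]
    exact hφ.differentiableOn
  have hinv : Tendsto (fun s : ℂ => s⁻¹) (cocompact ℂ) (𝓝[≠] 0) := by
    rw [← Metric.cobounded_eq_cocompact]
    exact tendsto_inv₀_cobounded'
  have h1 : Tendsto (fun t => (slope ψ 0 t)⁻¹) (𝓝[≠] 0) (𝓝 c⁻¹) :=
    (hasDerivAt_iff_tendsto_slope.1 hψ).inv₀ hc
  have h2 : Tendsto (fun t => (slope ψ 0 t)⁻¹ - φ 0 * t) (𝓝[≠] 0) (𝓝 (c⁻¹ - φ 0 * 0)) :=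
    h1.sub ((tendsto_id.mono_left nhdsWithin_le_nhds).const_mul _)
  rw [mul_zero, sub_zero] at h2
  -- For `t = s⁻¹` the slope `(φ s - φ 0) / s` equals `t / ψ t - φ 0 · t`, which tends to `c⁻¹`;
  -- being entire, the slope is constant by Liouville's theorem.
  have h3 : Tendsto (dslope φ 0) (cocompact ℂ) (𝓝 c⁻¹) := by
    refine (h2.comp hinv).congr' ?_
    filter_upwards [hinv.eventually h, hinv.eventually self_mem_nhdsWithin] with s s1 s2
    have hs : s ≠ 0 := by
      rintro rfl; simp at s2
    rw [inv_inv] at s1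
    have hψs : ψ s⁻¹ ≠ 0 := left_ne_zero_of_mul_eq_one s1
    rw [dslope_of_ne _ hs, Function.comp_apply, slope_def_field, slope_def_field, hψ0]
    have : φ s = (ψ s⁻¹)⁻¹ := eq_inv_of_mul_eq_one_right s1
    rw [this]
    simp only [sub_zero]
    field_simp
  have h4 := hd.apply_eq_of_tendsto_cocompact s h3
  have h5 := sub_smul_dslope φ 0 s
  rw [h4, smul_eq_mul, sub_zero] at h5
  linear_combination -h5

theorem apply_mem_curve (hsym : HasTrivialSymmetry f) {i : Fin n} {p : X n}
    (hp : p ∈ curve i) : f p ∈ curve i := by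
  rw [← hsym i]; exact Set.mem_image_of_mem f hp

/-- The intersection point of the curves `k - 1` and `k`. -/
abbrev corner (k : Fin (n + 1)) : X n := chart k (0, 0)

/-- A transition map is defined off an axis and has a nowhere vanishing component, so the origin of
a chart lies in no other chart. In particular `chartPt` has no choice at a corner. -/
theorem chart_eq_corner (hn : 1 ≤ n) {k l : Fin (n + 1)} {w : ℂ × ℂ} (h : chart l w = corner k) :
    l = k ∧ w = 0 := by
  have he : chart k (0, 0) ∈ exc n := by
    have := k.is_lt
    rw [chart_mem_exc hn]
    simp only [true_and]
    omega
  rcases lt_trichotomy (l : ℕ) k with h1 | h1 | h1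
  · obtain ⟨-, h2, h3⟩ := chart_eq_chart_of_lt hn h1 h (h ▸ he)
    exact absurd (congrArg Prod.snd h3).symm (inv_ne_zero h2)
  · obtain rfl := Fin.ext h1
    exact ⟨rfl, chart_injective l h⟩
  · exact absurd rfl (chart_eq_chart_of_lt hn h1 h.symm he).2.1

theorem chartPt_corner (hn : 1 ≤ n) {k : Fin (n + 1)} (hk : corner k ∈ exc n) :
    (chartPt (corner k)).1 = k ∧ (chartPt (corner k)).2 = 0 :=
  chart_eq_corner hn (chart_chartPt hk)

/-- A corner is the only common point of two consecutive curves, both of which are invariant. -/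
theorem apply_corner (hsym : HasTrivialSymmetry f) {k : Fin (n + 1)}
    (h1 : 1 ≤ (k : ℕ)) (h2 : (k : ℕ) < n) : f (corner k) = corner k := by
  have m1 : corner k ∈ curve (⟨k - 1, by omega⟩ : Fin n) :=
    (chart_mem_curve _ _ _).2 (Or.inr ⟨by change (k : ℕ) = k - 1 + 1; omega, rfl⟩)
  have m2 : corner k ∈ curve (⟨k, h2⟩ : Fin n) := (chart_mem_curve _ _ _).2 (Or.inl ⟨rfl, rfl⟩)
  have f1 := apply_mem_curve hsym m1
  have f2 := apply_mem_curve hsym m2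
  obtain ⟨l, w, hl⟩ := exists_chart_eq f1.1
  rw [← hl, chart_mem_curve] at f1 f2
  rw [← hl]
  simp only at f1 f2
  have hlk : l = k := Fin.ext (by omega)
  subst hlk
  have e : w = (0, 0) := by
    refine Prod.ext ?_ ?_
    · rcases f1 with h | h
      · omega
      · exact h.2
    · rcases f2 with h | h
      · exact h.2
      · omega
  rw [e]

/-- The only point of the curve off this axis is the next corner. It is fixed because `k + 1 < n`,
so by injectivity no other point is mapped to it. -/
theorem exists_apply_hAxis (hn : 1 ≤ n) (hf : IsAut f) (hsym : HasTrivialSymmetry f)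
    {k : Fin (n + 1)} (hk : (k : ℕ) + 1 < n) (s : ℂ) :
    ∃ t, f (chart k (s, 0)) = chart k (t, 0) := by
  have m : chart k (s, 0) ∈ curve (⟨k, by omega⟩ : Fin n) :=
    (chart_mem_curve _ _ _).2 (Or.inl ⟨rfl, rfl⟩)
  have m' := apply_mem_curve hsym m
  obtain ⟨l, w, hl⟩ := exists_chart_eq m'.1
  rw [← hl, chart_mem_curve] at m'
  rcases m' with ⟨h1, h2⟩ | ⟨h1, h2⟩
  · obtain rfl := Fin.ext h1
    exact ⟨w.1, by rw [← hl, ← h2]⟩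
  · have h1 : (l : ℕ) = k + 1 := h1
    by_cases hv : w.2 = 0
    · exfalso
      have e : w = (0, 0) := Prod.ext h2 hv
      rw [e] at hl
      have := hf.injOn ((chart_mem_exc hn _ _).2 (Or.inl ⟨rfl, by omega⟩)) m.1
        ((apply_corner hsym (k := l) (by omega) (by omega)).trans hl)
      have := (chart_eq_corner hn this.symm).1
      rw [this] at h1
      omega
    · rw [← hl, chart_pred k l h1 w hv, h2, mul_zero]
      exact ⟨_, rfl⟩

theorem exists_apply_vAxis (hn : 1 ≤ n) (hf : IsAut f) (hsym : HasTrivialSymmetry f)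
    {k : Fin (n + 1)} (hk : 2 ≤ (k : ℕ)) (s : ℂ) :
    ∃ t, f (chart k (0, s)) = chart k (0, t) := by
  have hkn := k.is_lt
  have m : chart k (0, s) ∈ curve (⟨k - 1, by omega⟩ : Fin n) :=
    (chart_mem_curve _ _ _).2 (Or.inr ⟨by change (k : ℕ) = k - 1 + 1; omega, rfl⟩)
  have m' := apply_mem_curve hsym m
  obtain ⟨l, w, hl⟩ := exists_chart_eq m'.1
  rw [← hl, chart_mem_curve] at m'
  rcases m' with ⟨h1, h2⟩ | ⟨h1, h2⟩
  · have h1 : (l : ℕ) = k - 1 := h1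
    by_cases hv : w.1 = 0
    · exfalso
      have e : w = (0, 0) := Prod.ext hv h2
      rw [e] at hl
      have := hf.injOn ((chart_mem_exc hn _ _).2 (Or.inl ⟨rfl, by omega⟩)) m.1
        ((apply_corner hsym (k := l) (by omega) (by omega)).trans hl)
      have := (chart_eq_corner hn this.symm).1
      rw [this] at h1
      omega
    · rw [← hl, chart_succ l k (by omega) w hv, h2, mul_zero]
      exact ⟨_, rfl⟩
  · have h1 : (l : ℕ) = k - 1 + 1 := h1
    obtain rfl : l = k := Fin.ext (by omega)
    exact ⟨w.2, by rw [← hl, ← h2]⟩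

section
variable {δ : ℂ}

/-- `f` is affine on the axis `v = 0` of the chart `k` if the point at infinity of the axis is a
corner. -/
theorem exists_affine_hAxis (hn : 1 ≤ n) (hf : IsAut f) (hsym : HasTrivialSymmetry f)
    (hδ : HasTwist f δ) {k : Fin (n + 1)} (hk : (k : ℕ) + 1 < n) :
    ∃ c d, c ≠ 0 ∧ ∀ s, f (chart k (s, 0)) = chart k (c * s + d, 0) := by
  choose φ hφ using exists_apply_hAxis hn hf hsym hk
  have hmem : ∀ s, chart k (s, 0) ∈ exc n := fun s =>
    (chart_mem_exc hn _ _).2 (Or.inr ⟨rfl, by omega⟩)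
  have hdiff : Differentiable ℂ φ := by
    intro s
    obtain ⟨F, hF, hFs⟩ := hf.exists_localRep hn (hmem s) (hφ s)
    have h1 := hF.onHAxis (φ := φ) (Eventually.of_forall hφ)
    have h2 : AnalyticAt ℂ (fun t => (F (t, 0)).1) s :=
      analyticAt_slice_fst (h := fun w => (F w).1) (a := (s, 0))
        (AnalyticAt.fun_comp (g := Prod.fst) analyticAt_fst hF.1)
    exact h2.differentiableAt.congr_of_eventuallyEq (h1.mono fun t ht => by simp only [ht])
  obtain ⟨l, hl⟩ : ∃ l : Fin (n + 1), (l : ℕ) = k + 1 := ⟨⟨k + 1, by omega⟩, rfl⟩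
  have hcor := apply_corner hsym (k := l) (by omega) (by omega)
  have hce : corner l ∈ exc n := (chart_mem_exc hn _ _).2 (Or.inl ⟨rfl, by omega⟩)
  obtain ⟨F, hF, hF0⟩ := hf.exists_localRep hn hce hcor
  have c0 : Tendsto (fun t : ℂ => ((0 : ℂ), t)) (𝓝 0) (𝓝 (0, 0)) :=
    (continuous_const.prodMk continuous_id).tendsto 0
  -- The next chart has the coordinate `t = s⁻¹` on the curve, so the action near its corner
  -- describes `φ` at infinity.
  have h1 : ∀ᶠ t in 𝓝[≠] (0 : ℂ), (F (0, t)).1 = 0 ∧ (F (0, t)).2 * φ t⁻¹ = 1 := by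
    filter_upwards [nhdsWithin_le_nhds (c0.eventually hF.2), self_mem_nhdsWithin] with t t1 t2
    have t2 : t ≠ 0 := t2
    rw [chart_pred k l hl (0, t) t2] at t1
    simp only [mul_zero] at t1
    rw [hφ] at t1
    obtain ⟨-, h2, h3⟩ := chart_eq_chart_of_lt hn (by omega) t1 (hmem _)
    rw [h3]
    simp only [mul_zero, true_and] at h2 ⊢
    exact inv_mul_cancel₀ h2
  set ψ : ℂ → ℂ := fun t => (F (0, t)).2 with hψdef
  have hψa : AnalyticAt ℂ ψ 0 := analyticAt_slice_snd (h := fun w => (F w).2) (a := (0, 0))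
    (AnalyticAt.fun_comp (g := Prod.snd) analyticAt_snd hF.1)
  have hψ := hψa.differentiableAt.hasDerivAt
  have hax : ∀ᶠ t in 𝓝 (0 : ℂ), F (0, t) = (0, ψ t) := by
    rw [eventually_nhdsWithin_iff] at h1
    filter_upwards [h1] with t ht
    by_cases h0 : t = 0
    · subst h0; rw [hF0, hψdef]; simp only [hF0]
    · exact Prod.ext (ht h0).1 rfl
  have hd := (hδ l l _ F hce hF).self_of_nhds
  obtain ⟨hc, -⟩ := det_of_apply_snd (fderiv_of_invariant_snd (a := (0, 0)) hF.1 hax hψ) hd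
    (twist_ne_zero hn hf hδ)
  have hψ0 : ψ 0 = 0 := by simp only [hψdef, hF0]
  refine ⟨(deriv ψ 0)⁻¹, φ 0, inv_ne_zero hc, fun s => ?_⟩
  rw [hφ, eq_affine_of_inv hdiff hψ hψ0 hc (h1.mono fun t ht => ht.2) s]

theorem exists_affine_vAxis (hn : 1 ≤ n) (hf : IsAut f) (hsym : HasTrivialSymmetry f)
    (hδ : HasTwist f δ) {k : Fin (n + 1)} (hk : 2 ≤ (k : ℕ)) :
    ∃ c d, c ≠ 0 ∧ ∀ s, f (chart k (0, s)) = chart k (0, c * s + d) := by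
  have hkn := k.is_lt
  choose φ hφ using exists_apply_vAxis hn hf hsym hk
  have hmem : ∀ s, chart k (0, s) ∈ exc n := fun s =>
    (chart_mem_exc hn _ _).2 (Or.inl ⟨rfl, by omega⟩)
  have hdiff : Differentiable ℂ φ := by
    intro s
    obtain ⟨F, hF, hFs⟩ := hf.exists_localRep hn (hmem s) (hφ s)
    have h1 := hF.onVAxis (φ := φ) (Eventually.of_forall hφ)
    have h2 : AnalyticAt ℂ (fun t => (F (0, t)).2) s :=
      analyticAt_slice_snd (h := fun w => (F w).2) (a := (0, s))
        (AnalyticAt.fun_comp (g := Prod.snd) analyticAt_snd hF.1)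
    exact h2.differentiableAt.congr_of_eventuallyEq (h1.mono fun t ht => by simp only [ht])
  obtain ⟨l, hl⟩ : ∃ l : Fin (n + 1), (k : ℕ) = l + 1 :=
    ⟨⟨k - 1, by omega⟩, by change (k : ℕ) = k - 1 + 1; omega⟩
  have hcor := apply_corner hsym (k := l) (by omega) (by omega)
  have hce : corner l ∈ exc n := (chart_mem_exc hn _ _).2 (Or.inl ⟨rfl, by omega⟩)
  obtain ⟨F, hF, hF0⟩ := hf.exists_localRep hn hce hcor
  have c0 : Tendsto (fun t : ℂ => (t, (0 : ℂ))) (𝓝 0) (𝓝 (0, 0)) :=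
    (continuous_id.prodMk continuous_const).tendsto 0
  have h1 : ∀ᶠ t in 𝓝[≠] (0 : ℂ), (F (t, 0)).2 = 0 ∧ (F (t, 0)).1 * φ t⁻¹ = 1 := by
    filter_upwards [nhdsWithin_le_nhds (c0.eventually hF.2), self_mem_nhdsWithin] with t t1 t2
    have t2 : t ≠ 0 := t2
    rw [chart_succ l k hl (t, 0) t2] at t1
    simp only [mul_zero] at t1
    rw [hφ] at t1
    obtain ⟨-, h2, h3⟩ := chart_eq_chart_of_lt hn (by omega) t1.symm (t1 ▸ hmem _)
    have e1 : (F (t, 0)).1 ^ 2 * (F (t, 0)).2 = 0 := (congrArg Prod.fst h3).symm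
    have e2 : φ t⁻¹ = (F (t, 0)).1⁻¹ := congrArg Prod.snd h3
    rw [e2]
    exact ⟨(mul_eq_zero.1 e1).resolve_left (pow_ne_zero _ h2), mul_inv_cancel₀ h2⟩
  set ψ : ℂ → ℂ := fun t => (F (t, 0)).1 with hψdef
  have hψa : AnalyticAt ℂ ψ 0 := analyticAt_slice_fst (h := fun w => (F w).1) (a := (0, 0))
    (AnalyticAt.fun_comp (g := Prod.fst) analyticAt_fst hF.1)
  have hψ := hψa.differentiableAt.hasDerivAt
  have hax : ∀ᶠ t in 𝓝 (0 : ℂ), F (t, 0) = (ψ t, 0) := by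
    rw [eventually_nhdsWithin_iff] at h1
    filter_upwards [h1] with t ht
    by_cases h0 : t = 0
    · subst h0; rw [hF0, hψdef]; simp only [hF0]
    · exact Prod.ext rfl (ht h0).1
  have hd := (hδ l l _ F hce hF).self_of_nhds
  obtain ⟨hc, -⟩ := det_of_apply_fst (fderiv_of_invariant_fst (a := (0, 0)) hF.1 hax hψ) hd
    (twist_ne_zero hn hf hδ)
  have hψ0 : ψ 0 = 0 := by simp only [hψdef, hF0]
  refine ⟨(deriv ψ 0)⁻¹, φ 0, inv_ne_zero hc, fun s => ?_⟩
  rw [hφ, eq_affine_of_inv hdiff hψ hψ0 hc (h1.mono fun t ht => ht.2) s]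

/-- In the coordinate `t = s⁻¹` the affine map `s ↦ c s + d` becomes `t ↦ t / (c + d t)`, with
multiplier `c⁻¹` at the corner. -/
theorem onVAxis_corner {k l : Fin (n + 1)} (hl : (l : ℕ) = k + 1) {c d : ℂ} (hc : c ≠ 0)
    (h : ∀ s, f (chart k (s, 0)) = chart k (c * s + d, 0)) (hcor : f (corner l) = corner l) :
    OnVAxis f l (fun t => t / (c + d * t)) 0 := by
  have hcont : ContinuousAt (fun t : ℂ => c + d * t) 0 := by fun_prop
  filter_upwards [hcont.eventually_ne (by simpa using hc)] with t ht
  by_cases h0 : t = 0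
  · subst h0; simpa using hcor
  · have e : c * t⁻¹ + d ≠ 0 := by
      have : c * t⁻¹ + d = (c + d * t) * t⁻¹ := by field_simp
      rw [this]; exact mul_ne_zero ht (inv_ne_zero h0)
    rw [chart_pred k l hl (0, t) h0]
    simp only [mul_zero]
    rw [h, chart_succ k l hl _ e]
    simp only [mul_zero]
    congr 2
    field_simp

theorem onHAxis_corner {k l : Fin (n + 1)} (hl : (l : ℕ) = k + 1) {c d : ℂ} (hc : c ≠ 0)
    (h : ∀ s, f (chart l (0, s)) = chart l (0, c * s + d)) (hcor : f (corner k) = corner k) :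
    OnHAxis f k (fun t => t / (c + d * t)) 0 := by
  have hcont : ContinuousAt (fun t : ℂ => c + d * t) 0 := by fun_prop
  filter_upwards [hcont.eventually_ne (by simpa using hc)] with t ht
  by_cases h0 : t = 0
  · subst h0; simpa using hcor
  · have e : c * t⁻¹ + d ≠ 0 := by
      have : c * t⁻¹ + d = (c + d * t) * t⁻¹ := by field_simp
      rw [this]; exact mul_ne_zero ht (inv_ne_zero h0)
    rw [chart_succ k l hl (t, 0) h0]
    simp only [mul_zero]
    rw [h, chart_pred k l hl _ e]
    simp only [mul_zero]
    congr 2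
    field_simp

theorem hasDerivAt_moebius_zero {c : ℂ} (d : ℂ) (hc : c ≠ 0) :
    HasDerivAt (fun t : ℂ => t / (c + d * t)) c⁻¹ 0 := by
  have h1 : HasDerivAt (fun t : ℂ => c + d * t) d 0 := by
    simpa using ((hasDerivAt_id (0 : ℂ)).const_mul d).const_add c
  have h2 := (hasDerivAt_id (0 : ℂ)).div h1 (by simpa using hc)
  refine h2.congr_deriv ?_
  simp
  field_simp

/-- The multipliers along the two axes at a fixed corner. -/
theorem mul_deriv_corner (hn : 1 ≤ n) (hf : IsAut f) (hδ : HasTwist f δ) {k : Fin (n + 1)}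
    (hk : corner k ∈ exc n) (hcor : f (corner k) = corner k) {φ ψ : ℂ → ℂ} {c c' : ℂ}
    (h1 : OnHAxis f k φ 0) (h2 : OnVAxis f k ψ 0) (hφ : HasDerivAt φ c 0)
    (hψ : HasDerivAt ψ c' 0) : c * c' = δ := by
  obtain ⟨F, hF, hF0⟩ := hf.exists_localRep hn hk hcor
  have hd := (hδ k k _ F hk hF).self_of_nhds
  have d1 := fderiv_of_invariant_fst (a := (0, 0)) hF.1 (hF.onHAxis h1) hφ
  have d2 := fderiv_of_invariant_snd (a := (0, 0)) hF.1 (hF.onVAxis h2) hψ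
  rw [det_prod, d1, d2] at hd
  simpa using hd

/-- The action of `f` on a chain of at least two curves, in the coordinates of the charts, with
multipliers `γ`. -/
structure ChainAction (f : X n → X n) (γ : ℕ → ℂ) (d d' : ℂ) : Prop where
  fixed : ∀ k : Fin (n + 1), 1 ≤ (k : ℕ) → (k : ℕ) < n → f (corner k) = corner k
  first : ∀ s, f (chart 0 (s, 0)) = chart 0 (γ 1 * s + d, 0)
  middle : ∀ k : Fin (n + 1), 1 ≤ (k : ℕ) → (k : ℕ) + 1 < n →
    ∀ s, f (chart k (s, 0)) = chart k (γ (k + 1) * s, 0)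
  last : ∀ s, f (chart (Fin.last n) (0, s)) = chart (Fin.last n) (0, (γ n)⁻¹ * s + d')

/-- At the corner `k` the preceding curve contributes the multiplier `γ_k⁻¹`, so the next curve has
the multiplier `δ γ_k = γ_(k+1)`. On the middle curves `0` is a fixed corner as well, so the
translation part vanishes; it can survive only on the two end curves. -/
theorem exists_chainAction (hn : 2 ≤ n) (hf : IsAut f) (hsym : HasTrivialSymmetry f)
    (hδ : HasTwist f δ) {γ : ℕ → ℂ} (hγ : ∀ j, γ (j + 1) = δ * γ j) (hγ1 : γ 1 ≠ 0)
    (h1 : ∀ c d, (∀ s, f (chart 0 (s, 0)) = chart 0 (c * s + d, 0)) → c = γ 1) :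
    ∃ d d', ChainAction f γ d d' := by
  have hn1 : 1 ≤ n := by omega
  have hδ0 := twist_ne_zero hn1 hf hδ
  have hγ0 : ∀ j, γ (j + 1) ≠ 0 := by
    intro j
    induction j with
    | zero => exact hγ1
    | succ j ih => rw [hγ]; exact mul_ne_zero hδ0 ih
  have hcor : ∀ k : Fin (n + 1), 1 ≤ (k : ℕ) → (k : ℕ) < n → f (corner k) = corner k :=
    fun k => apply_corner hsym
  have hce : ∀ k : Fin (n + 1), corner k ∈ exc n := by
    intro k
    have := k.is_lt
    rw [chart_mem_exc hn1]
    simp only [true_and]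
    omega
  have hall : ∀ m (k : Fin (n + 1)), (k : ℕ) = m → m + 1 < n →
      ∃ d, (1 ≤ m → d = 0) ∧ ∀ s, f (chart k (s, 0)) = chart k (γ (m + 1) * s + d, 0) := by
    intro m
    induction m with
    | zero =>
      intro k hk hkn
      obtain rfl : k = 0 := Fin.ext hk
      obtain ⟨c, d, hc, h⟩ := exists_affine_hAxis hn1 hf hsym hδ (k := 0) hkn
      refine ⟨d, by omega, ?_⟩
      rw [← h1 c d h]; exact h
    | succ m ih =>
      intro k hk hkn
      obtain ⟨l, hl⟩ : ∃ l : Fin (n + 1), (l : ℕ) = m := ⟨⟨m, by omega⟩, rfl⟩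
      obtain ⟨d', -, h'⟩ := ih l hl (by omega)
      obtain ⟨c, d, hc, h⟩ := exists_affine_hAxis hn1 hf hsym hδ (k := k) (by omega)
      have hkc := hcor k (by omega) (by omega)
      have hd : d = 0 := by
        have := (h 0).symm.trans hkc
        simpa using chart_injective k this
      have e := mul_deriv_corner hn1 hf hδ (hce k) hkc (φ := fun s => c * s + d) (c := c)
        (Eventually.of_forall h) (onVAxis_corner (by omega) (hγ0 m) h' hkc)
        (by simpa using ((hasDerivAt_id (0 : ℂ)).const_mul c).add_const d)
        (hasDerivAt_moebius_zero d' (hγ0 m))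
      refine ⟨d, fun _ => hd, ?_⟩
      have hc : c = γ (m + 1 + 1) := by
        rw [hγ (m + 1), ← e]
        field_simp [hγ0 m]
      rw [← hc]; exact h
  obtain ⟨d, -, hd⟩ := hall 0 0 rfl (by omega)
  -- The last curve has a fixed corner on one side only. In the coordinate of the last chart this
  -- corner is at infinity, which makes the action affine and turns the multiplier into `γ_n⁻¹`.
  obtain ⟨l, hl⟩ : ∃ l : Fin (n + 1), (l : ℕ) = n - 2 := ⟨⟨n - 2, by omega⟩, rfl⟩
  obtain ⟨m, hm⟩ : ∃ m : Fin (n + 1), (m : ℕ) = n - 1 := ⟨⟨n - 1, by omega⟩, rfl⟩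
  obtain ⟨d₁, -, hd₁⟩ := hall (n - 2) l hl (by omega)
  obtain ⟨c', d', hc', h'⟩ := exists_affine_vAxis hn1 hf hsym hδ (k := Fin.last n) hn
  have hmc := hcor m (by omega) (by omega)
  have e := mul_deriv_corner hn1 hf hδ (hce m) hmc
    (onHAxis_corner (by simp; omega) hc' h' hmc) (onVAxis_corner (by omega) (hγ0 _) hd₁ hmc)
    (hasDerivAt_moebius_zero d' hc') (hasDerivAt_moebius_zero d₁ (hγ0 _))
  have hc : c' = (γ n)⁻¹ := by
    have e2 := hγ (n - 2 + 1)
    rw [show n - 2 + 1 + 1 = n by omega] at e2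
    rw [e2, ← e]
    have := hγ0 (n - 2)
    field_simp
  refine ⟨d, d', hcor, hd, fun k hk1 hk2 s => ?_, ?_⟩
  · obtain ⟨d₂, h0, h2⟩ := hall k k rfl hk2
    rw [h2, h0 hk1, add_zero]
  · rw [← hc]; exact h'

end

/-! ### The fixed points on the exceptional set -/

/-- The fixed point data of an automorphism with multipliers `γ`: for `γ_1, …, γ_n ≠ 1` there are
`n + 1` isolated fixed points; if `γ_i = 1`, two of them are replaced by a fixed curve or by one
parabolic fixed point. -/
def HasFixData (f : X n → X n) (δ : ℂ) (γ : ℕ → ℂ) : Prop :=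
  ∃ P : ℕ → X n,
    ((∀ j, 1 ≤ j → j ≤ n → γ j ≠ 1) → numFixedCurves f = 0 ∧
      isolatedFix f = P '' {k | k ≤ n} ∧ Set.InjOn P {k | k ≤ n} ∧
      ∀ k ≤ n, HasCharValue f (P k) ((1 - γ (k + 1)) * (1 - (γ k)⁻¹))) ∧
    ∀ i, 1 ≤ i → i ≤ n → γ i = 1 → (∀ j, 1 ≤ j → j ≤ n → j ≠ i → γ j ≠ 1) →
      Set.InjOn P {k | k ≤ n ∧ k + 1 ≠ i ∧ k ≠ i} ∧
      (∀ k ≤ n, k + 1 ≠ i → k ≠ i →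
        HasCharValue f (P k) ((1 - γ (k + 1)) * (1 - (γ k)⁻¹))) ∧
      ((numFixedCurves f = 1 ∧ isolatedFix f = P '' {k | k ≤ n ∧ k + 1 ≠ i ∧ k ≠ i}) ∨
        (numFixedCurves f = 0 ∧ ∃ Q, Q ∉ P '' {k | k ≤ n ∧ k + 1 ≠ i ∧ k ≠ i} ∧
          isolatedFix f = insert Q (P '' {k | k ≤ n ∧ k + 1 ≠ i ∧ k ≠ i}) ∧
          IsParabolicPt f δ Q))

section
variable {γ : ℕ → ℂ} {δ d d' : ℂ}

/-- The fixed points in the chain. -/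
def chainPt (n : ℕ) (γ : ℕ → ℂ) (d d' : ℂ) (k : ℕ) : X n :=
  if k = 0 then chart 0 (d / (1 - γ 1), 0)
  else if k < n then chart (Fin.ofNat (n + 1) k) (0, 0)
  else chart (Fin.last n) (0, d' / (1 - (γ n)⁻¹))

theorem chainPt_zero : chainPt n γ d d' 0 = chart 0 (d / (1 - γ 1), 0) := rfl

theorem chainPt_mid {k : Fin (n + 1)} (h1 : 1 ≤ (k : ℕ)) (h2 : (k : ℕ) < n) :
    chainPt n γ d d' k = corner k := by
  rw [chainPt, if_neg (by omega), if_pos h2, Fin.ofNat_val_eq_self]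

theorem chainPt_last (hn : 1 ≤ n) :
    chainPt n γ d d' n = chart (Fin.last n) (0, d' / (1 - (γ n)⁻¹)) := by
  rw [chainPt, if_neg (by omega), if_neg (by omega)]

theorem chainPt_mem_curve (hn : 2 ≤ n) {k : ℕ} (hk : k ≤ n) (i : Fin n) :
    chainPt n γ d d' k ∈ curve i ↔ k = i ∨ k = i + 1 := by
  have hi := i.is_lt
  rcases Nat.eq_zero_or_pos k with h0 | h0
  · subst h0
    rw [chainPt_zero, chart_mem_curve]
    simp only [Fin.val_zero, and_true]
    exact ⟨Or.imp_right And.left, Or.imp_right fun e => absurd e (by omega)⟩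
  · rcases Nat.lt_or_ge k n with h1 | h1
    · obtain ⟨l, rfl⟩ : ∃ l : Fin (n + 1), (l : ℕ) = k := ⟨⟨k, by omega⟩, rfl⟩
      rw [chainPt_mid h0 h1, chart_mem_curve]
      simp
    · obtain rfl : k = n := by omega
      rw [chainPt_last (by omega), chart_mem_curve]
      simp only [Fin.val_last, and_true]
      omega

/-- Incidence with the curves tells the points apart. This needs at least two curves: on a single
curve both points would have the same incidence. -/
theorem chainPt_injOn (hn : 2 ≤ n) : Set.InjOn (chainPt n γ d d') {k | k ≤ n} := by
  intro k hk l hl h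
  have hk : k ≤ n := hk
  have hl : l ≤ n := hl
  have e : ∀ i : Fin n, (k = i ∨ k = i + 1) ↔ (l = i ∨ l = i + 1) := fun i => by
    rw [← chainPt_mem_curve (γ := γ) (d := d) (d' := d') hn hk,
      ← chainPt_mem_curve (γ := γ) (d := d) (d' := d') hn hl, h]
  rcases Nat.lt_trichotomy k l with h1 | h1 | h1
  · by_cases h2 : k = 0
    · have h3 := e ⟨l - 1, by omega⟩
      have h4 := e ⟨1, by omega⟩
      simp only at h3 h4
      omega
    · have h3 := e ⟨k - 1, by omega⟩
      simp only at h3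
      omega
  · exact h1
  · by_cases h2 : l = 0
    · have h3 := e ⟨k - 1, by omega⟩
      have h4 := e ⟨1, by omega⟩
      simp only at h3 h4
      omega
    · have h3 := e ⟨l - 1, by omega⟩
      simp only at h3
      omega

/-- A point of a curve is on the axis of one chart, or it is the corner of the next chart. -/
theorem mem_curve_cases (i : Fin n) {p : X n} (hp : p ∈ curve i) :
    (∃ s, p = chart i.castSucc (s, 0)) ∨ p = corner i.succ := by
  obtain ⟨l, w, rfl⟩ := exists_chart_eq hp.1
  rcases (chart_mem_curve _ _ _).1 hp with ⟨h1, h2⟩ | ⟨h1, h2⟩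
  · obtain rfl : l = i.castSucc := Fin.ext h1
    exact Or.inl ⟨w.1, by rw [← h2]⟩
  · obtain rfl : l = i.succ := Fin.ext h1
    by_cases hv : w.2 = 0
    · exact Or.inr (by rw [show w = (0, 0) from Prod.ext h2 hv])
    · left
      rw [chart_pred i.castSucc i.succ (by simp) w hv, h2, mul_zero]
      exact ⟨_, rfl⟩

theorem mem_curve_cases' (i : Fin n) {p : X n} (hp : p ∈ curve i) :
    (∃ s, p = chart i.succ (0, s)) ∨ p = corner i.castSucc := by
  obtain ⟨l, w, rfl⟩ := exists_chart_eq hp.1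
  rcases (chart_mem_curve _ _ _).1 hp with ⟨h1, h2⟩ | ⟨h1, h2⟩
  · obtain rfl : l = i.castSucc := Fin.ext h1
    by_cases hv : w.1 = 0
    · exact Or.inr (by rw [show w = (0, 0) from Prod.ext hv h2])
    · left
      rw [chart_succ i.castSucc i.succ (by simp) w hv, h2, mul_zero]
      exact ⟨_, rfl⟩
  · obtain rfl : l = i.succ := Fin.ext h1
    exact Or.inl ⟨w.2, by rw [← h2]⟩

theorem curveFix_hAxis {i : Fin n} {c e : ℂ} (hcor : f (corner i.succ) = corner i.succ)
    (h : ∀ s, f (chart i.castSucc (s, 0)) = chart i.castSucc (c * s + e, 0)) :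
    curveFix f i = insert (corner i.succ) {p | ∃ s, c * s + e = s ∧ p = chart i.castSucc (s, 0)} := by
  ext p
  constructor
  · rintro ⟨hp, hfp⟩
    rcases mem_curve_cases i hp with ⟨s, rfl⟩ | rfl
    · rw [h] at hfp
      exact Or.inr ⟨s, congrArg Prod.fst (chart_injective _ hfp), rfl⟩
    · exact Or.inl rfl
  · rintro (rfl | ⟨s, hs, rfl⟩)
    · exact ⟨(chart_mem_curve _ _ _).2 (Or.inr ⟨by simp, rfl⟩), hcor⟩
    · exact ⟨(chart_mem_curve _ _ _).2 (Or.inl ⟨by simp, rfl⟩), by rw [h, hs]⟩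

theorem curveFix_vAxis {i : Fin n} {c e : ℂ} (hcor : f (corner i.castSucc) = corner i.castSucc)
    (h : ∀ s, f (chart i.succ (0, s)) = chart i.succ (0, c * s + e)) :
    curveFix f i = insert (corner i.castSucc) {p | ∃ s, c * s + e = s ∧ p = chart i.succ (0, s)} := by
  ext p
  constructor
  · rintro ⟨hp, hfp⟩
    rcases mem_curve_cases' i hp with ⟨s, rfl⟩ | rfl
    · rw [h] at hfp
      exact Or.inr ⟨s, congrArg Prod.snd (chart_injective _ hfp), rfl⟩
    · exact Or.inl rfl
  · rintro (rfl | ⟨s, hs, rfl⟩)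
    · exact ⟨(chart_mem_curve _ _ _).2 (Or.inl ⟨by simp, rfl⟩), hcor⟩
    · exact ⟨(chart_mem_curve _ _ _).2 (Or.inr ⟨by simp, rfl⟩), by rw [h, hs]⟩

theorem affine_fixed {c e s : ℂ} (hc : c ≠ 1) : c * s + e = s ↔ s = e / (1 - c) := by
  have : 1 - c ≠ 0 := sub_ne_zero.2 hc.symm
  rw [eq_div_iff this]
  constructor <;> intro h <;> linear_combination -h

theorem setOf_affine_fixed {c e : ℂ} (hc : c ≠ 1) (g : ℂ → X n) :
    {p | ∃ s, c * s + e = s ∧ p = g s} = {g (e / (1 - c))} := by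
  ext p
  simp only [affine_fixed hc, Set.mem_ofPred_eq, exists_eq_left, Set.mem_singleton_iff]

theorem setOf_translation_fixed {e : ℂ} (he : e ≠ 0) (g : ℂ → X n) :
    {p | ∃ s, 1 * s + e = s ∧ p = g s} = ∅ := by
  ext p
  simp [he]

/-- An affine map with multiplier different from `1` fixes infinity and one finite point, which on a
middle curve is the corner `0`. -/
theorem ChainAction.curveFix_eq (hn : 2 ≤ n) (h : ChainAction f γ d d') (i : Fin n)
    (hi : γ (i + 1) ≠ 1) :
    curveFix f i = {chainPt n γ d d' i, chainPt n γ d d' (i + 1)} := by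
  have hin := i.is_lt
  by_cases hl : (i : ℕ) + 1 < n
  · have hcor := h.fixed i.succ (by simp) (by simpa using hl)
    have e1 : chainPt n γ d d' (i + 1) = corner i.succ := by
      have := chainPt_mid (γ := γ) (d := d) (d' := d') (k := i.succ) (by simp) (by simpa using hl)
      simpa using this
    by_cases h0 : (i : ℕ) = 0
    · have hi0 : i.castSucc = 0 := Fin.ext h0
      have hf0 : ∀ s, f (chart i.castSucc (s, 0)) = chart i.castSucc (γ (i + 1) * s + d, 0) := by
        intro s; rw [hi0, h0]; exact h.first s
      rw [curveFix_hAxis hcor hf0, setOf_affine_fixed hi, e1, h0, hi0, chainPt_zero]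
      exact Set.pair_comm _ _
    · have hf0 : ∀ s, f (chart i.castSucc (s, 0)) = chart i.castSucc (γ (i + 1) * s + 0, 0) := by
        intro s; rw [add_zero]
        exact h.middle i.castSucc (by simp; omega) (by simpa using hl) s
      have e2 : chainPt n γ d d' i = corner i.castSucc := by
        have := chainPt_mid (γ := γ) (d := d) (d' := d') (k := i.castSucc) (by simp; omega)
          (by simp)
        simpa using this
      rw [curveFix_hAxis hcor hf0, setOf_affine_fixed hi, e1, e2, zero_div]
      exact Set.pair_comm _ _
  · have hin' : (i : ℕ) + 1 = n := by omega
    have hi1 : i.succ = Fin.last n := Fin.ext (by simpa using hin')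
    have hcor := h.fixed i.castSucc (by simp; omega) (by simp)
    have hf0 : ∀ s, f (chart i.succ (0, s)) = chart i.succ (0, (γ (i + 1))⁻¹ * s + d') := by
      intro s; rw [hi1, hin']; exact h.last s
    have e2 : chainPt n γ d d' i = corner i.castSucc := by
      have := chainPt_mid (γ := γ) (d := d) (d' := d') (k := i.castSucc) (by simp; omega)
        (by simp)
      simpa using this
    rw [curveFix_vAxis hcor hf0, setOf_affine_fixed (by simpa using hi), e2, hin',
      chainPt_last (by omega), hi1]

/-- The eigenvalues at the `k`-th point are `γ_(k+1)` along one curve and `γ_k⁻¹` along the other.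
At an end of the chain one of the two directions is transverse to `E`, and its eigenvalue is `δ`
divided by the other one. The end points need `γ_1 ≠ 1` or `γ_n ≠ 1`, since their coordinates are
quotients by `1 - γ_1` and `1 - γ_n⁻¹`. -/
theorem ChainAction.hasCharValue (hn : 2 ≤ n) (hf : IsAut f) (hδ : HasTwist f δ)
    (hγ : ∀ j, γ (j + 1) = δ * γ j) (hγ0 : ∀ j, γ j ≠ 0) (h : ChainAction f γ d d') {k : ℕ}
    (hk : k ≤ n) (h1 : k = 0 → γ 1 ≠ 1) (h2 : k = n → γ n ≠ 1) :
    HasCharValue f (chainPt n γ d d' k) ((1 - γ (k + 1)) * (1 - (γ k)⁻¹)) := by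
  have hn1 : 1 ≤ n := by omega
  have hδ0 := twist_ne_zero hn1 hf hδ
  have hlin : ∀ c e : ℂ, ∀ s, HasDerivAt (fun t : ℂ => c * t + e) c s := fun c e s => by
    simpa using ((hasDerivAt_id s).const_mul c).add_const e
  rcases Nat.eq_zero_or_pos k with h0 | h0
  · subst h0
    have h1 := h1 rfl
    have := (OnHAxis.hasCharValue hn1 hf hδ (k := 0) (by simp; omega) (s := d / (1 - γ 1))
      (φ := fun s => γ 1 * s + d) (Eventually.of_forall h.first) ((affine_fixed h1).2 rfl)
      (hlin _ _ _)).2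
    have e : δ * (γ 1)⁻¹ = (γ 0)⁻¹ := by
      rw [hγ 0]; have := hγ0 0; field_simp
    rw [e] at this
    exact this
  · rcases Nat.lt_or_ge k n with h3 | h3
    · obtain ⟨l, hl⟩ : ∃ l : Fin (n + 1), (l : ℕ) = k := ⟨⟨k, by omega⟩, rfl⟩
      obtain ⟨m, hm⟩ : ∃ m : Fin (n + 1), (l : ℕ) = m + 1 :=
        ⟨⟨k - 1, by omega⟩, by change (l : ℕ) = k - 1 + 1; omega⟩
      have hcor := h.fixed l (by omega) (by omega)
      obtain ⟨e, he⟩ : ∃ e, ∀ s, f (chart m (s, 0)) = chart m (γ k * s + e, 0) := by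
        by_cases hm0 : (m : ℕ) = 0
        · obtain rfl : m = 0 := Fin.ext hm0
          refine ⟨d, fun s => ?_⟩
          rw [show k = 1 by omega]; exact h.first s
        · refine ⟨0, fun s => ?_⟩
          rw [add_zero, show k = m + 1 by omega]
          exact h.middle m (by omega) (by omega) s
      have := (OnVAxis.hasCharValue hn1 hf hδ (k := l) (by omega)
        (onVAxis_corner hm (hγ0 k) he hcor) (by simp) (hasDerivAt_moebius_zero e (hγ0 k))).2
      rw [inv_inv, ← hγ, mul_comm] at this
      rw [← hl, chainPt_mid (by omega) (by omega)]
      rw [← hl] at this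
      exact this
    · obtain rfl : k = n := by omega
      have h2 := h2 rfl
      have h2' : (γ k)⁻¹ ≠ 1 := by simpa using h2
      have := (OnVAxis.hasCharValue hn1 hf hδ (k := Fin.last k) (by simp; omega)
        (s := d' / (1 - (γ k)⁻¹)) (φ := fun s => (γ k)⁻¹ * s + d') (Eventually.of_forall h.last)
        ((affine_fixed h2').2 rfl) (hlin _ _ _)).2
      rw [inv_inv, ← hγ, mul_comm] at this
      rw [chainPt_last hn1]
      exact this

theorem not_fixed_of_curveFix_finite {i : Fin n} (h : (curveFix f i).Finite) :
    ¬ ∀ p ∈ curve i, f p = p := by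
  intro hall
  have : Set.range (fun s : ℂ => chart i.castSucc (s, 0)) ⊆ curveFix f i := by
    rintro _ ⟨s, rfl⟩
    have hm : chart i.castSucc (s, 0) ∈ curve i := (chart_mem_curve _ _ _).2 (Or.inl ⟨rfl, rfl⟩)
    exact ⟨hm, hall _ hm⟩
  refine Set.infinite_range_of_injective (f := fun s : ℂ => chart i.castSucc (s, 0)) ?_
    (h.subset this)
  intro s t hst
  exact congrArg Prod.fst (chart_injective _ hst)

/-- Without pointwise fixed curves, the isolated fixed points are all the fixed points. -/
theorem isolatedFix_eq_of_finite (hn : 1 ≤ n) (h : ∀ i : Fin n, (curveFix f i).Finite) :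
    numFixedCurves f = 0 ∧ isolatedFix f = ⋃ i, curveFix f i := by
  have hnot := fun i => not_fixed_of_curveFix_finite (h i)
  constructor
  · rw [numFixedCurves]
    simp only [hnot, Set.ofPred_false, Set.ncard_empty]
  · rw [isolatedFix_eq hn fun i => Or.inr (h i)]
    ext p
    simp only [Set.mem_ofPred_eq, Set.mem_iUnion]
    constructor
    · rintro ⟨he, hp, -⟩
      obtain ⟨i, hi⟩ := exists_mem_curve hn he
      exact ⟨i, hi, hp⟩
    · rintro ⟨i, hi, hp⟩
      exact ⟨hi.1, hp, fun j hj => absurd hj (hnot j)⟩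

/-- The isolated fixed points if exactly one curve is pointwise fixed. -/
theorem isolatedFix_eq_of_fixed (hn : 1 ≤ n) (i : Fin n) (hi : ∀ p ∈ curve i, f p = p)
    (h : ∀ j : Fin n, j ≠ i → (curveFix f j).Finite) :
    numFixedCurves f = 1 ∧ isolatedFix f = (⋃ j ∈ {j | j ≠ i}, curveFix f j) \ curve i := by
  have hiff : ∀ j : Fin n, (∀ p ∈ curve j, f p = p) ↔ j = i := by
    intro j
    constructor
    · intro hj
      by_contra hne
      exact not_fixed_of_curveFix_finite (h j hne) hj
    · rintro rfl; exact hi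
  constructor
  · rw [numFixedCurves]
    simp only [hiff, Set.ofPred_eq_eq_singleton, Set.ncard_singleton]
  · rw [isolatedFix_eq hn fun j => (eq_or_ne j i).imp (fun e => (hiff j).2 e) (h j)]
    ext p
    simp only [hiff, Set.mem_ofPred_eq, Set.mem_sdiff, Set.mem_iUnion, exists_prop, forall_eq]
    constructor
    · rintro ⟨he, hp, hpi⟩
      obtain ⟨j, hj⟩ := exists_mem_curve hn he
      exact ⟨⟨j, fun e => hpi (e ▸ hj), hj, hp⟩, hpi⟩
    · rintro ⟨⟨j, -, hj, hp⟩, hpi⟩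
      exact ⟨hj.1, hp, hpi⟩

/-- If `γ_i = 1`, the action on the `i`-th curve is a translation. On a middle curve it fixes a
finite point and is the identity. On an end curve it is the identity, or its only fixed point is the
corner at infinity, which is parabolic. -/
theorem ChainAction.hasFixData (hn : 2 ≤ n) (hf : IsAut f) (hδ : HasTwist f δ) (hδ1 : δ ≠ 1)
    (hγ : ∀ j, γ (j + 1) = δ * γ j) (hγ0 : ∀ j, γ j ≠ 0) (h : ChainAction f γ d d') :
    HasFixData f δ γ := by
  have hn1 : 1 ≤ n := by omega
  have hinj := chainPt_injOn (γ := γ) (d := d) (d' := d') hn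
  refine ⟨chainPt n γ d d', fun hne => ?_, fun i hi1 hin hi hne => ?_⟩
  · have hc : ∀ i : Fin n, curveFix f i = {chainPt n γ d d' i, chainPt n γ d d' (i + 1)} :=
      fun i => h.curveFix_eq hn i (hne _ (by omega) (by omega))
    obtain ⟨h1, h2⟩ := isolatedFix_eq_of_finite hn1 fun i => by rw [hc i]; exact Set.toFinite _
    refine ⟨h1, ?_, hinj, fun k hk => h.hasCharValue hn hf hδ hγ hγ0 hk
      (fun _ => hne 1 le_rfl hn1) (fun _ => hne n hn1 le_rfl)⟩
    rw [h2]
    ext p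
    simp only [hc, Set.mem_iUnion, Set.mem_insert_iff, Set.mem_singleton_iff, Set.mem_image,
      Set.mem_ofPred_eq]
    constructor
    · rintro ⟨i, rfl | rfl⟩
      · exact ⟨i, by omega, rfl⟩
      · exact ⟨i + 1, by omega, rfl⟩
    · rintro ⟨k, hk, rfl⟩
      by_cases hkn : k < n
      · exact ⟨⟨k, hkn⟩, Or.inl rfl⟩
      · refine ⟨⟨k - 1, by omega⟩, Or.inr ?_⟩
        simp only
        rw [Nat.sub_add_cancel (by omega)]
  · obtain ⟨i₀, hi₀⟩ : ∃ i₀ : Fin n, (i₀ : ℕ) + 1 = i :=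
      ⟨⟨i - 1, by omega⟩, by change i - 1 + 1 = i; omega⟩
    have hc : ∀ j : Fin n, j ≠ i₀ →
        curveFix f j = {chainPt n γ d d' j, chainPt n γ d d' (j + 1)} := fun j hj =>
      h.curveFix_eq hn j (hne _ (by omega) (by omega) fun e => hj (Fin.ext (by omega)))
    have hcfin : ∀ j : Fin n, j ≠ i₀ → (curveFix f j).Finite := fun j hj => by
      rw [hc j hj]; exact Set.toFinite _
    have hS : {k | k ≤ n ∧ k + 1 ≠ i ∧ k ≠ i} ⊆ {k | k ≤ n} := fun k hk => hk.1
    -- the fixed points off the curve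
    have hoff : ∀ p, p ∉ curve i₀ → ((∃ j, j ≠ i₀ ∧ p ∈ curveFix f j) ↔
        p ∈ chainPt n γ d d' '' {k | k ≤ n ∧ k + 1 ≠ i ∧ k ≠ i}) := by
      intro p hp
      constructor
      · rintro ⟨j, hj, hpj⟩
        obtain ⟨k, hk, rfl⟩ : ∃ k ≤ n, p = chainPt n γ d d' k := by
          rw [hc j hj] at hpj
          rcases hpj with rfl | rfl
          · exact ⟨j, by omega, rfl⟩
          · exact ⟨j + 1, by omega, rfl⟩
        rw [chainPt_mem_curve hn hk] at hp
        exact ⟨k, ⟨hk, by omega, by omega⟩, rfl⟩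
      · rintro ⟨k, ⟨hk, h1, h2⟩, rfl⟩
        by_cases hkn : k < n
        · refine ⟨⟨k, hkn⟩, fun e => h1 (by rw [← hi₀, ← e]), ?_⟩
          rw [hc _ fun e => h1 (by rw [← hi₀, ← e])]
          exact Or.inl rfl
        · have e' : ((⟨k - 1, by omega⟩ : Fin n) : ℕ) + 1 = k := by
            change k - 1 + 1 = k; omega
          have hne' : (⟨k - 1, by omega⟩ : Fin n) ≠ i₀ := by
            intro e
            exact h2 (by rw [← hi₀, ← e, e'])
          refine ⟨⟨k - 1, by omega⟩, hne', ?_⟩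
          rw [hc _ hne', e']
          exact Or.inr rfl
    have hmemc : ∀ p ∈ chainPt n γ d d' '' {k | k ≤ n ∧ k + 1 ≠ i ∧ k ≠ i}, p ∉ curve i₀ := by
      rintro _ ⟨k, ⟨hk, h1, h2⟩, rfl⟩
      rw [chainPt_mem_curve hn hk]
      omega
    refine ⟨hinj.mono hS, fun k hk h1 h2 => h.hasCharValue hn hf hδ hγ hγ0 hk ?_ ?_, ?_⟩
    · rintro rfl
      exact hne 1 le_rfl hn1 (by omega)
    · rintro rfl
      exact hne k hn1 le_rfl (by omega)
    by_cases hfix : ∀ p ∈ curve i₀, f p = p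
    · left
      obtain ⟨h1, h2⟩ := isolatedFix_eq_of_fixed hn1 i₀ hfix hcfin
      refine ⟨h1, ?_⟩
      rw [h2]
      ext p
      constructor
      · rintro ⟨hp, hpi⟩
        simp only [Set.mem_iUnion, Set.mem_ofPred_eq, exists_prop] at hp
        exact (hoff p hpi).1 hp
      · intro hp
        have hpi := hmemc p hp
        refine ⟨?_, hpi⟩
        simp only [Set.mem_iUnion, Set.mem_ofPred_eq, exists_prop]
        exact (hoff p hpi).2 hp
    · right
      -- the only fixed point on the curve is a parabolic corner
      obtain ⟨l, hl, hQ, hl1, hln, hll⟩ : ∃ l : Fin (n + 1), curveFix f i₀ = {corner l} ∧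
          IsParabolicPt f δ (corner l) ∧ 1 ≤ (l : ℕ) ∧ (l : ℕ) < n ∧
          ((l : ℕ) = i₀ ∨ (l : ℕ) = i₀ + 1) := by
        by_cases h0 : (i₀ : ℕ) = 0
        · have hi0 : i₀.castSucc = 0 := Fin.ext h0
          have hi1 : i = 1 := by omega
          have hcor := h.fixed i₀.succ (by simp) (by simp; omega)
          have hf0 : ∀ s, f (chart i₀.castSucc (s, 0)) = chart i₀.castSucc (1 * s + d, 0) := by
            intro s
            have := h.first s
            rw [show γ 1 = 1 by rw [← hi1]; exact hi] at this
            rw [hi0]; exact this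
          have hd : d ≠ 0 := by
            rintro rfl
            apply hfix
            intro p hp
            rcases mem_curve_cases i₀ hp with ⟨s, rfl⟩ | rfl
            · rw [hf0]; simp
            · exact hcor
          have hce : corner i₀.succ ∈ exc n := (chart_mem_exc hn1 _ _).2 (Or.inl ⟨rfl, by simp⟩)
          refine ⟨i₀.succ, ?_, ?_, by simp, by simp; omega, Or.inr rfl⟩
          · rw [curveFix_hAxis hcor hf0, setOf_translation_fixed hd]
            simp
          -- The translation `s ↦ s + d` reads `t ↦ t / (1 + d t)` at the corner, which is the
          -- parabolic normal form with `e = d`.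
          · obtain ⟨c1, c2⟩ := chartPt_corner hn1 hce
            refine OnVAxis.isParabolicPt hn1 hf hδ hδ1 hce c2 ?_ hd
              (φ := fun t => t / (1 + d * t)) ?_
            · rw [c1]; exact onVAxis_corner (by simp) one_ne_zero hf0 hcor
            · have hcont : ContinuousAt (fun t : ℂ => 1 + d * t) 0 := by fun_prop
              filter_upwards [hcont.eventually_ne (by simp : (1 : ℂ) + d * 0 ≠ 0)] with t ht
              simp only [sub_zero]
              field_simp
        · by_cases hl : (i₀ : ℕ) + 1 < n
          · exfalso
            apply hfix
            intro p hp
            rcases mem_curve_cases i₀ hp with ⟨s, rfl⟩ | rfl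
            · rw [h.middle i₀.castSucc (by simp; omega) (by simpa using hl)]
              simp only [Fin.val_castSucc]
              rw [hi₀, hi, one_mul]
            · exact h.fixed i₀.succ (by simp) (by simpa using hl)
          · have hin' : (i₀ : ℕ) + 1 = n := by omega
            have hi1 : i₀.succ = Fin.last n := Fin.ext (by simpa using hin')
            have hcor := h.fixed i₀.castSucc (by simp; omega) (by simp)
            have hf0 : ∀ s, f (chart i₀.succ (0, s)) = chart i₀.succ (0, 1 * s + d') := by
              intro s
              have := h.last s
              rw [show γ n = 1 by rw [← hi]; congr 1; omega, inv_one] at this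
              rw [hi1]; exact this
            have hd : d' ≠ 0 := by
              rintro rfl
              apply hfix
              intro p hp
              rcases mem_curve_cases' i₀ hp with ⟨s, rfl⟩ | rfl
              · rw [hf0]; simp
              · exact hcor
            have hce : corner i₀.castSucc ∈ exc n :=
              (chart_mem_exc hn1 _ _).2 (Or.inr ⟨rfl, by simp⟩)
            refine ⟨i₀.castSucc, ?_, ?_, by simp; omega, by simp, Or.inl rfl⟩
            · rw [curveFix_vAxis hcor hf0, setOf_translation_fixed hd]
              simp
            · obtain ⟨c1, c2⟩ := chartPt_corner hn1 hce
              refine OnHAxis.isParabolicPt hn1 hf hδ hδ1 hce c2 ?_ hd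
                (φ := fun t => t / (1 + d' * t)) ?_
              · rw [c1]; exact onHAxis_corner (by simp) one_ne_zero hf0 hcor
              · have hcont : ContinuousAt (fun t : ℂ => 1 + d' * t) 0 := by fun_prop
                filter_upwards [hcont.eventually_ne (by simp : (1 : ℂ) + d' * 0 ≠ 0)] with t ht
                simp only [sub_zero]
                field_simp
      have hfin : ∀ j : Fin n, (curveFix f j).Finite := fun j => by
        by_cases hj : j = i₀
        · rw [hj, hl]; exact Set.toFinite _
        · exact hcfin j hj
      obtain ⟨h1, h2⟩ := isolatedFix_eq_of_finite hn1 hfin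
      have hlc : corner l ∈ curveFix f i₀ := by rw [hl]; rfl
      refine ⟨h1, corner l, fun hm => hmemc _ hm hlc.1, ?_, hQ⟩
      rw [h2]
      ext p
      simp only [Set.mem_iUnion, Set.mem_insert_iff]
      constructor
      · rintro ⟨j, hj⟩
        by_cases hpi : p ∈ curve i₀
        · left
          have : p ∈ curveFix f i₀ := ⟨hpi, hj.2⟩
          rw [hl] at this
          exact this
        · right
          refine (hoff p hpi).1 ⟨j, fun e => hpi (e ▸ hj.1), hj⟩
      · rintro (rfl | hp)
        · exact ⟨i₀, hlc⟩
        · obtain ⟨j, -, hj⟩ := (hoff p (hmemc p hp)).2 hp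
          exact ⟨j, hj⟩

end

/-! ### Lifts and multipliers -/

theorem HasMultipliers.exists_lift {α₁ α₂ : ℂ} (h : HasMultipliers f α₁ α₂) :
    ∃ F a b c d, IsLift f F ∧ fderiv ℂ F 0 (1, 0) = (a, c) ∧ fderiv ℂ F 0 (0, 1) = (b, d) ∧
      a + d = α₁ + α₂ ∧ a * d - b * c = α₁ * α₂ := by
  obtain ⟨F, hF, hA⟩ := h
  refine ⟨F, _, _, _, _, hF, rfl, rfl, ?_⟩
  rw [← LinearMap.charpoly_toMatrix _ (Module.Basis.finTwoProd ℂ), Matrix.charpoly_fin_two] at hA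
  -- The value of the characteristic polynomial at `0` gives the determinant, and the value at `1`
  -- then gives the trace.
  have h0 := congrArg (Polynomial.eval 0) hA
  have h1 := congrArg (Polynomial.eval 1) hA
  simp only [Matrix.det_fin_two, Matrix.trace_fin_two] at h0 h1
  simp [LinearMap.toMatrix_apply] at h0 h1
  constructor
  · linear_combination h0 - h1
  · linear_combination h0

theorem IsLift.tendsto {F : ℂ × ℂ → ℂ × ℂ} (hF : IsLift f F) (ξ : ℂ × ℂ) :
    Tendsto (fun t : ℂ => t⁻¹ • F (t • ξ)) (𝓝[≠] 0) (𝓝 (fderiv ℂ F 0 ξ)) := by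
  have h1 : HasDerivAt (fun t : ℂ => t • ξ) ξ 0 := by
    simpa using (hasDerivAt_id (0 : ℂ)).smul_const ξ
  have h2 : HasFDerivAt F (fderiv ℂ F 0) ((0 : ℂ) • ξ) := by
    rw [zero_smul]; exact hF.1.differentiableAt.hasFDerivAt
  have h3 := hasDerivAt_iff_tendsto_slope.1 (h2.comp_hasDerivAt (0 : ℂ) h1)
  refine h3.congr fun t => ?_
  simp [slope_def_module, hF.2.1]

/-- The line through `(s, 1)` in `ℂ²` lifts to the curve `v = t^(n+1)` over the point `s` of the
first curve. This is true for all `s` only if `n = 1`; for larger `n` only the second coordinate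
axis, `s = 0`, is used. -/
theorem toS_chart_zero_eq_quot {s : ℂ} (hs : s = 0 ∨ n = 1) (hn : 1 ≤ n) (t : ℂ) :
    toS (chart (n := n) 0 (s, t ^ (n + 1))) = quot n (t • (s, 1)) := by
  have hn0 : n ≠ 0 := by omega
  rw [toS_chart, quot]
  rcases hs with rfl | rfl
  · simp [hn0]
  · simp only [Prod.smul_mk, smul_eq_mul, Fin.val_zero]
    refine Prod.ext ?_ (Prod.ext ?_ ?_) <;> simp <;> ring

theorem IsLift.toS_localRep {F : ℂ × ℂ → ℂ × ℂ} (hF : IsLift f F) (hn : 1 ≤ n) {s : ℂ}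
    (hs : s = 0 ∨ n = 1) {l : Fin (n + 1)} {G : ℂ × ℂ → ℂ × ℂ} (hG : IsLocalRep f 0 l (s, 0) G) :
    ∀ᶠ t in 𝓝 (0 : ℂ), toS (chart l (G (s, t ^ (n + 1)))) = quot n (F (t • (s, 1))) := by
  have c1 : Tendsto (fun t : ℂ => (s, t ^ (n + 1))) (𝓝 0) (𝓝 (s, 0)) := by
    have : ContinuousAt (fun t : ℂ => (s, t ^ (n + 1))) 0 := by fun_prop
    simpa [ContinuousAt] using this
  have c2 : Tendsto (fun t : ℂ => t • (s, (1 : ℂ))) (𝓝 0) (𝓝 0) := by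
    have : ContinuousAt (fun t : ℂ => t • (s, (1 : ℂ))) 0 := by fun_prop
    simpa [ContinuousAt] using this
  filter_upwards [c1.eventually hG.2, c2.eventually hF.2.2] with t t1 t2
  rw [← t1]
  exact t2 _ (toS_chart_zero_eq_quot hs hn t)

/-- Near a point of the first chart, the linear part of a lift determines the image point and
the derivative in the normal direction. -/
theorem IsLift.chart_zero {F : ℂ × ℂ → ℂ × ℂ} (hF : IsLift f F) (hn : 1 ≤ n) (hf : IsAut f) {δ : ℂ}
    (hδ : HasTwist f δ) {s σ : ℂ} (hs : s = 0 ∨ n = 1)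
    (h : f (chart 0 (s, 0)) = chart 0 (σ, 0)) {p q : ℂ} (hpq : fderiv ℂ F 0 (s, 1) = (p, q)) :
    q ≠ 0 ∧ σ * q ^ (n + 1) * 0 ^ (n - 1) = p * q ∧
      ∀ φ c, OnHAxis f 0 φ s → HasDerivAt φ c s → c * q ^ (n + 1) = δ := by
  have hmem : ∀ u : ℂ, chart (n := n) 0 (u, 0) ∈ exc n := fun u =>
    (chart_mem_exc hn _ _).2 (Or.inr ⟨rfl, hn⟩)
  obtain ⟨G, hG, hGs⟩ := hf.exists_localRep hn (hmem s) h
  -- the curve is invariant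
  have c0 : Tendsto (fun u : ℂ => (u, (0 : ℂ))) (𝓝 s) (𝓝 (s, 0)) :=
    (continuous_id.prodMk continuous_const).tendsto s
  have hinv : ∀ᶠ u in 𝓝 s, G (u, 0) = ((G (u, 0)).1, 0) := by
    filter_upwards [c0.eventually hG.2] with u hu
    have := hf.mapsTo (hmem u)
    rw [hu, chart_mem_exc hn] at this
    refine Prod.ext rfl ?_
    rcases this with h | h
    · exact absurd h.2 (by simp)
    · exact h.1
  have hφa : AnalyticAt ℂ (fun u => (G (u, 0)).1) s :=
    analyticAt_slice_fst (h := fun w => (G w).1) (a := (s, 0))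
      (AnalyticAt.fun_comp (g := Prod.fst) analyticAt_fst hG.1)
  have d1 := fderiv_of_invariant_fst (a := (s, 0)) hG.1 hinv hφa.differentiableAt.hasDerivAt
  -- The Jacobian is triangular, so `δ` is the multiplier along the curve times the normal
  -- derivative `V'`.
  have hd := (hδ 0 0 _ G (hmem s) hG).self_of_nhds
  rw [det_prod, d1, mul_zero, sub_zero] at hd
  set V' := (fderiv ℂ G (s, 0) (0, 1)).2 with hV'
  have hδ0 := twist_ne_zero hn hf hδ
  have hV0 : V' ≠ 0 := by
    intro e; rw [e, mul_zero] at hd; exact hδ0 hd.symm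
  -- limits
  have hev := hF.toS_localRep hn hs hG
  have hlim := hF.tendsto (s, 1)
  rw [hpq] at hlim
  have hp : Tendsto (fun t : ℂ => t⁻¹ * (F (t • (s, 1))).1) (𝓝[≠] 0) (𝓝 p) :=
    (continuous_fst.tendsto _).comp hlim
  have hq : Tendsto (fun t : ℂ => t⁻¹ * (F (t • (s, 1))).2) (𝓝[≠] 0) (𝓝 q) :=
    (continuous_snd.tendsto _).comp hlim
  have hVd : HasDerivAt (fun v : ℂ => (G (s, v)).2) V' 0 := by
    have h1 : HasDerivAt (fun v : ℂ => (s, v)) ((0, 1) : ℂ × ℂ) 0 :=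
      (hasDerivAt_const _ _).prodMk (hasDerivAt_id _)
    have h2 := HasFDerivAt.comp_hasDerivAt (x := 0) (l := G)
      hG.1.differentiableAt.hasFDerivAt h1
    exact hasFDerivAt_snd.comp_hasDerivAt (0 : ℂ) h2
  have hpow : Tendsto (fun t : ℂ => t ^ (n + 1)) (𝓝[≠] 0) (𝓝[≠] 0) := by
    refine tendsto_nhdsWithin_iff.2 ⟨?_, ?_⟩
    · have : ContinuousAt (fun t : ℂ => t ^ (n + 1)) 0 := by fun_prop
      have h2 : Tendsto (fun t : ℂ => t ^ (n + 1)) (𝓝 0) (𝓝 0) := by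
        simpa [ContinuousAt] using this
      exact h2.mono_left nhdsWithin_le_nhds
    · filter_upwards [self_mem_nhdsWithin] with t ht
      exact pow_ne_zero _ ht
  have hV := (hasDerivAt_iff_tendsto_slope.1 hVd).comp hpow
  -- In the first chart `z = v`, and on `ℂ²` it is `w₂^(n+1)`. Dividing by `t^(n+1)` and letting `t
  -- → 0` gives `q^(n+1) = V'`.
  have hV2 : ∀ᶠ t in 𝓝[≠] (0 : ℂ), (t⁻¹ * (F (t • (s, 1))).2) ^ (n + 1) =
      slope (fun v : ℂ => (G (s, v)).2) 0 (t ^ (n + 1)) := by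
    filter_upwards [nhdsWithin_le_nhds hev] with t ht
    have e := congrArg (fun z => z.2.2) ht
    simp only [toS_chart, quot, Fin.val_zero, pow_zero, one_mul, zero_add, pow_one] at e
    rw [slope_def_field, e, hGs, mul_pow]
    simp [div_eq_inv_mul]
  have hqV : q ^ (n + 1) = V' := tendsto_nhds_unique ((hq.pow (n + 1)).congr' hV2) hV
  have hq0 : q ≠ 0 := by
    rintro rfl
    apply hV0; rw [← hqV]; simp
  refine ⟨hq0, ?_, fun φ c h1 h2 => ?_⟩
  -- The coordinate `x = u v = w₁ w₂` divided by `t²` leaves the factor `t^(n-1)`. Its limit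
  -- `0^(n-1)` is `1` for `n = 1`, which determines `σ = p / q`, and `0` otherwise, which forces `p
  -- = 0`.
  · have hU : Tendsto (fun t : ℂ => (G (s, t ^ (n + 1))).1) (𝓝[≠] 0) (𝓝 σ) := by
      have c1 : ContinuousAt (fun t : ℂ => (G (s, t)).1) 0 := by
        have h3 : ContinuousAt G (s, 0) := hG.1.continuousAt
        have h4 : ContinuousAt (fun t : ℂ => (s, t)) 0 := by fun_prop
        exact continuous_fst.continuousAt.comp (ContinuousAt.comp (g := G) h3 h4)
      have h5 : Tendsto (fun t : ℂ => (G (s, t)).1) (𝓝 0) (𝓝 σ) := by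
        have := c1.tendsto
        rwa [hGs] at this
      exact h5.comp (hpow.mono_right nhdsWithin_le_nhds)
    have h0 : Tendsto (fun t : ℂ => t ^ (n - 1)) (𝓝[≠] 0) (𝓝 (0 ^ (n - 1))) :=
      ((continuous_id.pow (n - 1)).tendsto (0 : ℂ)).mono_left nhdsWithin_le_nhds
    refine tendsto_nhds_unique ((hU.mul (hq.pow (n + 1))).mul h0) ((hp.mul hq).congr' ?_)
    filter_upwards [nhdsWithin_le_nhds hev, self_mem_nhdsWithin] with t ht ht0
    have ht0 : t ≠ 0 := ht0
    have e := congrArg (fun z => z.2.2) ht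
    have e1 := congrArg (fun z => z.1) ht
    simp only [toS_chart, quot, Fin.val_zero, pow_zero, one_mul, zero_add, pow_one] at e e1
    rw [mul_pow, ← e, mul_mul_mul_comm, ← e1]
    obtain ⟨m, rfl⟩ : ∃ m, n = m + 1 := ⟨n - 1, by omega⟩
    have e2 : t⁻¹ ^ (m + 1 + 1) * t ^ m = t⁻¹ * t⁻¹ := by
      have e3 : t⁻¹ ^ m * t ^ m = 1 := by rw [← mul_pow, inv_mul_cancel₀ ht0, one_pow]
      rw [pow_succ, pow_succ]
      linear_combination (t⁻¹ * t⁻¹) * e3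
    rw [Nat.add_sub_cancel, ← e2]
    ring
  · have d2 := fderiv_of_invariant_fst (a := (s, 0)) hG.1 (hG.onHAxis h1) h2
    rw [d1] at d2
    rw [hqV, ← hd]
    congr 1
    exact (congrArg Prod.fst d2).symm

/-- The multiplier of the first curve of a chain. -/
theorem IsLift.first_multiplier {F : ℂ × ℂ → ℂ × ℂ} (hF : IsLift f F) (hn : 2 ≤ n) (hf : IsAut f)
    {δ : ℂ} (hδ : HasTwist f δ) {b c d : ℂ} (h1 : fderiv ℂ F 0 (0, 1) = (b, d)) {φ : ℂ → ℂ}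
    (h : OnHAxis f 0 φ 0) (hφ : HasDerivAt φ c 0) : d ≠ 0 ∧ b = 0 ∧ c * d ^ (n + 1) = δ := by
  obtain ⟨h2, h3, h4⟩ := hF.chart_zero (by omega) hf hδ (Or.inl rfl) h.self_of_nhds h1
  refine ⟨h2, ?_, h4 φ c h hφ⟩
  rw [zero_pow (by omega), mul_zero] at h3
  exact (mul_eq_zero.1 h3.symm).resolve_right h2

theorem gam_succ {α₁ α₂ : ℂ} (h₁ : α₁ ≠ 0) (h₂ : α₂ ≠ 0) (j : ℕ) :
    gam n α₁ α₂ (j + 1) = α₁ * α₂ * gam n α₁ α₂ j := by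
  simp only [gam]
  rw [show ((j + 1 : ℕ) : ℤ) - n - 1 = (j : ℤ) - n - 1 + 1 by push_cast; ring,
    zpow_add_one₀ h₂, Nat.cast_succ, zpow_add_one₀ h₁]
  ring

theorem gam_ne_zero {α₁ α₂ : ℂ} (h₁ : α₁ ≠ 0) (h₂ : α₂ ≠ 0) (j : ℕ) : gam n α₁ α₂ j ≠ 0 :=
  mul_ne_zero (zpow_ne_zero _ h₁) (zpow_ne_zero _ h₂)

theorem gam_one_mul {α₁ α₂ : ℂ} (h₂ : α₂ ≠ 0) :
    gam n α₁ α₂ 1 * α₂ ^ (n + 1) = α₁ * α₂ := by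
  simp only [gam]
  rw [← zpow_natCast α₂ (n + 1), mul_assoc, ← zpow_add₀ h₂]
  norm_num

/-- Exchanging the multipliers amounts to reading the chain from its other end. -/
theorem gam_swap {α₁ α₂ : ℂ} {j : ℕ} (hj : j ≤ n + 1) :
    gam n α₂ α₁ j = (gam n α₁ α₂ (n + 1 - j))⁻¹ := by
  simp only [gam]
  rw [mul_inv, ← zpow_neg, ← zpow_neg, mul_comm, Nat.cast_sub hj]
  congr 2 <;> push_cast <;> ring

/-- The matrix `F'(0)` is triangular with `b = 0`, so `d` is one of its eigenvalues. Nothing decides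
which one, as a lift may also exchange the roles of `α₁` and `α₂`; hence the alternative. -/
theorem hasFixData_of_two_le (hn : 2 ≤ n) (hf : IsAut f) (hsym : HasTrivialSymmetry f) {δ α₁ α₂ : ℂ}
    (hδ : HasTwist f δ) (hδ1 : δ ≠ 1) (hα : α₁ * α₂ = δ) (h : HasMultipliers f α₁ α₂) :
    HasFixData f δ (gam n α₁ α₂) ∨ HasFixData f δ (gam n α₂ α₁) := by
  have hn1 : 1 ≤ n := by omega
  have hδ0 := twist_ne_zero hn1 hf hδ
  have h₁ : α₁ ≠ 0 := by rintro rfl; exact hδ0 (by rw [← hα, zero_mul])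
  have h₂ : α₂ ≠ 0 := by rintro rfl; exact hδ0 (by rw [← hα, mul_zero])
  obtain ⟨F, a, b, c, d, hF, -, hbd, htr, hdet⟩ := h.exists_lift
  have key : ∀ e s, (∀ t, f (chart 0 (t, 0)) = chart 0 (e * t + s, 0)) →
      d ≠ 0 ∧ b = 0 ∧ e * d ^ (n + 1) = δ := fun e s hes =>
    hF.first_multiplier hn hf hδ hbd (φ := fun t => e * t + s) (Eventually.of_forall hes)
      (by simpa using ((hasDerivAt_id (0 : ℂ)).const_mul e).add_const s)
  have main : ∀ {x y : ℂ}, x ≠ 0 → y ≠ 0 → x * y = δ → d = y → HasFixData f δ (gam n x y) := by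
    intro x y hx hy hxy hd
    have hγ : ∀ j, gam n x y (j + 1) = δ * gam n x y j := fun j => by
      rw [← hxy]; exact gam_succ hx hy j
    obtain ⟨s, s', hc⟩ := exists_chainAction hn hf hsym hδ hγ (gam_ne_zero hx hy 1) fun e s hes => by
      have h1 := (key e s hes).2.2
      have h2 := gam_one_mul (n := n) (α₁ := x) hy
      rw [hd] at h1
      exact mul_right_cancel₀ (pow_ne_zero (n + 1) hy) (by rw [h1, h2, hxy])
    exact hc.hasFixData hn hf hδ hδ1 hγ (gam_ne_zero hx hy)
  obtain ⟨e, s, -, hes⟩ := exists_affine_hAxis hn1 hf hsym hδ (k := 0) (by simp; omega)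
  have hb := (key e s hes).2.1
  have hroots : (d - α₁) * (d - α₂) = 0 := by
    rw [hb] at hdet
    linear_combination d * htr - hdet
  rcases mul_eq_zero.1 hroots with h3 | h3
  · exact Or.inr (main h₂ h₁ (by rw [mul_comm, hα]) (sub_eq_zero.1 h3))
  · exact Or.inl (main h₁ h₂ hα (sub_eq_zero.1 h3))

/-! ### The case of one curve -/

section
variable {f : X 1 → X 1} {a b c d δ : ℂ}

/-- The action of `f` on the exceptional curve of an `A_1` singularity is the Möbius transformation
`[s : 1] ↦ [a s + b : c s + d]`. -/
structure MoebiusAction (f : X 1 → X 1) (a b c d : ℂ) : Prop where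
  hAxis : ∀ s, c * s + d ≠ 0 → f (chart 0 (s, 0)) = chart 0 ((a * s + b) / (c * s + d), 0)
  hAxis_pole : ∀ s, c * s + d = 0 → f (chart 0 (s, 0)) = corner 1
  vAxis : ∀ t, a + b * t ≠ 0 → f (chart 1 (0, t)) = chart 1 (0, (c + d * t) / (a + b * t))
  vAxis_pole : ∀ t, a + b * t = 0 → f (chart 1 (0, t)) = corner 0

theorem chart_one_vAxis {t : ℂ} (ht : t ≠ 0) :
    chart (n := 1) 1 (0, t) = chart 0 (t⁻¹, 0) := by
  rw [chart_pred 0 1 rfl (0, t) ht, mul_zero]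

theorem chart_zero_eq_chart_one {s t : ℂ} :
    chart (n := 1) 0 (s, 0) = chart 1 (0, t) ↔ s * t = 1 := by
  constructor
  · intro h
    obtain ⟨-, h1, h2⟩ := chart_eq_chart_of_lt le_rfl (by simp) h
      ((chart_mem_exc le_rfl _ _).2 (Or.inr ⟨rfl, by simp⟩))
    have h2 : t = s⁻¹ := congrArg Prod.snd h2
    rw [h2]; exact mul_inv_cancel₀ h1
  · intro h
    rw [chart_one_vAxis (right_ne_zero_of_mul_eq_one h), eq_inv_of_mul_eq_one_left h]

theorem mem_curve_zero_hAxis (s : ℂ) : chart (n := 1) 0 (s, 0) ∈ curve (0 : Fin 1) :=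
  (chart_mem_curve _ _ _).2 (Or.inl ⟨rfl, rfl⟩)

theorem mem_curve_zero_vAxis (t : ℂ) : chart (n := 1) 1 (0, t) ∈ curve (0 : Fin 1) :=
  (chart_mem_curve _ _ _).2 (Or.inr ⟨rfl, rfl⟩)

theorem corner_zero_ne_corner_one : corner (n := 1) 0 ≠ corner 1 := fun h => by
  simpa using (chart_zero_eq_chart_one (s := 0) (t := 0)).1 h

theorem IsLift.denom_eq_zero {F : ℂ × ℂ → ℂ × ℂ} (hF : IsLift f F) (hf : IsAut f) {s : ℂ}
    (h : f (chart 0 (s, 0)) = corner 1) {p q : ℂ} (hpq : fderiv ℂ F 0 (s, 1) = (p, q)) : q = 0 := by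
  obtain ⟨G, hG, hGs⟩ := hf.exists_localRep le_rfl (curve_subset_exc 0 (mem_curve_zero_hAxis s)) h
  have hev := hF.toS_localRep le_rfl (Or.inr rfl) hG
  have hlim := hF.tendsto (s, 1)
  rw [hpq] at hlim
  have hp : Tendsto (fun t : ℂ => t⁻¹ * (F (t • (s, 1))).1) (𝓝[≠] 0) (𝓝 p) :=
    (continuous_fst.tendsto _).comp hlim
  have hq : Tendsto (fun t : ℂ => t⁻¹ * (F (t • (s, 1))).2) (𝓝[≠] 0) (𝓝 q) :=
    (continuous_snd.tendsto _).comp hlim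
  have hV : Tendsto (fun t : ℂ => (G (s, t ^ (1 + 1))).2) (𝓝[≠] 0) (𝓝 0) := by
    have c0 : ContinuousAt (fun t : ℂ => (s, t ^ (1 + 1))) 0 := by fun_prop
    have c1 : ContinuousAt G (s, (0 : ℂ) ^ (1 + 1)) := by
      rw [zero_pow (by norm_num)]; exact hG.1.continuousAt
    have c2 : ContinuousAt (fun t : ℂ => (G (s, t ^ (1 + 1))).2) 0 :=
      continuous_snd.continuousAt.comp (ContinuousAt.comp (g := G) c1 c0)
    have := c2.tendsto
    rw [zero_pow (by norm_num), hGs] at this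
    exact this.mono_left nhdsWithin_le_nhds
  have hlim2 : Tendsto (fun t : ℂ => (t⁻¹ * (F (t • (s, 1))).2) ^ 2) (𝓝[≠] 0)
      (𝓝 (p ^ 2 * 0 ^ 2)) := by
    -- In the second chart `z = y v²`, that is, `F₂² = F₁² v²`, and `v → 0` at the corner.
    refine ((hp.pow 2).mul (hV.pow 2)).congr' ?_
    filter_upwards [nhdsWithin_le_nhds hev] with t ht
    have e1 := congrArg (fun z => z.2.1) ht
    have e2 := congrArg (fun z => z.2.2) ht
    simp [toS_chart, quot] at e1 e2
    simp only [Prod.smul_mk, smul_eq_mul, mul_one, one_add_one_eq_two]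
    rw [mul_pow, mul_pow, ← e2, ← e1]
    ring
  have := tendsto_nhds_unique (hq.pow 2) hlim2
  simpa using this

/-- The lines spanned by `(s, 1)` show the action on the finite part of the curve. The image of the
point at infinity is not accessible in this way; it is the one value that `f` does not take
elsewhere on the curve. -/
theorem IsLift.moebiusAction {F : ℂ × ℂ → ℂ × ℂ} (hF : IsLift f F) (hf : IsAut f)
    (hsym : HasTrivialSymmetry f) (hδ : HasTwist f δ) (h1 : fderiv ℂ F 0 (1, 0) = (a, c))
    (h2 : fderiv ℂ F 0 (0, 1) = (b, d)) (hdet : a * d - b * c ≠ 0) : MoebiusAction f a b c d := by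
  have hpq : ∀ s : ℂ, fderiv ℂ F 0 (s, 1) = (a * s + b, c * s + d) := fun s => by
    have : ((s, 1) : ℂ × ℂ) = s • (1, 0) + (0, 1) := by simp
    rw [this, map_add, map_smul, h1, h2]
    simp [mul_comm]
  have hcases : ∀ s, (∃ σ, c * s + d ≠ 0 ∧ f (chart 0 (s, 0)) = chart 0 (σ, 0) ∧
      σ = (a * s + b) / (c * s + d)) ∨ (c * s + d = 0 ∧ f (chart 0 (s, 0)) = corner 1) := by
    intro s
    rcases mem_curve_cases 0 (apply_mem_curve hsym (mem_curve_zero_hAxis s)) with ⟨σ, h⟩ | h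
    · obtain ⟨h3, h4, -⟩ := hF.chart_zero le_rfl hf hδ (Or.inr rfl) h (hpq s)
      refine Or.inl ⟨σ, h3, h, ?_⟩
      rw [eq_div_iff h3]
      apply mul_right_cancel₀ h3
      simp only [Nat.sub_self, pow_zero, mul_one] at h4
      linear_combination h4
    · exact Or.inr ⟨hF.denom_eq_zero hf h (hpq s), h⟩
  have hH : ∀ s, c * s + d ≠ 0 →
      f (chart 0 (s, 0)) = chart 0 ((a * s + b) / (c * s + d), 0) := by
    intro s hs
    rcases hcases s with ⟨σ, -, h, rfl⟩ | ⟨h, -⟩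
    · exact h
    · exact absurd h hs
  have hP : ∀ s, c * s + d = 0 → f (chart 0 (s, 0)) = corner 1 := by
    intro s hs
    rcases hcases s with ⟨σ, h, -⟩ | ⟨-, h⟩
    · exact absurd hs h
    · exact h
  -- A point not attained from the first chart must be the image of the only remaining point, since
  -- `f` maps the curve onto itself.
  have hsurj : ∀ p ∈ curve (0 : Fin 1), (∀ s, f (chart 0 (s, 0)) ≠ p) → f (corner 1) = p := by
    intro p hp hne
    rw [← hsym 0] at hp
    obtain ⟨x, hx, rfl⟩ := hp
    rcases mem_curve_cases 0 hx with ⟨s, rfl⟩ | rfl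
    · exact absurd rfl (hne s)
    · rfl
  have hflip : ∀ {x y t : ℂ}, t ≠ 0 → x * t⁻¹ + y = (x + y * t) * t⁻¹ := fun {x y t} ht => by
    field_simp
  refine ⟨hH, hP, fun t ht => ?_, fun t ht => ?_⟩
  · by_cases h0 : t = 0
    · subst h0
      simp only [mul_zero, add_zero] at ht ⊢
      refine hsurj _ (mem_curve_zero_vAxis _) fun s hs => ?_
      by_cases hq : c * s + d = 0
      · rw [hP s hq] at hs
        have : (0 : ℂ) = c / a := congrArg Prod.snd (chart_injective _ hs)
        have hc : c = 0 := (div_eq_zero_iff.1 this.symm).resolve_right ht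
        apply hdet
        rw [hc] at hq ⊢
        linear_combination a * hq
      · rw [hH s hq, chart_zero_eq_chart_one] at hs
        rw [div_mul_div_comm, div_eq_one_iff_eq (mul_ne_zero hq ht)] at hs
        apply hdet
        linear_combination -hs
    · rw [chart_one_vAxis h0]
      by_cases hq : c * t⁻¹ + d = 0
      · rw [hP _ hq]
        rw [hflip h0] at hq
        rw [(mul_eq_zero.1 hq).resolve_right (inv_ne_zero h0), zero_div]
      · rw [hH _ hq, chart_zero_eq_chart_one, hflip h0, hflip h0]
        rw [hflip h0] at hq
        rw [mul_div_mul_right _ _ (inv_ne_zero h0), div_mul_div_comm, mul_comm, div_self]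
        exact mul_ne_zero (left_ne_zero_of_mul hq) ht
  · by_cases h0 : t = 0
    · subst h0
      simp only [mul_zero, add_zero] at ht ⊢
      refine hsurj _ (mem_curve_zero_hAxis _) fun s hs => ?_
      by_cases hq : c * s + d = 0
      · rw [hP s hq] at hs
        exact corner_zero_ne_corner_one hs.symm
      · rw [hH s hq] at hs
        have : (a * s + b) / (c * s + d) = 0 := congrArg Prod.fst (chart_injective _ hs)
        have hb := (div_eq_zero_iff.1 this).resolve_right hq
        apply hdet
        rw [ht] at hb ⊢
        linear_combination -c * hb
    · rw [chart_one_vAxis h0]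
      have hp : a * t⁻¹ + b = 0 := by rw [hflip h0, ht, zero_mul]
      have hq : c * t⁻¹ + d ≠ 0 := by
        intro hq
        apply hdet
        linear_combination a * hq - c * hp
      rw [hH _ hq, hp, zero_div]

/-- The point of the exceptional curve is an eigenline of the matrix `(a, b; c, d)` with
eigenvalue `x`. -/
def IsEigenPt (a b c d x : ℂ) (p : X 1) : Prop :=
  (∃ s, p = chart 0 (s, 0) ∧ c * s + d = x ∧ a * s + b = x * s) ∨
    ∃ t, p = chart 1 (0, t) ∧ a + b * t = x ∧ c + d * t = x * t

theorem IsEigenPt.mem_curve {x : ℂ} {p : X 1} (h : IsEigenPt a b c d x p) :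
    p ∈ curve (0 : Fin 1) := by
  rcases h with ⟨s, rfl, -⟩ | ⟨t, rfl, -⟩
  · exact mem_curve_zero_hAxis s
  · exact mem_curve_zero_vAxis t

theorem IsEigenPt.root {x : ℂ} {p : X 1} (h : IsEigenPt a b c d x p) :
    x ^ 2 - (a + d) * x + (a * d - b * c) = 0 := by
  rcases h with ⟨s, -, h1, h2⟩ | ⟨t, -, h1, h2⟩
  · linear_combination (a - x) * h1 - c * h2
  · linear_combination (d - x) * h1 - b * h2

theorem exists_isEigenPt {x : ℂ} (h : x ^ 2 - (a + d) * x + (a * d - b * c) = 0) :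
    ∃ p, IsEigenPt a b c d x p := by
  by_cases hc : c = 0
  · subst hc
    by_cases hx : x = a
    · exact ⟨corner 1, Or.inr ⟨0, rfl, by simp [hx], by simp⟩⟩
    · have hd : x = d := by
        have : (x - a) * (x - d) = 0 := by linear_combination h
        exact sub_eq_zero.1 ((mul_eq_zero.1 this).resolve_left (sub_ne_zero.2 hx))
      have hda : x - a ≠ 0 := sub_ne_zero.2 hx
      refine ⟨_, Or.inl ⟨b / (x - a), rfl, by simp [hd], ?_⟩⟩
      field_simp
      ring
  · refine ⟨_, Or.inl ⟨(x - d) / c, rfl, by field_simp; ring, ?_⟩⟩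
    field_simp
    linear_combination -h

theorem IsEigenPt.eigenvalue_unique {x y : ℂ} {p : X 1} (h : IsEigenPt a b c d x p)
    (h' : IsEigenPt a b c d y p) : x = y := by
  have key : ∀ {x y s t : ℂ}, c * s + d = x → c + d * t = y * t → s * t = 1 → x = y := by
    intro x y s t h1 h2 h3
    have ht := right_ne_zero_of_mul_eq_one h3
    apply mul_right_cancel₀ ht
    linear_combination c * h3 + h2 - t * h1
  rcases h with ⟨s, rfl, h1, h2⟩ | ⟨t, rfl, h1, h2⟩ <;>
    rcases h' with ⟨s', e, h1', h2'⟩ | ⟨t', e, h1', h2'⟩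
  · obtain rfl : s = s' := congrArg Prod.fst (chart_injective _ e)
    rw [← h1, h1']
  · exact key h1 h2' (chart_zero_eq_chart_one.1 e)
  · exact (key h1' h2 (chart_zero_eq_chart_one.1 e.symm)).symm
  · obtain rfl : t = t' := congrArg Prod.snd (chart_injective _ e)
    rw [← h1, h1']

/-- Two distinct eigenlines with the same eigenvalue span `ℂ²`. -/
theorem IsEigenPt.scalar_of_ne {x : ℂ} {p p' : X 1} (h : IsEigenPt a b c d x p)
    (h' : IsEigenPt a b c d x p') (hne : p ≠ p') : a = x ∧ b = 0 ∧ c = 0 ∧ d = x := by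
  have key : ∀ {s t : ℂ}, c * s + d = x → a * s + b = x * s → a + b * t = x → c + d * t = x * t →
      s * t ≠ 1 → a = x ∧ b = 0 ∧ c = 0 ∧ d = x := by
    intro s t h1 h2 h3 h4 h5
    have h5 : 1 - s * t ≠ 0 := sub_ne_zero.2 h5.symm
    have hc : c = 0 := (mul_eq_zero.1 (show c * (1 - s * t) = 0 by
      linear_combination h4 - t * h1)).resolve_right h5
    have hb : b = 0 := (mul_eq_zero.1 (show b * (1 - s * t) = 0 by
      linear_combination h2 - s * h3)).resolve_right h5
    subst hb hc
    exact ⟨by linear_combination h3, rfl, rfl, by linear_combination h1⟩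
  rcases h with ⟨s, rfl, h1, h2⟩ | ⟨t, rfl, h1, h2⟩ <;>
    rcases h' with ⟨s', rfl, h1', h2'⟩ | ⟨t', rfl, h1', h2'⟩
  · have hs : s - s' ≠ 0 := sub_ne_zero.2 fun e => hne (by rw [e])
    have hc : c = 0 := (mul_eq_zero.1 (show c * (s - s') = 0 by
      linear_combination h1 - h1')).resolve_right hs
    have ha : a - x = 0 := (mul_eq_zero.1 (show (a - x) * (s - s') = 0 by
      linear_combination h2 - h2')).resolve_right hs
    subst hc
    exact ⟨by linear_combination ha, by linear_combination h2 - s * ha, rfl,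
      by linear_combination h1⟩
  · exact key h1 h2 h1' h2' fun e => hne (chart_zero_eq_chart_one.2 e)
  · exact key h1' h2' h1 h2 fun e => hne (chart_zero_eq_chart_one.2 e).symm
  · have hs : t - t' ≠ 0 := sub_ne_zero.2 fun e => hne (by rw [e])
    have hb : b = 0 := (mul_eq_zero.1 (show b * (t - t') = 0 by
      linear_combination h1 - h1')).resolve_right hs
    have hd : d - x = 0 := (mul_eq_zero.1 (show (d - x) * (t - t') = 0 by
      linear_combination h2 - h2')).resolve_right hs
    subst hb
    exact ⟨by linear_combination h1, rfl, by linear_combination h2 - t * hd,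
      by linear_combination hd⟩

theorem MoebiusAction.onHAxis (h : MoebiusAction f a b c d) {s : ℂ} (hs : c * s + d ≠ 0) :
    OnHAxis f 0 (fun s => (a * s + b) / (c * s + d)) s := by
  have : ContinuousAt (fun s : ℂ => c * s + d) s := by fun_prop
  filter_upwards [this.eventually_ne hs] with t ht
  exact h.hAxis t ht

theorem MoebiusAction.onVAxis (h : MoebiusAction f a b c d) {t : ℂ} (ht : a + b * t ≠ 0) :
    OnVAxis f 1 (fun t => (c + d * t) / (a + b * t)) t := by
  have : ContinuousAt (fun t : ℂ => a + b * t) t := by fun_prop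
  filter_upwards [this.eventually_ne ht] with t ht
  exact h.vAxis t ht

/-- A line is mapped to itself exactly when it is an eigenline; invertibility excludes the
eigenvalue `0`, so the denominators at an eigenline do not vanish. -/
theorem MoebiusAction.apply_eq_iff (h : MoebiusAction f a b c d) (hdet : a * d - b * c ≠ 0)
    {p : X 1} (hp : p ∈ curve (0 : Fin 1)) : f p = p ↔ ∃ x, IsEigenPt a b c d x p := by
  constructor
  · intro hfp
    rcases mem_curve_cases 0 hp with ⟨s, rfl⟩ | rfl
    · by_cases hs : c * s + d = 0
      · exfalso
        have := (h.hAxis_pole s hs).symm.trans hfp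
        simpa using chart_zero_eq_chart_one.1 this.symm
      · refine ⟨_, Or.inl ⟨s, rfl, rfl, ?_⟩⟩
        have := congrArg Prod.fst (chart_injective _ ((h.hAxis s hs).symm.trans hfp))
        rw [div_eq_iff hs] at this
        rw [this, mul_comm]
    · by_cases hs : a + b * 0 = 0
      · exact absurd ((h.vAxis_pole 0 hs).symm.trans hfp) corner_zero_ne_corner_one
      · refine ⟨_, Or.inr ⟨0, rfl, rfl, ?_⟩⟩
        have := congrArg Prod.snd (chart_injective _ ((h.vAxis 0 hs).symm.trans hfp))
        rw [div_eq_iff hs] at this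
        rw [this, mul_comm]
  · rintro ⟨x, hx⟩
    have hx0 : x ≠ 0 := by
      rintro rfl
      apply hdet
      linear_combination hx.root
    rcases hx with ⟨s, rfl, h1, h2⟩ | ⟨t, rfl, h1, h2⟩
    · rw [h.hAxis s (by rwa [h1]), h1, h2, mul_div_cancel_left₀ _ hx0]
    · rw [h.vAxis t (by rwa [h1]), h1, h2, mul_div_cancel_left₀ _ hx0]

theorem hasDerivAt_moebius {a b c d s : ℂ} (hs : c * s + d ≠ 0) :
    HasDerivAt (fun s => (a * s + b) / (c * s + d)) ((a * d - b * c) / (c * s + d) ^ 2) s := by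
  have h1 : ∀ x y : ℂ, HasDerivAt (fun s : ℂ => x * s + y) x s := fun x y => by
    simpa using ((hasDerivAt_id s).const_mul x).add_const y
  refine ((h1 a b).fun_div (h1 c d) hs).congr_deriv ?_
  ring

/-- The denominator of the Möbius transformation at the fixed point is the eigenvalue `x`, so the
multiplier along the curve is `δ / x²` and the transverse one is `x²`. -/
theorem MoebiusAction.hasCharValue (h : MoebiusAction f a b c d) (hf : IsAut f)
    (hδ : HasTwist f δ) (hdet : a * d - b * c = δ) {x : ℂ} {p : X 1}
    (hp : IsEigenPt a b c d x p) : HasCharValue f p ((1 - δ / x ^ 2) * (1 - x ^ 2)) := by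
  have hδ0 := twist_ne_zero le_rfl hf hδ
  have hx0 : x ≠ 0 := by
    rintro rfl
    apply hδ0
    linear_combination hp.root - hdet
  have e : δ * (δ / x ^ 2)⁻¹ = x ^ 2 := by field_simp
  suffices HasCharValue f p ((1 - δ / x ^ 2) * (1 - δ * (δ / x ^ 2)⁻¹)) by rwa [e] at this
  rcases hp with ⟨s, rfl, h1, h2⟩ | ⟨t, rfl, h1, h2⟩
  · have hs : c * s + d ≠ 0 := by rwa [h1]
    refine (OnHAxis.hasCharValue le_rfl hf hδ (by simp) (h.onHAxis hs) ?_ ?_).2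
    · simp only [h1, h2]; exact mul_div_cancel_left₀ _ hx0
    · have := hasDerivAt_moebius (a := a) (b := b) hs
      rwa [h1, hdet] at this
  · have ht : a + b * t ≠ 0 := by rwa [h1]
    refine (OnVAxis.hasCharValue le_rfl hf hδ (by simp) (h.onVAxis ht) ?_ ?_).2
    · simp only [h1, h2]; exact mul_div_cancel_left₀ _ hx0
    · have ht' : b * t + a ≠ 0 := by rwa [add_comm]
      have := hasDerivAt_moebius (a := d) (b := c) ht'
      rw [add_comm (b * t), h1, mul_comm d, mul_comm c, hdet] at this
      simpa only [add_comm] using this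

/-- For a Jordan block with double eigenvalue `x`, the transformation in the coordinate centred at
its fixed point is `t ↦ t / (1 + e t)` with `e = c / x` in the first chart and `e = b / x` in the
second. Here `chartPt` may select either chart, so both are treated. -/
theorem MoebiusAction.isParabolicPt (h : MoebiusAction f a b c d) (hf : IsAut f)
    (hδ : HasTwist f δ) (hδ1 : δ ≠ 1) {x : ℂ} (hx0 : x ≠ 0) (htr : a + d = 2 * x) {p : X 1}
    (hp : IsEigenPt a b c d x p) (hns : ¬ (a = x ∧ b = 0 ∧ c = 0 ∧ d = x)) :
    IsParabolicPt f δ p := by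
  have he := curve_subset_exc 0 hp.mem_curve
  have hc := chart_chartPt he
  have hm := hp.mem_curve
  rw [← hc, chart_mem_curve] at hm
  rcases hm with ⟨h1, h2⟩ | ⟨h1, h2⟩
  · have hk : (chartPt p).1 = 0 := Fin.ext h1
    obtain ⟨s, hs⟩ : ∃ s, (chartPt p).2 = (s, 0) := ⟨_, Prod.ext rfl h2⟩
    rw [hk, hs] at hc
    obtain ⟨e1, e2⟩ : c * s + d = x ∧ a * s + b = x * s := by
      rcases hp with ⟨s', e, e1, e2⟩ | ⟨t, e, e1, e2⟩
      · obtain rfl : s = s' := congrArg Prod.fst (chart_injective _ (hc.trans e))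
        exact ⟨e1, e2⟩
      · have hst := chart_zero_eq_chart_one.1 (hc.trans e)
        constructor
        · apply mul_right_cancel₀ (right_ne_zero_of_mul_eq_one hst)
          linear_combination c * hst + e2
        · linear_combination s * e1 - b * hst
    have hcs : c * s + d ≠ 0 := by rwa [e1]
    refine OnHAxis.isParabolicPt le_rfl hf hδ hδ1 he hs (e := c / x)
      (φ := fun s => (a * s + b) / (c * s + d)) ?_ ?_ ?_
    · rw [hk]; exact h.onHAxis hcs
    · intro e
      have hc0 : c = 0 := (div_eq_zero_iff.1 e).resolve_right hx0
      subst hc0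
      apply hns
      have hd : d = x := by linear_combination e1
      have ha : a = x := by linear_combination htr - hd
      exact ⟨ha, by rw [ha] at e2; linear_combination e2, rfl, hd⟩
    · have hcont : ContinuousAt (fun s : ℂ => c * s + d) s := by fun_prop
      filter_upwards [hcont.eventually_ne hcs] with t ht
      have k1 : 1 + c / x * (t - s) = (c * t + d) / x := by
        rw [eq_div_iff hx0]; field_simp; linear_combination -e1
      have k2 : (a * t + b) / (c * t + d) - s = x * (t - s) / (c * t + d) := by
        rw [eq_div_iff ht, sub_mul, div_mul_cancel₀ _ ht]
        linear_combination e2 + (t - s) * htr - t * e1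
      rw [k1, k2]
      field_simp
  · have hk : (chartPt p).1 = 1 := Fin.ext h1
    obtain ⟨s, hs⟩ : ∃ s, (chartPt p).2 = (0, s) := ⟨_, Prod.ext h2 rfl⟩
    rw [hk, hs] at hc
    obtain ⟨e1, e2⟩ : a + b * s = x ∧ c + d * s = x * s := by
      rcases hp with ⟨s', e, e1, e2⟩ | ⟨t, e, e1, e2⟩
      · have hst := chart_zero_eq_chart_one.1 (e.symm.trans hc.symm)
        constructor
        · apply mul_left_cancel₀ (left_ne_zero_of_mul_eq_one hst)
          linear_combination b * hst + e2
        · linear_combination s * e1 - c * hst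
      · obtain rfl : s = t := congrArg Prod.snd (chart_injective _ (hc.trans e))
        exact ⟨e1, e2⟩
    have hcs : a + b * s ≠ 0 := by rwa [e1]
    refine OnVAxis.isParabolicPt le_rfl hf hδ hδ1 he hs (e := b / x)
      (φ := fun s => (c + d * s) / (a + b * s)) ?_ ?_ ?_
    · rw [hk]; exact h.onVAxis hcs
    · intro e
      have hb0 : b = 0 := (div_eq_zero_iff.1 e).resolve_right hx0
      subst hb0
      apply hns
      have ha : a = x := by linear_combination e1
      have hd : d = x := by linear_combination htr - ha
      exact ⟨ha, rfl, by rw [hd] at e2; linear_combination e2, hd⟩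
    · have hcont : ContinuousAt (fun s : ℂ => a + b * s) s := by fun_prop
      filter_upwards [hcont.eventually_ne hcs] with t ht
      have k1 : 1 + b / x * (t - s) = (a + b * t) / x := by
        rw [eq_div_iff hx0]; field_simp; linear_combination -e1
      have k2 : (c + d * t) / (a + b * t) - s = x * (t - s) / (a + b * t) := by
        rw [eq_div_iff ht, sub_mul, div_mul_cancel₀ _ ht]
        linear_combination e2 + (t - s) * htr - t * e1
      rw [k1, k2]
      field_simp

/-- As `γ_1 = α₁ / α₂`, the condition `γ_1 ≠ 1` means two distinct eigenvalues, hence two fixed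
points. If `γ_1 = 1`, a scalar matrix fixes the curve pointwise, and a Jordan block has one
parabolic fixed point. -/
theorem MoebiusAction.hasFixData (h : MoebiusAction f a b c d) (hf : IsAut f)
    (hδ : HasTwist f δ) (hδ1 : δ ≠ 1) (hdet : a * d - b * c = δ) {α₁ α₂ : ℂ} (h₁ : α₁ ≠ 0)
    (h₂ : α₂ ≠ 0) (hα : α₁ * α₂ = δ) (htr : a + d = α₁ + α₂) : HasFixData f δ (gam 1 α₁ α₂) := by
  have hδ0 := twist_ne_zero le_rfl hf hδ
  have hdet0 : a * d - b * c ≠ 0 := by rwa [hdet]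
  have hγ0 : (gam 1 α₁ α₂ 0)⁻¹ = α₂ ^ 2 := by
    simp only [gam]
    rw [← zpow_natCast α₂ 2]
    norm_num
  have hγ1 : gam 1 α₁ α₂ 1 = α₁ / α₂ := by
    simp [gam, div_eq_mul_inv]
  have hγ2 : gam 1 α₁ α₂ 2 = α₁ ^ 2 := by
    simp only [gam]
    rw [← zpow_natCast α₁ 2]
    norm_num
  have hroot : ∀ x, x ^ 2 - (a + d) * x + (a * d - b * c) = (x - α₁) * (x - α₂) := fun x => by
    rw [htr, hdet, ← hα]; ring
  obtain ⟨p₁, hp₁⟩ := exists_isEigenPt (a := a) (b := b) (c := c) (d := d) (x := α₁)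
    (by rw [hroot]; ring)
  obtain ⟨p₂, hp₂⟩ := exists_isEigenPt (a := a) (b := b) (c := c) (d := d) (x := α₂)
    (by rw [hroot]; ring)
  have hfix : ∀ {p}, p ∈ curveFix f 0 → IsEigenPt a b c d α₁ p ∨ IsEigenPt a b c d α₂ p := by
    rintro p ⟨hp, hfp⟩
    obtain ⟨x, hx⟩ := (h.apply_eq_iff hdet0 hp).1 hfp
    have := hx.root
    rw [hroot] at this
    rcases mul_eq_zero.1 this with e | e
    · rw [sub_eq_zero.1 e] at hx; exact Or.inl hx
    · rw [sub_eq_zero.1 e] at hx; exact Or.inr hx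
  have hfix' : ∀ {p x}, IsEigenPt a b c d x p → p ∈ curveFix f 0 := fun hp =>
    ⟨hp.mem_curve, (h.apply_eq_iff hdet0 hp.mem_curve).2 ⟨_, hp⟩⟩
  -- The eigenline of `α₂` comes first: its eigenvalues are `α₁ / α₂ = γ_1` and `α₂² = γ_0⁻¹`.
  refine ⟨fun k => if k = 0 then p₂ else p₁, fun hne => ?_, fun i hi1 hin hi _ => ?_⟩
  · have hne : α₁ ≠ α₂ := by
      intro e
      apply hne 1 le_rfl le_rfl
      rw [hγ1, e, div_self h₂]
    have hpp : p₂ ≠ p₁ := by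
      rintro rfl
      exact hne (hp₁.eigenvalue_unique hp₂)
    have huniq : ∀ {x p p'}, IsEigenPt a b c d x p → IsEigenPt a b c d x p' → p = p' := by
      intro x p p' hp hp'
      by_contra hpp'
      obtain ⟨ha, -, -, hd⟩ := hp.scalar_of_ne hp' hpp'
      have e1 := hp₁.root
      have e2 := hp₂.root
      obtain ⟨-, hb, hc, -⟩ := hp.scalar_of_ne hp' hpp'
      apply hne
      have k : ∀ y, y ^ 2 - (a + d) * y + (a * d - b * c) = 0 → y = x := by
        intro y hy
        rw [ha, hb, hd] at hy
        have : (y - x) ^ 2 = 0 := by linear_combination hy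
        exact sub_eq_zero.1 (pow_eq_zero_iff (two_ne_zero) |>.1 this)
      rw [k _ e1, k _ e2]
    have hcurve : curveFix f 0 = {p₂, p₁} := by
      ext p
      constructor
      · intro hp
        rcases hfix hp with hp | hp
        · exact Or.inr (huniq hp hp₁)
        · exact Or.inl (huniq hp hp₂)
      · rintro (rfl | rfl)
        · exact hfix' hp₂
        · exact hfix' hp₁
    obtain ⟨k1, k2⟩ := isolatedFix_eq_of_finite (f := f) le_rfl fun i => by
      rw [Subsingleton.elim i 0, hcurve]; exact Set.toFinite _
    refine ⟨k1, ?_, ?_, ?_⟩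
    · rw [k2, show (⋃ i, curveFix f i) = curveFix f 0 from iSup_unique (curveFix f), hcurve]
      ext p
      constructor
      · rintro (rfl | rfl)
        · exact ⟨0, Nat.zero_le _, rfl⟩
        · exact ⟨1, Nat.le_refl 1, rfl⟩
      · rintro ⟨k, hk, rfl⟩
        by_cases hk0 : k = 0
        · simp [hk0]
        · simp [hk0]
    · intro k hk l hl hkl
      have hk : k ≤ 1 := hk
      have hl : l ≤ 1 := hl
      interval_cases k <;> interval_cases l
      · rfl
      · exact absurd hkl (by simpa using hpp)
      · exact absurd hkl (by simpa using hpp.symm)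
      · rfl
    · intro k hk
      interval_cases k
      · have := h.hasCharValue hf hδ hdet hp₂
        rw [hγ0, zero_add, hγ1]
        rwa [show δ / α₂ ^ 2 = α₁ / α₂ by rw [← hα]; field_simp] at this
      · have := h.hasCharValue hf hδ hdet hp₁
        rw [hγ1, hγ2, mul_comm]
        rwa [show δ / α₁ ^ 2 = (α₁ / α₂)⁻¹ by rw [← hα]; field_simp] at this
  · obtain rfl : i = 1 := by omega
    have hS : {k | k ≤ 1 ∧ k + 1 ≠ 1 ∧ k ≠ 1} = ∅ := by
      ext k
      simp only [Set.mem_ofPred_eq, Set.mem_empty_iff_false, iff_false]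
      omega
    rw [hS, Set.image_empty]
    refine ⟨Set.injOn_empty _, fun k hk h1 h2 => absurd hk (by omega), ?_⟩
    have hαα : α₁ = α₂ := by
      rw [hγ1, div_eq_one_iff_eq h₂] at hi; exact hi
    subst hαα
    by_cases hs : a = α₁ ∧ b = 0 ∧ c = 0 ∧ d = α₁
    · left
      obtain ⟨rfl, rfl, rfl, rfl⟩ := hs
      have hall : ∀ p ∈ curve (0 : Fin 1), f p = p := by
        intro p hp
        refine (h.apply_eq_iff hdet0 hp).2 ⟨d, ?_⟩
        rcases mem_curve_cases 0 hp with ⟨s, rfl⟩ | rfl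
        · exact Or.inl ⟨s, rfl, by ring, by ring⟩
        · exact Or.inr ⟨0, rfl, by ring, by ring⟩
      obtain ⟨k1, k2⟩ := isolatedFix_eq_of_fixed le_rfl 0 hall fun j hj =>
        absurd (Subsingleton.elim j 0) hj
      refine ⟨k1, ?_⟩
      rw [k2]
      ext p
      simp [Subsingleton.elim _ (0 : Fin 1)]
    · right
      have hcurve : curveFix f 0 = {p₁} := by
        ext p
        constructor
        · intro hp
          by_contra hne
          exact hs ((or_self_iff.1 (hfix hp)).scalar_of_ne hp₁ hne)
        · rintro rfl
          exact hfix' hp₁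
      obtain ⟨k1, k2⟩ := isolatedFix_eq_of_finite (f := f) le_rfl fun i => by
        rw [Subsingleton.elim i 0, hcurve]; exact Set.toFinite _
      refine ⟨k1, p₁, by simp, ?_, h.isParabolicPt hf hδ hδ1 h₁ (by rw [htr]; ring) hp₁ hs⟩
      rw [k2, show (⋃ i, curveFix f i) = curveFix f 0 from iSup_unique (curveFix f), hcurve]
      simp

end

theorem hasFixData {n : ℕ} {f : X n → X n} (hn : 1 ≤ n) (hf : IsAut f)
    (hsym : HasTrivialSymmetry f) {δ α₁ α₂ : ℂ} (hδ : HasTwist f δ) (hδ1 : δ ≠ 1)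
    (hα : α₁ * α₂ = δ) (h : HasMultipliers f α₁ α₂) :
    HasFixData f δ (gam n α₁ α₂) ∨ HasFixData f δ (gam n α₂ α₁) := by
  rcases hn.lt_or_eq with hn | rfl
  · exact hasFixData_of_two_le hn hf hsym hδ hδ1 hα h
  · left
    have hδ0 := twist_ne_zero hn hf hδ
    obtain ⟨F, a, b, c, d, hF, hac, hbd, htr, hdet⟩ := h.exists_lift
    rw [hα] at hdet
    exact (hF.moebiusAction hf hsym hδ hac hbd (by rwa [hdet])).hasFixData hf hδ hδ1 hdet
      (by rintro rfl; exact hδ0 (by rw [← hα, zero_mul]))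
      (by rintro rfl; exact hδ0 (by rw [← hα, mul_zero])) hα htr

/-! ### Summation of the indices -/

section
variable {γ : ℕ → ℂ} {δ : ℂ}

/-- Telescoping: as `γ_(k+1) - γ_k = (δ - 1) γ_k`, each summand is `(δ - 1)⁻¹` times the difference
of `(1 - γ_k)⁻¹` and `(1 - γ_(k+1))⁻¹`. -/
theorem sum_inv_charValue (hδ1 : δ ≠ 1) (hγ : ∀ j, γ (j + 1) = δ * γ j) (hγ0 : ∀ j, γ j ≠ 0)
    {a b : ℕ} (hab : a ≤ b) (h : ∀ k, a ≤ k → k ≤ b → γ k ≠ 1) :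
    ∑ k ∈ Finset.Ico a b, ((1 - γ (k + 1)) * (1 - (γ k)⁻¹))⁻¹ =
      (δ - 1)⁻¹ * ((1 - γ a)⁻¹ - (1 - γ b)⁻¹) := by
  induction b, hab using Nat.le_induction with
  | base => simp
  | succ b hab ih =>
    rw [Finset.sum_Ico_succ_top hab, ih fun k h1 h2 => h k h1 (by omega)]
    have e1 : 1 - γ b ≠ 0 := sub_ne_zero.2 (h b hab (by omega)).symm
    have e2 : 1 - γ (b + 1) ≠ 0 := sub_ne_zero.2 (h (b + 1) (by omega) le_rfl).symm
    have e3 : δ - 1 ≠ 0 := sub_ne_zero.2 hδ1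
    have e4 : 1 - (γ b)⁻¹ = -(1 - γ b) * (γ b)⁻¹ := by
      have := hγ0 b
      field_simp; ring
    have e5 : (1 - γ b)⁻¹ - (1 - γ (b + 1))⁻¹ = (γ b - γ (b + 1)) / ((1 - γ b) * (1 - γ (b + 1))) := by
      field_simp; ring
    have e6 : ((1 - γ (b + 1)) * (1 - (γ b)⁻¹))⁻¹ =
        (δ - 1)⁻¹ * ((1 - γ b)⁻¹ - (1 - γ (b + 1))⁻¹) := by
      rw [e4, e5, show γ b - γ (b + 1) = -((δ - 1) * γ b) by rw [hγ]; ring, mul_inv, mul_inv,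
        inv_inv, div_eq_mul_inv, mul_inv, neg_mul, mul_neg, mul_assoc (δ - 1), inv_mul_cancel_left₀ e3,
        inv_neg]
      ring
    rw [e6]; ring

theorem geom_eq (hγ : ∀ j, γ (j + 1) = δ * γ j) (i j : ℕ) : γ (i + j) = δ ^ j * γ i := by
  induction j with
  | zero => simp
  | succ j ih => rw [← add_assoc, hγ, ih]; ring

/-- Two terms equal to `1` would make a positive power of `δ` equal to `1`. -/
theorem geom_ne_one (hroot : ∀ m : ℕ, 0 < m → δ ^ m ≠ 1) (hγ : ∀ j, γ (j + 1) = δ * γ j)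
    {i j : ℕ} (hi : γ i = 1) (hij : j ≠ i) : γ j ≠ 1 := by
  intro hj
  rcases Nat.lt_or_gt_of_ne hij with h | h
  · have := geom_eq hγ j (i - j)
    rw [Nat.add_sub_cancel' h.le, hi, hj, mul_one] at this
    exact hroot (i - j) (by omega) this.symm
  · have := geom_eq hγ i (j - i)
    rw [Nat.add_sub_cancel' h.le, hi, hj, mul_one] at this
    exact hroot (j - i) (by omega) this.symm

theorem finsum_mem_image_finset {M : Type*} [AddCommMonoid M] {P : ℕ → X n} {s : Finset ℕ}
    (hP : Set.InjOn P s) (g : X n → M) : ∑ᶠ p ∈ P '' s, g p = ∑ k ∈ s, g (P k) := by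
  rw [finsum_mem_image hP, finsum_mem_coe_finset]

/-- The sums of the indices over a set of simple fixed points. -/
theorem sum_index (hn : 1 ≤ n) (hf : IsAut f) {P : ℕ → X n} {s : Finset ℕ} (hP : Set.InjOn P s)
    {D : ℕ → ℂ} (h : ∀ k ∈ s, HasCharValue f (P k) (D k)) (hD : ∀ k ∈ s, D k ≠ 0) (β : ℂ) :
    ∑ᶠ p ∈ P '' s, muAt f p = s.card ∧
      ∑ᶠ p ∈ P '' s, β * nuAt f p = β * ∑ k ∈ s, (D k)⁻¹ := by
  rw [finsum_mem_image_finset hP, finsum_mem_image_finset hP, Finset.mul_sum]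
  constructor
  · rw [Finset.sum_congr rfl fun k hk => (((h k hk).index hn hf).1 (hD k hk)).1]
    simp
  · exact Finset.sum_congr rfl fun k hk => by rw [(((h k hk).index hn hf).1 (hD k hk)).2]

theorem setOf_le_eq (n : ℕ) : {k | k ≤ n} = ((Finset.range (n + 1) : Finset ℕ) : Set ℕ) := by
  ext k; simp

theorem setOf_off_eq {n i : ℕ} (h1 : 1 ≤ i) (h2 : i ≤ n) : {k | k ≤ n ∧ k + 1 ≠ i ∧ k ≠ i} =
    ((Finset.Ico 0 (i - 1) ∪ Finset.Ico (i + 1) (n + 1) : Finset ℕ) : Set ℕ) := by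
  ext k; simp; omega

theorem HasFixData.finite (hroot : ∀ m : ℕ, 0 < m → δ ^ m ≠ 1) (hγ : ∀ j, γ (j + 1) = δ * γ j)
    (h : HasFixData f δ γ) : (isolatedFix f).Finite := by
  obtain ⟨P, h1, h2⟩ := h
  by_cases hc : ∃ i, 1 ≤ i ∧ i ≤ n ∧ γ i = 1
  · obtain ⟨i, hi1, hi2, hi⟩ := hc
    obtain ⟨-, -, h3⟩ := h2 i hi1 hi2 hi fun j _ _ hj => geom_ne_one hroot hγ hi hj
    have hfin : (P '' {k | k ≤ n ∧ k + 1 ≠ i ∧ k ≠ i}).Finite := by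
      rw [setOf_off_eq hi1 hi2]; exact (Finset.finite_toSet _).image P
    rcases h3 with ⟨-, h3⟩ | ⟨-, Q, -, h3, -⟩
    · rw [h3]; exact hfin
    · rw [h3]; exact hfin.insert Q
  · push Not at hc
    rw [(h1 hc).2.1, setOf_le_eq]
    exact (Finset.finite_toSet _).image P

theorem charValue_ne_zero {x y : ℂ} (hx : x ≠ 1) (hy : y ≠ 1) : (1 - x) * (1 - y⁻¹) ≠ 0 :=
  mul_ne_zero (sub_ne_zero.2 hx.symm) (sub_ne_zero.2 fun e => hy (inv_eq_one.1 e.symm))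

/-- The total depends on the two ends of the progression only, whether or not some inner term is
`1`. -/
theorem HasFixData.index (hn : 1 ≤ n) (hf : IsAut f) (hroot : ∀ m : ℕ, 0 < m → δ ^ m ≠ 1)
    (hγ : ∀ j, γ (j + 1) = δ * γ j) (hγ0 : ∀ j, γ j ≠ 0) (h : HasFixData f δ γ) (h0 : γ 0 ≠ 1)
    (hN : γ (n + 1) ≠ 1) {β : ℂ} (hβ : β ^ 2 = δ) :
    muExc f = (n : ℕ∞) + 1 ∧
      nuHatExc f β = β * ((δ - 1)⁻¹ * ((1 - γ 0)⁻¹ - (1 - γ (n + 1))⁻¹)) := by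
  have hδ1 : δ ≠ 1 := by simpa using hroot 1 one_pos
  have hδs : δ - 1 ≠ 0 := sub_ne_zero.2 hδ1
  obtain ⟨P, h1, h2⟩ := h
  rw [muExc, nuHatExc, hβ]
  by_cases hc : ∃ i, 1 ≤ i ∧ i ≤ n ∧ γ i = 1
  · obtain ⟨i, hi1, hi2, hi⟩ := hc
    have hne : ∀ j, j ≠ i → γ j ≠ 1 := fun j hj => geom_ne_one hroot hγ hi hj
    obtain ⟨hP, hD, h3⟩ := h2 i hi1 hi2 hi fun j _ _ hj => hne j hj
    rw [setOf_off_eq hi1 hi2] at hP h3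
    set s := Finset.Ico 0 (i - 1) ∪ Finset.Ico (i + 1) (n + 1) with hs
    have hmem : ∀ k ∈ s, k ≤ n ∧ k + 1 ≠ i ∧ k ≠ i := fun k hk => by
      rw [hs, Finset.mem_union, Finset.mem_Ico, Finset.mem_Ico] at hk
      omega
    have hdisj : Disjoint (Finset.Ico 0 (i - 1)) (Finset.Ico (i + 1) (n + 1)) := by
      rw [Finset.disjoint_left]
      intro k h1 h2
      rw [Finset.mem_Ico] at h1 h2
      omega
    obtain ⟨e1, e2⟩ := sum_index hn hf hP
      (fun k hk => hD k (hmem k hk).1 (hmem k hk).2.1 (hmem k hk).2.2)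
      (fun k hk => charValue_ne_zero (hne _ (hmem k hk).2.1) (hne _ (hmem k hk).2.2)) β
    have hcard : ((s.card : ℕ) : ℕ∞) + 2 = (n : ℕ∞) + 1 := by
      rw [hs, Finset.card_union_of_disjoint hdisj, Nat.card_Ico, Nat.card_Ico]
      norm_cast
      omega
    -- The telescoping sum is interrupted between `γ_(i-1) = δ⁻¹` and `γ_(i+1) = δ`, and the gap `(δ
    -- - 1)⁻¹ ((1 - δ⁻¹)⁻¹ - (1 - δ)⁻¹)` is the parabolic index.
    have hsum : ∑ k ∈ s, ((1 - γ (k + 1)) * (1 - (γ k)⁻¹))⁻¹ + (δ + 1) / (δ - 1) ^ 2 =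
        (δ - 1)⁻¹ * ((1 - γ 0)⁻¹ - (1 - γ (n + 1))⁻¹) := by
      rw [hs, Finset.sum_union hdisj,
        sum_inv_charValue hδ1 hγ hγ0 (Nat.zero_le _) fun k _ hk => hne k (by omega),
        sum_inv_charValue hδ1 hγ hγ0 (by omega) fun k hk _ => hne k (by omega)]
      have e3 : γ (i + 1) = δ := by rw [hγ, hi, mul_one]
      have e4 : δ * γ (i - 1) = 1 := by
        rw [← hγ, Nat.sub_add_cancel hi1, hi]
      have hδ0 : δ ≠ 0 := left_ne_zero_of_mul_eq_one e4
      have e5 : γ (i - 1) = δ⁻¹ := eq_inv_of_mul_eq_one_right e4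
      have e6 : (1 - δ⁻¹)⁻¹ = δ / (δ - 1) := by
        rw [inv_eq_iff_eq_inv, inv_div]; field_simp
      have e7 : (1 - δ)⁻¹ = -(δ - 1)⁻¹ := by rw [← inv_neg, neg_sub]
      rw [e3, e5, e6, e7]
      field_simp
      ring
    rcases h3 with ⟨h4, h5⟩ | ⟨h4, Q, hQ, h5, h6, h7⟩
    · rw [h4, h5, e1, e2, ← hsum]
      refine ⟨?_, ?_⟩
      · rw [← hcard]; norm_num
      · push_cast; ring
    · have hfin : (P '' (s : Set ℕ)).Finite := (Finset.finite_toSet _).image P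
      rw [h4, h5, finsum_mem_insert _ hQ hfin, finsum_mem_insert _ hQ hfin, e1, e2, h6, h7, ← hsum]
      refine ⟨?_, ?_⟩
      · rw [← hcard]; simp [add_comm]
      · push_cast; ring
  · push Not at hc
    obtain ⟨h3, h4, hP, hD⟩ := h1 hc
    have hne : ∀ j, j ≤ n + 1 → γ j ≠ 1 := by
      intro j hj
      rcases Nat.eq_zero_or_pos j with rfl | h5
      · exact h0
      · rcases Nat.lt_or_ge n j with h6 | h6
        · obtain rfl : j = n + 1 := by omega
          exact hN
        · exact hc j h5 h6
    rw [setOf_le_eq] at hP h4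
    obtain ⟨e1, e2⟩ := sum_index hn hf hP
      (fun k hk => hD k (by rw [Finset.mem_range] at hk; omega))
      (fun k hk => charValue_ne_zero (hne _ (by rw [Finset.mem_range] at hk; omega))
        (hne _ (by rw [Finset.mem_range] at hk; omega))) β
    rw [h3, h4, e1, e2, Finset.range_eq_Ico,
      sum_inv_charValue hδ1 hγ hγ0 (Nat.zero_le _) fun k _ hk => hne k hk]
    simp

/-- No inner term is `1`, so all `n + 1` points are present, each with multiplicity at least one,
and the characteristic value vanishes at one end of the chain. -/
theorem HasFixData.two_add_le (hn : 1 ≤ n) (hf : IsAut f) (hroot : ∀ m : ℕ, 0 < m → δ ^ m ≠ 1)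
    (hγ : ∀ j, γ (j + 1) = δ * γ j) (h : HasFixData f δ γ)
    (hex : γ 0 = 1 ∨ γ (n + 1) = 1) : (n : ℕ∞) + 2 ≤ muExc f := by
  obtain ⟨P, h1, -⟩ := h
  have hne : ∀ j, 1 ≤ j → j ≤ n → γ j ≠ 1 := fun j h2 h3 => by
    rcases hex with h | h
    · exact geom_ne_one hroot hγ h (by omega)
    · exact geom_ne_one hroot hγ h (by omega)
  obtain ⟨-, h4, hP, hD⟩ := h1 hne
  rw [setOf_le_eq] at hP h4
  obtain ⟨m, hm, hm0⟩ : ∃ m ≤ n, (1 - γ (m + 1)) * (1 - (γ m)⁻¹) = 0 := by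
    rcases hex with h | h
    · exact ⟨0, Nat.zero_le _, by rw [h]; simp⟩
    · exact ⟨n, le_rfl, by rw [h]; simp⟩
  have hge : ∀ k ≤ n, 1 ≤ muAt f (P k) := fun k hk => by
    have := (hD k hk).index hn hf
    by_cases e : (1 - γ (k + 1)) * (1 - (γ k)⁻¹) = 0
    · exact le_trans (by norm_num) (this.2 e)
    · exact (this.1 e).1.ge
  rw [muExc, h4, finsum_mem_image_finset hP]
  refine le_trans ?_ le_self_add
  have hmr : m ∈ Finset.range (n + 1) := by rw [Finset.mem_range]; omega
  rw [← Finset.add_sum_erase _ _ hmr, add_comm (n : ℕ∞)]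
  refine add_le_add (((hD m hm).index hn hf).2 hm0) ?_
  have : ∑ k ∈ (Finset.range (n + 1)).erase m, (1 : ℕ∞) = n := by
    rw [Finset.sum_const, Finset.card_erase_of_mem hmr, Finset.card_range, Nat.add_sub_cancel]
    simp
  rw [← this]
  refine Finset.sum_le_sum fun k hk => hge k ?_
  have := Finset.mem_of_mem_erase hk
  rw [Finset.mem_range] at this
  omega

end

/-! ### The index formulas -/

section
variable {β α : ℂ}

theorem gam_zero_eq (hβ : β ≠ 0) (hα : α ≠ 0) :
    gam n (β * α) (β * α⁻¹) 0 = α ^ (n + 1) / β ^ (n + 1) := by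
  have h : ((0 : ℕ) : ℤ) - n - 1 = -((n + 1 : ℕ) : ℤ) := by push_cast; ring
  rw [gam, h, zpow_neg, zpow_natCast, zpow_natCast, pow_zero, one_mul, mul_pow, inv_pow]
  have := pow_ne_zero (n + 1) hα
  field_simp

theorem gam_last_eq : gam n (β * α) (β * α⁻¹) (n + 1) = α ^ (n + 1) * β ^ (n + 1) := by
  have h : ((n + 1 : ℕ) : ℤ) - n - 1 = 0 := by push_cast; ring
  rw [gam, h, zpow_zero, zpow_natCast, mul_one, mul_pow, mul_comm]

/-- The denominator of the index formula in terms of `γ_0` and `γ_(n+1)`. -/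
theorem denom_identity {a b : ℂ} (ha : a ≠ 0) (hb : b ≠ 0) :
    (1 - a / b) * (1 - a * b) = -a * (b + b⁻¹ - (a + a⁻¹)) := by
  field_simp
  ring

theorem index_formula (hβ : β ≠ 0) (hα : α ≠ 0) (hβ1 : β ^ 2 ≠ 1)
    (h0 : gam n (β * α) (β * α⁻¹) 0 ≠ 1) (hN : gam n (β * α) (β * α⁻¹) (n + 1) ≠ 1) :
    H (n + 1) (β + β⁻¹) - (α ^ (n + 1) + (α⁻¹) ^ (n + 1)) ≠ 0 ∧
      β * ((β ^ 2 - 1)⁻¹ * ((1 - gam n (β * α) (β * α⁻¹) 0)⁻¹ -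
        (1 - gam n (β * α) (β * α⁻¹) (n + 1))⁻¹)) =
        K n (β + β⁻¹) / (H (n + 1) (β + β⁻¹) - (α ^ (n + 1) + (α⁻¹) ^ (n + 1))) := by
  have hK := K_add_inv n β hβ
  rw [H_add_inv _ _ hβ, gam_zero_eq hβ hα, gam_last_eq] at *
  simp only [inv_pow] at *
  have ha := pow_ne_zero (n + 1) hα
  have hb := pow_ne_zero (n + 1) hβ
  set a := α ^ (n + 1)
  set b := β ^ (n + 1)
  have e0 : 1 - a / b ≠ 0 := sub_ne_zero.2 h0.symm
  have eN : 1 - a * b ≠ 0 := sub_ne_zero.2 hN.symm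
  have hid := denom_identity ha hb
  have hne : b + b⁻¹ - (a + a⁻¹) ≠ 0 := fun e => mul_ne_zero e0 eN (by rw [hid, e, mul_zero])
  have hβs : β ^ 2 - 1 ≠ 0 := sub_ne_zero.2 hβ1
  refine ⟨hne, ?_⟩
  -- With `γ_0 = a / b` and `γ_(n+1) = a b` the numerator is `b - b⁻¹ = (β - β⁻¹) K_n`, and the
  -- remaining factor `β (β² - 1)⁻¹` cancels `β - β⁻¹`.
  have h1 : (1 - a / b)⁻¹ - (1 - a * b)⁻¹ = (b - b⁻¹) / (b + b⁻¹ - (a + a⁻¹)) := by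
    rw [inv_sub_inv e0 eN, hid, div_eq_div_iff (mul_ne_zero (neg_ne_zero.2 ha) hne) hne]
    ring
  have h2 : β * (β ^ 2 - 1)⁻¹ * (β - β⁻¹) = 1 := by
    field_simp
  rw [h1, ← hK]
  linear_combination (K n (β + β⁻¹) / (b + b⁻¹ - (a + a⁻¹))) * h2

/-- If `γ_i = 1`, then the denominator of the index formula is a product. -/
theorem denom_eq_of_gam_eq_one (hβ : β ≠ 0) (hα : α ≠ 0) {i : ℕ} (h1 : 1 ≤ i)
    (h2 : i ≤ n) (hi : gam n (β * α) (β * α⁻¹) i = 1) :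
    (H 2 (β + β⁻¹) - 2) * K (i - 1) (β + β⁻¹) * K (n - i) (β + β⁻¹) =
      H (n + 1) (β + β⁻¹) - (α ^ (n + 1) + (α⁻¹) ^ (n + 1)) := by
  have k1 := K_add_inv (i - 1) β hβ
  have k2 := K_add_inv (n - i) β hβ
  rw [Nat.sub_add_cancel h1] at k1
  have e0 := geom_eq (gam_succ (n := n) (mul_ne_zero hβ hα) (mul_ne_zero hβ (inv_ne_zero hα))) 0 i
  obtain ⟨m, rfl⟩ : ∃ m, n = m + i := ⟨n - i, by omega⟩
  rw [Nat.add_sub_cancel] at k2 ⊢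
  rw [zero_add, hi, gam_zero_eq hβ hα, show β * α * (β * α⁻¹) = β ^ 2 by field_simp] at e0
  have hB : β ^ (m + i + 1) = β ^ (m + 1) * β ^ i := by ring
  have hB2 : (β ^ 2) ^ i = β ^ i * β ^ i := by ring
  have hm := pow_ne_zero (m + 1) hβ
  have hi0 := pow_ne_zero i hβ
  -- The condition `γ_i = 1` eliminates `α`. What remains is the expansion of `(β^i - β^(-i))
  -- (β^(m+1) - β^(-(m+1)))`, with one factor `β - β⁻¹` for each `K`.
  have ha : α ^ (m + i + 1) = β ^ (m + 1) * (β ^ i)⁻¹ := by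
    rw [hB, hB2] at e0
    field_simp at e0 ⊢
    linear_combination -e0
  rw [H_add_inv _ _ hβ, H_add_inv _ _ hβ]
  simp only [inv_pow] at *
  rw [ha, hB]
  have e1 : β ^ 2 + (β ^ 2)⁻¹ - 2 = (β - β⁻¹) * (β - β⁻¹) := by
    field_simp; ring
  have e2 : ∀ x y z : ℂ, x * x * y * z = (x * y) * (x * z) := fun x y z => by ring
  rw [e1, e2, k1, k2]
  field_simp
  ring

theorem index_of_hasFixData (hn : 1 ≤ n) (hf : IsAut f) {δ : ℂ}
    (hroot : ∀ m : ℕ, 0 < m → δ ^ m ≠ 1) (hβ : β ^ 2 = δ) (hβ0 : β ≠ 0) (hα : α ≠ 0)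
    (h : HasFixData f δ (gam n (β * α) (β * α⁻¹))) :
    (isolatedFix f).Finite ∧
      (gam n (β * α) (β * α⁻¹) 0 ≠ 1 → gam n (β * α) (β * α⁻¹) (n + 1) ≠ 1 →
        muExc f = (n : ℕ∞) + 1 ∧
        H (n + 1) (β + β⁻¹) - (α ^ (n + 1) + (α⁻¹) ^ (n + 1)) ≠ 0 ∧
        nuHatExc f β =
          K n (β + β⁻¹) / (H (n + 1) (β + β⁻¹) - (α ^ (n + 1) + (α⁻¹) ^ (n + 1)))) ∧
      (gam n (β * α) (β * α⁻¹) 0 = 1 ∨ gam n (β * α) (β * α⁻¹) (n + 1) = 1 →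
        (n : ℕ∞) + 2 ≤ muExc f) := by
  have h₁ : β * α ≠ 0 := mul_ne_zero hβ0 hα
  have h₂ : β * α⁻¹ ≠ 0 := mul_ne_zero hβ0 (inv_ne_zero hα)
  have hγ : ∀ j, gam n (β * α) (β * α⁻¹) (j + 1) = δ * gam n (β * α) (β * α⁻¹) j := fun j => by
    rw [gam_succ h₁ h₂, ← hβ]; congr 1; field_simp
  refine ⟨h.finite hroot hγ, fun h0 hN => ?_, h.two_add_le hn hf hroot hγ⟩
  obtain ⟨e1, e2⟩ := h.index hn hf hroot hγ (gam_ne_zero h₁ h₂) h0 hN hβ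
  obtain ⟨e3, e4⟩ := index_formula hβ0 hα (by rw [hβ]; simpa using hroot 1 one_pos) h0 hN
  rw [← hβ, e4] at e2
  exact ⟨e1, e3, e2⟩

end

end AnResolution

/-! ### The main theorem -/

open AnResolution in
theorem theorem6p1 (n : ℕ) (hn : 1 ≤ n) (f : X n → X n) (hf : IsAut f)
    (hsym : HasTrivialSymmetry f) (δ : ℂ) (hδ : HasTwist f δ)
    (hroot : ∀ m : ℕ, 0 < m → δ ^ m ≠ 1) (β α : ℂ) (hβ : β ^ 2 = δ) (hα : α ≠ 0)
    (hmul : HasMultipliers f (β * α) (β * α⁻¹)) :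
    (isolatedFix f).Finite ∧
    -- case (C1)
    ((∀ j ≤ n + 1, gam n (β * α) (β * α⁻¹) j ≠ 1) →
      muExc f = (n : ℕ∞) + 1 ∧
      H (n + 1) (β + β⁻¹) - (α ^ (n + 1) + (α⁻¹) ^ (n + 1)) ≠ 0 ∧
      nuHatExc f β =
        K n (β + β⁻¹) / (H (n + 1) (β + β⁻¹) - (α ^ (n + 1) + (α⁻¹) ^ (n + 1)))) ∧
    -- case (C2)
    (∀ i : ℕ, 1 ≤ i → i ≤ n → gam n (β * α) (β * α⁻¹) i = 1 →
      muExc f = (n : ℕ∞) + 1 ∧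
      (H 2 (β + β⁻¹) - 2) * K (i - 1) (β + β⁻¹) * K (n - i) (β + β⁻¹) ≠ 0 ∧
      nuHatExc f β =
        K n (β + β⁻¹) / ((H 2 (β + β⁻¹) - 2) * K (i - 1) (β + β⁻¹) * K (n - i) (β + β⁻¹))) ∧
    -- case (C3)
    (gam n (β * α) (β * α⁻¹) 0 = 1 ∨ gam n (β * α) (β * α⁻¹) (n + 1) = 1 →
      (n : ℕ∞) + 2 ≤ muExc f) := by
  have hδ1 : δ ≠ 1 := by simpa using hroot 1 one_pos
  have hδ0 := twist_ne_zero hn hf hδ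
  have hβ0 : β ≠ 0 := by
    rintro rfl
    exact hδ0 (by rw [← hβ]; simp)
  have hprod : β * α * (β * α⁻¹) = δ := by rw [← hβ]; field_simp
  have key : (isolatedFix f).Finite ∧
      (gam n (β * α) (β * α⁻¹) 0 ≠ 1 → gam n (β * α) (β * α⁻¹) (n + 1) ≠ 1 →
        muExc f = (n : ℕ∞) + 1 ∧
        H (n + 1) (β + β⁻¹) - (α ^ (n + 1) + (α⁻¹) ^ (n + 1)) ≠ 0 ∧
        nuHatExc f β =
          K n (β + β⁻¹) / (H (n + 1) (β + β⁻¹) - (α ^ (n + 1) + (α⁻¹) ^ (n + 1)))) ∧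
      (gam n (β * α) (β * α⁻¹) 0 = 1 ∨ gam n (β * α) (β * α⁻¹) (n + 1) = 1 →
        (n : ℕ∞) + 2 ≤ muExc f) := by
    rcases hasFixData hn hf hsym hδ hδ1 hprod hmul with h | h
    · exact index_of_hasFixData hn hf hroot hβ hβ0 hα h
    -- Exchanging the multipliers replaces `α` by `α⁻¹`. The denominator is symmetric in the two,
    -- and the end conditions on `γ_0` and `γ_(n+1)` are interchanged.
    · have e0 := gam_swap (n := n) (α₁ := β * α) (α₂ := β * α⁻¹) (Nat.zero_le (n + 1))
      have eN := gam_swap (n := n) (α₁ := β * α) (α₂ := β * α⁻¹) (le_refl (n + 1))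
      rw [Nat.sub_zero] at e0
      rw [Nat.sub_self] at eN
      have := index_of_hasFixData (α := α⁻¹) hn hf hroot hβ hβ0 (inv_ne_zero hα)
        (by rw [inv_inv]; exact h)
      rw [inv_inv, e0, eN, add_comm (α⁻¹ ^ (n + 1)), inv_eq_one, inv_eq_one, Ne, Ne, inv_eq_one,
        inv_eq_one] at this
      exact ⟨this.1, fun h0 hN => this.2.1 hN h0, fun h => this.2.2 h.symm⟩
  obtain ⟨k1, k2, k3⟩ := key
  refine ⟨k1, fun h => k2 (h 0 (Nat.zero_le _)) (h (n + 1) le_rfl), fun i h1 h2 hi => ?_, k3⟩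
  have hne : ∀ j, j ≠ i → gam n (β * α) (β * α⁻¹) j ≠ 1 := fun j hj =>
    geom_ne_one hroot (fun j => by
      rw [gam_succ (mul_ne_zero hβ0 hα) (mul_ne_zero hβ0 (inv_ne_zero hα)), hprod]) hi hj
  -- The general formula requires only the two end terms to differ from `1`, so this case is the
  -- same value with the denominator factored.
  rw [denom_eq_of_gam_eq_one hβ0 hα h1 h2 hi]
  exact k2 (hne 0 (by omega)) (hne (n + 1) (by omega))

end
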